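/- Let $N\ge 2$ and let $\Omega\subset\mathbb R^N$ be a smooth bounded domain (open and connected). Let $W^{1,1}(\Omega;\mathbb S^1)=\{u\in W^{1,1}(\Omega;\mathbb C):\ |u|=1\text{ a.e.}\}$, and for a complex-valued $u$ let $|\nabla u|=\big(\sum_{j}|\partial_j u|^2\big)^{1/2}$. For $u,v\in W^{1,1}(\Omega;\mathbb S^1)$ write $u\sim v$ if $u=e^{i\varphi}v$ a.e. for some $\varphi\in W^{1,1}(\Omega;\mathbb R)$, let $\mathcal E(u)$ be the equivalence class of $u$, and let $\mathcal E=\mathcal E(1)=\{e^{i\varphi}:\varphi\in W^{1,1}(\Omega;\mathbb R)\}$. Set $$\Sigma(u)=\inf_{\varphi\in W^{1,1}(\Omega;\mathbb R)}\int_\Omega|\nabla(ue^{-i\varphi})|,\qquad d_{W^{1,1}}(u,\mathcal E(v_0))=\inf_{v\sim v_0}\int_\Omega|\nabla(u-v)|,$$ $$\operatorname{dist}_{W^{1,1}}(\mathcal E(u_0),\mathcal E(v_0))=\inf_{u\sim u_0}d_{W^{1,1}}(u,\mathcal E(v_0)),\qquad \operatorname{Dist}_{W^{1,1}}(\mathcal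 E(u_0),\mathcal E(v_0))=\sup_{u\sim u_0}d_{W^{1,1}}(u,\mathcal E(v_0)).$$ Then for all $u_0,v_0\in W^{1,1}(\Omega;\mathbb S^1)$, $$\operatorname{dist}_{W^{1,1}}(\mathcal E(u_0),\mathcal E(v_0))=\frac{2}{\pi}\,\Sigma(u_0\bar v_0),\qquad \operatorname{Dist}_{W^{1,1}}(\mathcal E(u_0),\mathcal E(v_0))=\Sigma(u_0\bar v_0),$$ and $\operatorname{Dist}_{W^{1,1}}(\mathcal E(u_0),\mathcal E(v_0))=\operatorname{Dist}_{W^{1,1}}(\mathcal E(v_0),\mathcal E(u_0))$. In particular, for every $u\in W^{1,1}(\Omega;\mathbb S^1)$, $$\frac{2}{\pi}\,\Sigma(u)\le d_{W^{1,1}}(u,\mathcal E)\le\Sigma(u),$$ and these constants are optimal: $$\sup_{u\in W^{1,1}(\Omega;\mathbb S^1)\setminus\mathcal E}\frac{d_{W^{1,1}}(u,\mathcal E)}{\Sigma(u)}=1,\qquad \inf_{u\in W^{1,1}(\Omega;\mathbb S^1)\setminus\mathcal E}\frac{d_{W^{1,1}}(u,\mathcal E)}{\Sigma(u)}=\frac{2}{\pi}.$$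 -/

import Mathlib

open MeasureTheory Set
open scoped ContDiff ENNReal ComplexConjugate

noncomputable section

namespace CircleSobolev

/-- `ℝ^N` with its Euclidean norm and Lebesgue measure. -/
abbrev Space (N : ℕ) : Type := EuclideanSpace ℝ (Fin N)

/-- A smooth bounded domain: bounded, open, connected (and nonempty), and near each boundary point
the set of points where a smooth function with nonzero differential at that point is negative. -/
structure IsSmoothBoundedDomain {N : ℕ} (Ω : Set (Space N)) : Prop where
  isOpen : IsOpen Ω
  isConnected : IsConnected Ω
  isBounded : Bornology.IsBounded Ω
  smooth_boundary : ∀ x ∈ frontier Ω, ∃ (U : Set (Space N)) (ρ : Space N → ℝ),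
    IsOpen U ∧ x ∈ U ∧ ContDiff ℝ ∞ ρ ∧ fderiv ℝ ρ x ≠ 0 ∧ ∀ y ∈ U, y ∈ Ω ↔ ρ y < 0

section Weak

variable {N : ℕ} {𝕜 : Type*} [RCLike 𝕜]

/-- `G = (∂₁u, …, ∂_N u)` in the sense of distributions on `Ω`, for `u` real- or complex-valued.
For a complex-valued `u` the norm of `G x` in `EuclideanSpace ℂ (Fin N)` is
`(∑ⱼ |∂ⱼu|²)^(1/2)`, the Euclidean norm of the gradient of `u` viewed as a map to `ℝ²`. -/
structure HasWeakGradient (Ω : Set (Space N)) (u : Space N → 𝕜)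
    (G : Space N → EuclideanSpace 𝕜 (Fin N)) : Prop where
  locallyIntegrableOn : LocallyIntegrableOn u Ω
  locallyIntegrableOn_grad : LocallyIntegrableOn G Ω
  integral_eq : ∀ η : Space N → ℝ, ContDiff ℝ ∞ η → HasCompactSupport η → tsupport η ⊆ Ω →
    ∀ j : Fin N, ∫ x in Ω, (fderiv ℝ η x (EuclideanSpace.single j 1)) • u x
      = - ∫ x in Ω, η x • G x j

/-- The weak gradient is unique up to null sets. -/
theorem HasWeakGradient.ae_eq {Ω : Set (Space N)} (hΩ : IsOpen Ω) {u : Space N → 𝕜}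
    {G H : Space N → EuclideanSpace 𝕜 (Fin N)}
    (hG : HasWeakGradient Ω u G) (hH : HasWeakGradient Ω u H) :
    G =ᵐ[volume.restrict Ω] H := by
  have key : ∀ j : Fin N, ∀ᵐ x ∂(volume : Measure (Space N)), x ∈ Ω → G x j - H x j = 0 := by
    intro j
    have comp : ∀ K : Space N → EuclideanSpace 𝕜 (Fin N), LocallyIntegrableOn K Ω →
        LocallyIntegrableOn (fun x => K x j) Ω := by
      intro K hK
      exact fun x hx => by
        obtain ⟨s, hs, hi⟩ := hK x hx
        exact ⟨s, hs, (EuclideanSpace.proj j : EuclideanSpace 𝕜 (Fin N) →L[𝕜] 𝕜).integrable_comp hi⟩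
    have hGj := comp G hG.locallyIntegrableOn_grad
    have hHj := comp H hH.locallyIntegrableOn_grad
    refine hΩ.ae_eq_zero_of_integral_contDiff_smul_eq_zero (hGj.sub hHj) ?_
    intro η hη hc hs
    have e := (hG.integral_eq η hη hc hs j).symm.trans (hH.integral_eq η hη hc hs j)
    have e' := neg_injective e
    have int : ∀ f : Space N → 𝕜, LocallyIntegrableOn f Ω →
        Integrable (fun x => η x • f x) := by
      intro f hf
      have h1 : IntegrableOn f (tsupport η) := hf.integrableOn_compact_subset hs hc
      have h2 : IntegrableOn (fun x => η x • f x) (tsupport η) :=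
        h1.continuousOn_smul hη.continuous.continuousOn hc
      refine (integrableOn_iff_integrable_of_support_subset ?_).1 h2
      intro x hx
      refine subset_tsupport η ?_
      intro h0
      exact hx (by simp [h0])
    have full : ∀ f : Space N → 𝕜, ∫ x in Ω, η x • f x = ∫ x, η x • f x := by
      intro f
      refine setIntegral_eq_integral_of_forall_compl_eq_zero ?_
      intro x hx
      have : η x = 0 := image_eq_zero_of_notMem_tsupport (fun h => hx (hs h))
      simp [this]
    rw [full, full] at e'
    simp only [smul_sub]
    rw [integral_sub (int _ hGj) (int _ hHj), e', sub_self]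
  refine (ae_restrict_iff' hΩ.measurableSet).2 ?_
  filter_upwards [ae_all_iff.2 key] with x hx hxΩ
  ext j
  exact sub_eq_zero.1 (hx j hxΩ)

open Classical in
/-- The weak gradient `∇u` on `Ω` (and `0` if `u` is not weakly differentiable on `Ω`). -/
def weakGradient (Ω : Set (Space N)) (u : Space N → 𝕜) : Space N → EuclideanSpace 𝕜 (Fin N) :=
  if h : ∃ G, HasWeakGradient Ω u G then h.choose else 0

theorem weakGradient_spec {Ω : Set (Space N)} {u : Space N → 𝕜}
    (h : ∃ G, HasWeakGradient Ω u G) : HasWeakGradient Ω u (weakGradient Ω u) := by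
  rw [weakGradient, dif_pos h]
  exact h.choose_spec

/-- `u ∈ W^{1,1}(Ω; 𝕜)`. -/
def MemW11 (Ω : Set (Space N)) (u : Space N → 𝕜) : Prop :=
  IntegrableOn u Ω ∧ ∃ G, HasWeakGradient Ω u G ∧ IntegrableOn G Ω

/-- `∫_Ω |∇u|`. -/
def gradEnergy (Ω : Set (Space N)) (u : Space N → 𝕜) : ℝ≥0∞ :=
  ∫⁻ x in Ω, ‖weakGradient Ω u x‖ₑ

end Weak

variable {N : ℕ}

/-- `W^{1,1}(Ω; 𝕊¹)`; maps are functions on the whole space, of which only the values almost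
everywhere on `Ω` matter. -/
def W11Circle (Ω : Set (Space N)) : Set (Space N → ℂ) :=
  {u | MemW11 Ω u ∧ ∀ᵐ x ∂(volume.restrict Ω), ‖u x‖ = 1}

/-- The class `𝓔` of the maps `e^{iφ}`, `φ ∈ W^{1,1}(Ω; ℝ)`. -/
def liftable (Ω : Set (Space N)) : Set (Space N → ℂ) :=
  {u | u ∈ W11Circle Ω ∧ ∃ φ : Space N → ℝ, MemW11 Ω φ ∧
    u =ᵐ[volume.restrict Ω] fun x => Complex.exp (Complex.I * (φ x : ℂ))}

/-- The relation `u ∼ v`: `u = e^{iφ} v` for some `φ ∈ W^{1,1}(Ω; ℝ)`. -/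
def Equivalent (Ω : Set (Space N)) (u v : Space N → ℂ) : Prop :=
  ∃ φ : Space N → ℝ, MemW11 Ω φ ∧
    u =ᵐ[volume.restrict Ω] fun x => Complex.exp (Complex.I * (φ x : ℂ)) * v x

/-- The equivalence class `𝓔(u₀)`. -/
def equivClass (Ω : Set (Space N)) (u₀ : Space N → ℂ) : Set (Space N → ℂ) :=
  {u | u ∈ W11Circle Ω ∧ Equivalent Ω u u₀}

/-- `Σ(u)`, the infimum of `∫_Ω |∇(u e^{-iφ})|` over `φ ∈ W^{1,1}(Ω; ℝ)`. -/
def Sig (Ω : Set (Space N)) (u : Space N → ℂ) : ℝ≥0∞ :=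
  ⨅ (φ : Space N → ℝ) (_ : MemW11 Ω φ),
    gradEnergy Ω fun x => u x * Complex.exp (-(Complex.I * (φ x : ℂ)))

/-- `d_{W^{1,1}}(u, B)`, the infimum of `∫_Ω |∇(u - v)|` over `v ∈ B`. -/
def distTo (Ω : Set (Space N)) (u : Space N → ℂ) (B : Set (Space N → ℂ)) : ℝ≥0∞ :=
  ⨅ v ∈ B, gradEnergy Ω fun x => u x - v x

/-- `dist_{W^{1,1}}(A, B)`. -/
def distInf (Ω : Set (Space N)) (A B : Set (Space N → ℂ)) : ℝ≥0∞ :=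
  ⨅ u ∈ A, distTo Ω u B

/-- `Dist_{W^{1,1}}(A, B)`, the one-sided Hausdorff distance. -/
def distSup (Ω : Set (Space N)) (A B : Set (Space N → ℂ)) : ℝ≥0∞ :=
  ⨆ u ∈ A, distTo Ω u B

end CircleSobolev

end

/-! Since |u|² = 1, each ∂ⱼu is tangent to the circle, so ∇u = i u a for a real integrable field a
(`exists_isCircleMap`). Products add these fields, conjugation negates them, and a factor e^{iφ}
adds ∇φ; hence Σ(u) is the infimum of ∫|c| over circle maps w ∼ u with ∇w = i w c. The main freedom
is this: if f is C¹ and 2π-periodic, then f(arg w) is an admissible phase even when arg w is not. So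
w may be composed with any degree-one map of the circle having derivative ρ, without leaving its
class, and c becomes ρ(arg w) c.

Lower bound for dist. If θ is the angle of w = u v̄ and a, b are the fields of u, v, then |∇(u − v)|
≥ |cos(θ/2)| |a − b|. The right side is 2/π times the gradient of w reparametrised with density
(π/2)|cos(s/2)|, so its integral is at least (2/π) Σ(u v̄) (`two_div_pi_mul_Sig_le`).

Upper bounds. Take w ∼ u₀ v̄₀ nearly optimal and reparametrise it so that the result W equals 1
unless arg w is close to some t. Put v = u W̄. In ∇(u − v) the field of u₀ enters only where W ≠ 1,
and averaging over t makes that contribution small. With u fixed, the part coming from c averages to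
at most ∫|c|, which gives d(u, 𝓔(v₀)) ≤ Σ. Sharing the jump equally between u and v lowers the
factor to the mean of |cos(s/2)|, namely 2/π (`exists_pair`, `integral_windMap_half`).

Lower bound for Dist. Let u = u₀ e with e = e^{iδ sin(k xᵢ)}, δ small and k large. If v is a
competitor of bounded energy, s = ū₀ v and g = e − s, then ∂ᵢg controls δk |cos(k xᵢ)| times the
sine of the angle between e and s. Oscillation integrals then force g to be small in a weighted L²
sense (`exists_frequency`). So ∫|∇(u − v)| is nearly ∫|∇g|, and as e is uniformly close to 1,
projecting s + (1 − e) radially shows that ∫|∇g| is at least almost Σ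
(`Sig_mul_conj_le_of_near_one`).

Optimality. Within one class Σ is constant, so the extremal ratios are Dist/Σ = 1 and dist/Σ = 2/π
as soon as Σ ≠ 0. By a Poincaré inequality Σ(u) = 0 only for liftable u, and a vortex (xᵢ + i
xⱼ)/|xᵢ + i xⱼ| centred in Ω is not liftable, since its phase gradient has nonzero distributional
curl. -/

noncomputable section

namespace CircleSobolev

open Filter Topology
open scoped Convolution

/-! ### Vector-valued weak partial derivatives -/

section WeakPartials

variable {N : ℕ} {E : Type*} [NormedAddCommGroup E] [NormedSpace ℝ E]

omit [NormedSpace ℝ E] in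
/-- `L¹`-continuity of translations. -/
theorem tendsto_lintegral_translate_sub {U : Space N → E} (hU : Integrable U) :
    Tendsto (fun y => ∫⁻ x, ‖U (x - y) - U x‖ₑ) (𝓝 0) (𝓝 0) := by
  have hm : MemLp U 1 volume := memLp_one_iff_integrable.2 hU
  set F := hm.toLp U with hF
  -- Translations depend continuously on y in the compact-open topology, so the claim is continuity
  -- in L¹ of composition with measure-preserving maps, at y = 0.
  let g : Space N → C(Space N, Space N) := fun y => ⟨fun x => x - y, by fun_prop⟩
  have hg : Continuous g := by
    refine ContinuousMap.continuous_of_continuous_uncurry _ ?_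
    show Continuous fun p : Space N × Space N => p.2 - p.1
    fun_prop
  have hmp : ∀ y, MeasurePreserving (g y) (volume : Measure (Space N)) volume :=
    fun y => measurePreserving_sub_right volume y
  have key := Filter.Tendsto.compMeasurePreservingLp (l := 𝓝 (0 : Space N)) (f := fun _ => F)
    (f₀ := F) (g := g) (g₀ := g 0) (p := 1) tendsto_const_nhds hg.continuousAt hmp (hmp 0)
    ENNReal.one_ne_top
  rw [tendsto_iff_edist_tendsto_0] at key
  refine key.congr fun y => ?_
  rw [Lp.edist_def, eLpNorm_one_eq_lintegral_enorm]
  refine lintegral_congr_ae ?_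
  have h1 := Lp.coeFn_compMeasurePreserving F (hmp y)
  have h2 := Lp.coeFn_compMeasurePreserving F (hmp 0)
  have h3 := (hmp y).quasiMeasurePreserving.ae (hm.coeFn_toLp)
  have h4 := (hmp 0).quasiMeasurePreserving.ae (hm.coeFn_toLp)
  filter_upwards [h1, h2, h3, h4] with x h1 h2 h3 h4
  simp only [Pi.sub_apply, h1, h2, Function.comp]
  rw [h3, h4]
  simp [g]

/-- `g = (∂₁u, …, ∂_N u)` in the sense of distributions, for vector valued maps. -/
structure HasWeakPartials (Ω : Set (Space N)) (u : Space N → E) (g : Fin N → Space N → E) :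
    Prop where
  loc : LocallyIntegrableOn u Ω
  loc_partial : ∀ j, LocallyIntegrableOn (g j) Ω
  integral_eq : ∀ η : Space N → ℝ, ContDiff ℝ ∞ η → HasCompactSupport η → tsupport η ⊆ Ω →
    ∀ j : Fin N, ∫ x in Ω, (fderiv ℝ η x (EuclideanSpace.single j 1)) • u x
      = - ∫ x in Ω, η x • g j x

theorem _root_.MeasureTheory.LocallyIntegrableOn.clm_comp {X F : Type*} [TopologicalSpace X]
    [MeasurableSpace X] {μ : Measure X} [NormedAddCommGroup F] [NormedSpace ℝ F] {s : Set X}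
    {f : X → E} (L : E →L[ℝ] F) (hf : LocallyIntegrableOn f s μ) :
    LocallyIntegrableOn (fun x => L (f x)) s μ := fun x hx => by
  obtain ⟨t, ht, hi⟩ := hf x hx
  exact ⟨t, ht, L.integrable_comp hi⟩

section Grad

variable {𝕜 : Type*} [RCLike 𝕜]

theorem locallyIntegrableOn_euclidean_iff {s : Set (Space N)}
    {G : Space N → EuclideanSpace 𝕜 (Fin N)} :
    LocallyIntegrableOn G s ↔ ∀ j, LocallyIntegrableOn (fun x => G x j) s := by
  constructor
  · intro h j x hx
    obtain ⟨t, ht, hi⟩ := h x hx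
    exact ⟨t, ht, (EuclideanSpace.proj j : EuclideanSpace 𝕜 (Fin N) →L[𝕜] 𝕜).integrable_comp hi⟩
  · intro h x hx
    choose t ht hi using fun j => h j x hx
    refine ⟨⋂ j, t j, iInter_mem.2 ht, ?_⟩
    have : G = fun x => ∑ j, EuclideanSpace.single j (G x j) := by
      funext x; ext i; simp [Finset.sum_apply, Pi.single_apply]
    rw [this]
    refine integrable_finsetSum _ fun j _ => ?_
    have h1 : IntegrableOn (fun x => G x j) (⋂ j, t j) := (hi j).mono_set (iInter_subset _ j)
    refine h1.norm.mono' ?_ (by simp)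
    have hc : Continuous (fun z : 𝕜 => (EuclideanSpace.single j z : EuclideanSpace 𝕜 (Fin N))) := by
      exact (PiLp.continuous_toLp 2 _).comp (continuous_single (A := fun _ : Fin N => 𝕜) j)
    exact hc.comp_aestronglyMeasurable h1.1

/-- The bridge from Euclidean gradients to families of partials. The latter make sense in any real
normed space, so pairs, linear images and compositions can be treated uniformly. -/
theorem hasWeakGradient_iff {Ω : Set (Space N)} {u : Space N → 𝕜}
    {G : Space N → EuclideanSpace 𝕜 (Fin N)} :
    HasWeakGradient Ω u G ↔ HasWeakPartials Ω u fun j x => G x j :=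
  ⟨fun h => ⟨h.1, locallyIntegrableOn_euclidean_iff.1 h.2, h.3⟩,
    fun h => ⟨h.1, locallyIntegrableOn_euclidean_iff.2 h.2, h.3⟩⟩

end Grad

theorem setIntegral_smul_eq_integral {Ω : Set (Space N)} {η : Space N → ℝ} (hs : tsupport η ⊆ Ω)
    (f : Space N → E) : ∫ x in Ω, η x • f x = ∫ x, η x • f x := by
  refine setIntegral_eq_integral_of_forall_compl_eq_zero fun x hx => ?_
  have : η x = 0 := image_eq_zero_of_notMem_tsupport fun h => hx (hs h)
  simp [this]

theorem setIntegral_smul_eq_setIntegral {Ω K : Set (Space N)} {η : Space N → ℝ}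
    (hs : tsupport η ⊆ Ω) (hK : tsupport η ⊆ K)
    (f : Space N → E) : ∫ x in Ω, η x • f x = ∫ x in K, η x • f x := by
  rw [setIntegral_smul_eq_integral hs, setIntegral_smul_eq_integral hK]

theorem tsupport_fderiv_apply_subset {η : Space N → ℝ} (v : Space N) :
    tsupport (fun x => fderiv ℝ η x v) ⊆ tsupport η := by
  refine closure_minimal (fun x hx => ?_) (isClosed_tsupport η)
  by_contra h
  refine hx ?_
  have := fderiv_of_notMem_tsupport (𝕜 := ℝ) h
  simp [this]

end WeakPartials

/-! ### Smooth approximation on compact sets -/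

section Mollification

variable {N : ℕ} {E : Type*} [NormedAddCommGroup E] [NormedSpace ℝ E] [CompleteSpace E]

/-- The kernel has mass one, so the error at x is at most the kernel average of |U(x − t) − U(x)|.
After Fubini only translations by t in the shrinking support remain. -/
theorem tendsto_lintegral_mollify {φ : ℕ → ContDiffBump (0 : Space N)}
    (hφ : Tendsto (fun n => (φ n).rOut) atTop (𝓝 0)) {U : Space N → E} (hU : Integrable U) :
    Tendsto (fun n => ∫⁻ x, ‖((φ n).normed volume ⋆[ContinuousLinearMap.lsmul ℝ ℝ, volume] U) x
      - U x‖ₑ) atTop (𝓝 0) := by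
  have hω := tendsto_lintegral_translate_sub hU
  rw [ENNReal.tendsto_nhds_zero] at hω ⊢
  intro ε hε
  obtain ⟨r, hr, hball⟩ := Metric.eventually_nhds_iff.1 (hω ε hε)
  filter_upwards [hφ.eventually (gt_mem_nhds hr)] with n hn
  set ρ := (φ n).normed (volume : Measure (Space N)) with hρ
  have hρc : Continuous ρ := (φ n).continuous_normed
  have hρs : HasCompactSupport ρ := (φ n).hasCompactSupport_normed
  have hρi : Integrable ρ := hρc.integrable_of_hasCompactSupport hρs
  have hpt : ∀ x, ‖(ρ ⋆[ContinuousLinearMap.lsmul ℝ ℝ, volume] U) x - U x‖ₑ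
      ≤ ∫⁻ t, ‖ρ t‖ₑ * ‖U (x - t) - U x‖ₑ := by
    intro x
    have h1 : Integrable fun t => ρ t • U (x - t) := by
      have := (hρs.convolutionExists_left (ContinuousLinearMap.lsmul ℝ ℝ) hρc
        hU.locallyIntegrable (μ := volume) (g := U)) x
      simpa [ConvolutionExistsAt] using this
    have h2 : Integrable fun t => ρ t • U x := hρi.smul_const _
    have h3 : ∫ t, ρ t • U x = U x := by
      rw [integral_smul_const, (φ n).integral_normed, one_smul]
    have h4 : (ρ ⋆[ContinuousLinearMap.lsmul ℝ ℝ, volume] U) x - U x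
        = ∫ t, ρ t • (U (x - t) - U x) := by
      simp_rw [smul_sub]
      rw [integral_sub h1 h2, h3]
      simp [convolution]
    rw [h4]
    refine (enorm_integral_le_lintegral_enorm _).trans (le_of_eq ?_)
    simp_rw [enorm_smul]
  calc ∫⁻ x, ‖(ρ ⋆[ContinuousLinearMap.lsmul ℝ ℝ, volume] U) x - U x‖ₑ
      ≤ ∫⁻ x, ∫⁻ t, ‖ρ t‖ₑ * ‖U (x - t) - U x‖ₑ := lintegral_mono hpt
    _ = ∫⁻ t, ∫⁻ x, ‖ρ t‖ₑ * ‖U (x - t) - U x‖ₑ := by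
        refine lintegral_lintegral_swap ?_
        have ha : AEStronglyMeasurable (fun p : Space N × Space N => U (p.1 - p.2))
            (volume.prod volume) :=
          hU.1.comp_quasiMeasurePreserving (quasiMeasurePreserving_sub volume volume)
        have hb : AEStronglyMeasurable (fun p : Space N × Space N => U p.1)
            (volume.prod volume) := hU.1.comp_fst
        exact ((hρc.comp continuous_snd).aestronglyMeasurable.enorm).mul (ha.sub hb).enorm
    _ = ∫⁻ t, ‖ρ t‖ₑ * ∫⁻ x, ‖U (x - t) - U x‖ₑ := by
        refine lintegral_congr fun t => ?_
        rw [lintegral_const_mul' _ _ enorm_ne_top]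
    _ ≤ ∫⁻ t, ‖ρ t‖ₑ * ε := by
        refine lintegral_mono fun t => ?_
        by_cases ht : ρ t = 0
        · simp [ht]
        · have : t ∈ Function.support ρ := ht
          rw [hρ, (φ n).support_normed_eq] at this
          have h5 : dist t 0 < r := (Metric.mem_ball.1 this).trans hn
          exact mul_le_mul_right (hball h5) _
    _ = ε := by
        have : ∫⁻ t, ‖ρ t‖ₑ = 1 := by
          rw [← ofReal_integral_norm_eq_lintegral_enorm hρi]
          have : ∀ t, ‖ρ t‖ = ρ t := fun t => Real.norm_of_nonneg ((φ n).nonneg_normed t)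
          simp_rw [this]
          rw [(φ n).integral_normed, ENNReal.ofReal_one]
        rw [lintegral_mul_const'' _ hρc.aestronglyMeasurable.enorm, this, one_mul]

/-- Mollify u cut off to a compact neighbourhood K' of K. For kernels of small radius the cut-off is
invisible from K, and there the derivative of the mollification is the mollification of the weak
partial. -/
theorem HasWeakPartials.exists_smooth_approx {Ω K : Set (Space N)} {u : Space N → E}
    {g : Fin N → Space N → E} (hΩ : IsOpen Ω) (h : HasWeakPartials Ω u g) (hK : IsCompact K)
    (hKΩ : K ⊆ Ω) : ∃ v : ℕ → Space N → E, (∀ n, ContDiff ℝ ∞ (v n)) ∧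
      (∀ᵐ x ∂(volume.restrict K), Tendsto (fun n => v n x) atTop (𝓝 (u x))) ∧
      Tendsto (fun n => ∫⁻ x in K, ‖v n x - u x‖ₑ) atTop (𝓝 0) ∧
      ∀ j, Tendsto (fun n => ∫⁻ x in K, ‖fderiv ℝ (v n) x (EuclideanSpace.single j 1) - g j x‖ₑ)
        atTop (𝓝 0) := by
  obtain ⟨K', hK', hKK', hK'Ω⟩ := exists_compact_between hK hΩ hKΩ
  obtain ⟨δ, hδ, hδK⟩ := hK.exists_cthickening_subset_open isOpen_interior hKK'
  have hKK : K ⊆ K' := hKK'.trans interior_subset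
  have hind : ∀ f : Space N → E, LocallyIntegrableOn f Ω → Integrable (K'.indicator f) :=
    fun f hf => (integrable_indicator_iff hK'.measurableSet).2
      (hf.integrableOn_compact_subset hK'Ω hK')
  have hres : ∀ (f : Space N → E), ∀ x ∈ K, K'.indicator f x = f x :=
    fun f x hx => indicator_of_mem (hKK hx) f
  -- Outer radii at most δ keep the kernels centred on K inside K'; the fixed ratio 2 to the inner
  -- radii is what almost everywhere convergence requires.
  let φ : ℕ → ContDiffBump (0 : Space N) := fun n =>
    ⟨δ / (2 * (n + 1)), δ / (n + 1), by positivity, by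
      apply div_lt_div_of_pos_left hδ (by positivity); linarith [n.cast_nonneg (α := ℝ)]⟩
  have hφ : Tendsto (fun n => (φ n).rOut) atTop (𝓝 0) := by
    show Tendsto (fun n : ℕ => δ / ((n : ℝ) + 1)) atTop (𝓝 0)
    have := (tendsto_one_div_add_atTop_nhds_zero_nat (𝕜 := ℝ)).const_mul δ
    simpa [div_eq_mul_inv] using this
  have hφδ : ∀ n, (φ n).rOut ≤ δ := fun n => by
    show δ / ((n : ℝ) + 1) ≤ δ
    exact div_le_self hδ.le (by linarith [n.cast_nonneg (α := ℝ)])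
  set U := K'.indicator u with hU
  have hUi : Integrable U := hind u h.loc
  have hfd : ∀ n j, ∀ x ∈ K,
      fderiv ℝ ((φ n).normed volume ⋆[ContinuousLinearMap.lsmul ℝ ℝ, volume] U) x
        (EuclideanSpace.single j 1)
      = ((φ n).normed volume ⋆[ContinuousLinearMap.lsmul ℝ ℝ, volume] (K'.indicator (g j))) x := by
    intro n j x hx
    set ρ := (φ n).normed (volume : Measure (Space N)) with hρ
    have hρd : ContDiff ℝ ∞ ρ := (φ n).contDiff_normed
    have hρs : HasCompactSupport ρ := (φ n).hasCompactSupport_normed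
    have hd := hρs.hasFDerivAt_convolution_left (ContinuousLinearMap.lsmul ℝ ℝ) (μ := volume)
      (hρd.of_le (by norm_cast)) hUi.locallyIntegrable x
    rw [hd.fderiv]
    -- The reflected kernel serves as test function; the sign from the reflection cancels the sign
    -- of integration by parts.
    let η : Space N → ℝ := fun y => ρ (x - y)
    have hηd : ContDiff ℝ ∞ η := hρd.comp (contDiff_const.sub contDiff_id)
    have hηs : tsupport η ⊆ Metric.closedBall x δ := by
      refine closure_minimal (fun y hy => ?_) Metric.isClosed_closedBall
      have : x - y ∈ Function.support ρ := hy
      rw [hρ, (φ n).support_normed_eq] at this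
      have h1 := (Metric.mem_ball.1 this).le.trans (hφδ n)
      rw [Metric.mem_closedBall, dist_comm, dist_eq_norm]
      simpa using h1
    have hηK : tsupport η ⊆ K' := (hηs.trans (Metric.closedBall_subset_cthickening hx δ)).trans
      (hδK.trans interior_subset)
    have hηc : HasCompactSupport η := hK'.of_isClosed_subset (isClosed_tsupport _) hηK
    have hη' : ∀ y, fderiv ℝ η y (EuclideanSpace.single j 1)
        = - fderiv ℝ ρ (x - y) (EuclideanSpace.single j 1) := by
      intro y
      have h1 : HasFDerivAt ρ (fderiv ℝ ρ (x - y)) (x - y) :=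
        (hρd.differentiable (by simp)).differentiableAt.hasFDerivAt
      have h2 : HasFDerivAt (fun y : Space N => x - y) (-ContinuousLinearMap.id ℝ (Space N)) y :=
        (hasFDerivAt_id y).const_sub x
      have := (h1.comp y h2).fderiv
      rw [show η = ρ ∘ fun y => x - y from rfl, this]
      simp
    have e := h.integral_eq η hηd hηc (hηK.trans hK'Ω) j
    have e1 : ∫ y in Ω, η y • g j y = ∫ y in K', η y • g j y :=
      setIntegral_smul_eq_setIntegral (hηK.trans hK'Ω) hηK _
    have e2 : ∫ y in Ω, (fderiv ℝ η y (EuclideanSpace.single j 1)) • u y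
        = ∫ y in K', (fderiv ℝ η y (EuclideanSpace.single j 1)) • u y :=
      setIntegral_smul_eq_setIntegral (η := fun y => fderiv ℝ η y (EuclideanSpace.single j 1))
        (((tsupport_fderiv_apply_subset _).trans hηK).trans hK'Ω)
        ((tsupport_fderiv_apply_subset _).trans hηK) _
    rw [e1, e2] at e
    have e3 : ∀ f : Space N → E, (ρ ⋆[ContinuousLinearMap.lsmul ℝ ℝ, volume] (K'.indicator f)) x
        = ∫ y in K', η y • f y := by
      intro f
      rw [convolution_eq_swap, ← integral_indicator hK'.measurableSet]
      refine integral_congr_ae (Eventually.of_forall fun y => ?_)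
      by_cases hy : y ∈ K' <;> simp [hy, η]
    rw [e3]
    have e4 : (fderiv ℝ ρ ⋆[ContinuousLinearMap.precompL (Space N)
        (ContinuousLinearMap.lsmul ℝ ℝ : ℝ →L[ℝ] E →L[ℝ] E), volume] U) x
          (EuclideanSpace.single j 1)
        = ∫ y in K', (fderiv ℝ ρ (x - y) (EuclideanSpace.single j 1)) • u y := by
      have hce : ConvolutionExistsAt (fderiv ℝ ρ) U x (ContinuousLinearMap.precompL (Space N)
          (ContinuousLinearMap.lsmul ℝ ℝ : ℝ →L[ℝ] E →L[ℝ] E)) volume :=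
        (hρs.fderiv ℝ).convolutionExists_left _ (hρd.continuous_fderiv (by simp))
          hUi.locallyIntegrable x
      rw [convolution_eq_swap, ContinuousLinearMap.integral_apply hce.integrable_swap,
        ← integral_indicator hK'.measurableSet]
      refine integral_congr_ae (Eventually.of_forall fun y => ?_)
      by_cases hy : y ∈ K' <;> simp [hy, hU]
    rw [e4]
    simp_rw [hη', neg_smul] at e
    rw [integral_neg] at e
    exact neg_injective e
  refine ⟨fun n => (φ n).normed volume ⋆[ContinuousLinearMap.lsmul ℝ ℝ, volume] U, fun n => ?_,
    ?_, ?_, fun j => ?_⟩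
  · exact (φ n).hasCompactSupport_normed.contDiff_convolution_left _ (φ n).contDiff_normed
      hUi.locallyIntegrable
  · have := ContDiffBump.ae_convolution_tendsto_right_of_locallyIntegrable (μ := volume) (K := 2) hφ
      (Eventually.of_forall fun n => by
        show δ / ((n : ℝ) + 1) ≤ 2 * (δ / (2 * (n + 1)))
        apply le_of_eq; field_simp) hUi.locallyIntegrable
    rw [ae_restrict_iff' hK.measurableSet]
    filter_upwards [this] with x hx hxK
    rw [← hres u x hxK]
    exact hx
  · refine tendsto_of_tendsto_of_tendsto_of_le_of_le tendsto_const_nhds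
      (tendsto_lintegral_mollify hφ hUi) (fun _ => bot_le) fun n => ?_
    refine le_trans (le_of_eq ?_) (setLIntegral_le_lintegral K _)
    refine setLIntegral_congr_fun hK.measurableSet fun x hx => ?_
    simp only [hU, hres u x hx]
  · refine tendsto_of_tendsto_of_tendsto_of_le_of_le tendsto_const_nhds
      (tendsto_lintegral_mollify hφ (hind _ (h.loc_partial j))) (fun _ => bot_le) fun n => ?_
    refine le_trans (le_of_eq ?_) (setLIntegral_le_lintegral K _)
    refine setLIntegral_congr_fun hK.measurableSet fun x hx => ?_
    simp only [hfd n j x hx, hres (g j) x hx]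

end Mollification

/-! ### Calculus of weak partials and the global chain rule -/

section Calculus

variable {N : ℕ} {E E' : Type*} [NormedAddCommGroup E] [NormedSpace ℝ E]
  [NormedAddCommGroup E'] [NormedSpace ℝ E']
  {Ω K : Set (Space N)} {u v : Space N → E} {g g' : Fin N → Space N → E}

omit [NormedSpace ℝ E] in
theorem locallyIntegrableOn_iff_compact (hΩ : IsOpen Ω) {f : Space N → E} :
    LocallyIntegrableOn f Ω ↔ ∀ K ⊆ Ω, IsCompact K → IntegrableOn f K :=
  locallyIntegrableOn_iff hΩ.isLocallyClosed

omit [NormedSpace ℝ E] in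
theorem locallyIntegrableOn_congr (hΩ : IsOpen Ω) (h : LocallyIntegrableOn u Ω)
    (e : u =ᵐ[volume.restrict Ω] v) : LocallyIntegrableOn v Ω := by
  rw [locallyIntegrableOn_iff_compact hΩ] at h ⊢
  exact fun K hK hc => (h K hK hc).congr (ae_mono (Measure.restrict_mono hK le_rfl) e)

theorem HasWeakPartials.congr (hΩ : IsOpen Ω) (h : HasWeakPartials Ω u g)
    (e : u =ᵐ[volume.restrict Ω] v) (e' : ∀ j, g j =ᵐ[volume.restrict Ω] g' j) :
    HasWeakPartials Ω v g' where
  loc := locallyIntegrableOn_congr hΩ h.loc e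
  loc_partial j := locallyIntegrableOn_congr hΩ (h.loc_partial j) (e' j)
  integral_eq η hη hc hs j := by
    have e1 : ∫ x in Ω, (fderiv ℝ η x (EuclideanSpace.single j 1)) • v x
        = ∫ x in Ω, (fderiv ℝ η x (EuclideanSpace.single j 1)) • u x :=
      integral_congr_ae (by filter_upwards [e] with x hx; rw [hx])
    have e2 : ∫ x in Ω, η x • g' j x = ∫ x in Ω, η x • g j x :=
      integral_congr_ae (by filter_upwards [e' j] with x hx; rw [hx])
    rw [e1, e2, h.integral_eq η hη hc hs j]

theorem integrable_smul_of_locallyIntegrableOn {f : Space N → E} (hf : LocallyIntegrableOn f Ω)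
    {η : Space N → ℝ} (hη : Continuous η) (hc : HasCompactSupport η) (hs : tsupport η ⊆ Ω) :
    Integrable fun x => η x • f x := by
  have h1 : IntegrableOn f (tsupport η) := hf.integrableOn_compact_subset hs hc
  have h2 : IntegrableOn (fun x => η x • f x) (tsupport η) :=
    h1.continuousOn_smul hη.continuousOn hc
  refine (integrableOn_iff_integrable_of_support_subset ?_).1 h2
  intro x hx
  exact subset_tsupport η fun h0 => hx (by simp [h0])

theorem HasWeakPartials.clm_comp [CompleteSpace E] [CompleteSpace E'] (L : E →L[ℝ] E')
    (h : HasWeakPartials Ω u g) :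
    HasWeakPartials Ω (fun x => L (u x)) fun j x => L (g j x) where
  loc := h.loc.clm_comp L
  loc_partial j := (h.loc_partial j).clm_comp L
  integral_eq η hη hc hs j := by
    simp_rw [← L.map_smul]
    have i1 := (integrable_smul_of_locallyIntegrableOn h.loc
      (η := fun x => fderiv ℝ η x (EuclideanSpace.single j 1))
      ((hη.continuous_fderiv (by simp)).clm_apply continuous_const)
      (hc.of_isClosed_subset (isClosed_tsupport _) (tsupport_fderiv_apply_subset _))
      ((tsupport_fderiv_apply_subset _).trans hs)).integrableOn (s := Ω)
    have i2 := (integrable_smul_of_locallyIntegrableOn (h.loc_partial j)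
      hη.continuous hc hs).integrableOn (s := Ω)
    rw [L.integral_comp_comm i1, L.integral_comp_comm i2, h.integral_eq η hη hc hs j, map_neg]

theorem HasWeakPartials.prodMk [CompleteSpace E] [CompleteSpace E'] {w : Space N → E'}
    {k : Fin N → Space N → E'} (h : HasWeakPartials Ω u g) (h' : HasWeakPartials Ω w k) :
    HasWeakPartials Ω (fun x => (u x, w x)) fun j x => (g j x, k j x) where
  loc x hx := by
    obtain ⟨s, hs, hi⟩ := h.loc x hx
    obtain ⟨t, ht, hj⟩ := h'.loc x hx
    exact ⟨s ∩ t, inter_mem hs ht, Integrable.prodMk (hi.mono_set inter_subset_left)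
      (hj.mono_set inter_subset_right)⟩
  loc_partial j x hx := by
    obtain ⟨s, hs, hi⟩ := h.loc_partial j x hx
    obtain ⟨t, ht, hj⟩ := h'.loc_partial j x hx
    exact ⟨s ∩ t, inter_mem hs ht, Integrable.prodMk (hi.mono_set inter_subset_left)
      (hj.mono_set inter_subset_right)⟩
  integral_eq η hη hc hs j := by
    have i1 : ∀ {F : Type _} [NormedAddCommGroup F] [NormedSpace ℝ F] {f : Space N → F},
        LocallyIntegrableOn f Ω → IntegrableOn
          (fun x => (fderiv ℝ η x (EuclideanSpace.single j 1)) • f x) Ω := fun hf =>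
      (integrable_smul_of_locallyIntegrableOn hf
      (η := fun x => fderiv ℝ η x (EuclideanSpace.single j 1))
      ((hη.continuous_fderiv (by simp)).clm_apply continuous_const)
      (hc.of_isClosed_subset (isClosed_tsupport _) (tsupport_fderiv_apply_subset _))
      ((tsupport_fderiv_apply_subset _).trans hs)).integrableOn
    have i1' := (integrable_smul_of_locallyIntegrableOn h'.loc
      (η := fun x => fderiv ℝ η x (EuclideanSpace.single j 1))
      ((hη.continuous_fderiv (by simp)).clm_apply continuous_const)
      (hc.of_isClosed_subset (isClosed_tsupport _) (tsupport_fderiv_apply_subset _))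
      ((tsupport_fderiv_apply_subset _).trans hs)).integrableOn (s := Ω)
    have i2 := (integrable_smul_of_locallyIntegrableOn (h.loc_partial j)
      hη.continuous hc hs).integrableOn (s := Ω)
    have i2' := (integrable_smul_of_locallyIntegrableOn (h'.loc_partial j)
      hη.continuous hc hs).integrableOn (s := Ω)
    simp_rw [Prod.smul_mk]
    rw [integral_pair (i1 h.loc) i1', integral_pair i2 i2', h.integral_eq η hη hc hs j,
      h'.integral_eq η hη hc hs j, Prod.neg_mk]

theorem HasWeakPartials.of_contDiff (Ω : Set (Space N)) (hu : ContDiff ℝ 1 u) :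
    HasWeakPartials Ω u fun j x => fderiv ℝ u x (EuclideanSpace.single j 1) where
  loc := hu.continuous.locallyIntegrable.locallyIntegrableOn Ω
  loc_partial j := (((hu.continuous_fderiv (by simp)).clm_apply
    continuous_const).locallyIntegrable).locallyIntegrableOn Ω
  integral_eq η hη hc hs j := by
    have h2 := (hu.continuous_fderiv (by simp)).clm_apply
      (continuous_const (y := (EuclideanSpace.single j 1 : Space N)))
    rw [setIntegral_smul_eq_integral hs]
    rw [setIntegral_smul_eq_integral (η := fun x => fderiv ℝ η x (EuclideanSpace.single j 1))
      ((tsupport_fderiv_apply_subset _).trans hs)]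
    rw [integral_smul_fderiv_eq_neg_fderiv_smul_of_integrable, neg_neg]
    · exact integrable_smul_of_locallyIntegrableOn
        (η := fun x => fderiv ℝ η x (EuclideanSpace.single j 1))
        (hu.continuous.locallyIntegrable.locallyIntegrableOn Ω)
        ((hη.continuous_fderiv (by simp)).clm_apply continuous_const)
        (hc.of_isClosed_subset (isClosed_tsupport _) (tsupport_fderiv_apply_subset _))
        ((tsupport_fderiv_apply_subset _).trans hs)
    · exact integrable_smul_of_locallyIntegrableOn (h2.locallyIntegrable.locallyIntegrableOn Ω)
        hη.continuous hc hs
    · exact integrable_smul_of_locallyIntegrableOn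
        (hu.continuous.locallyIntegrable.locallyIntegrableOn Ω) hη.continuous hc hs
    · exact fun x _ => (hη.differentiable (by simp)).differentiableAt
    · exact fun x _ => (hu.differentiable (by simp)).differentiableAt

theorem tendsto_setIntegral_smul {η : Space N → ℝ} (hη : Continuous η) (hc : HasCompactSupport η)
    (hs : tsupport η ⊆ Ω) {f : Space N → E} {F : ℕ → Space N → E} (hf : LocallyIntegrableOn f Ω)
    (hF : ∀ n, LocallyIntegrableOn (F n) Ω) {K : Set (Space N)} (hK : tsupport η ⊆ K)
    (h : Tendsto (fun n => ∫⁻ x in K, ‖F n x - f x‖ₑ) atTop (𝓝 0)) :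
    Tendsto (fun n => ∫ x in Ω, η x • F n x) atTop (𝓝 (∫ x in Ω, η x • f x)) := by
  obtain ⟨C, hC⟩ := hc.exists_bound_of_continuous hη
  have hI : ∀ f : Space N → E, LocallyIntegrableOn f Ω → IntegrableOn (fun x => η x • f x) K :=
    fun f hf => (integrable_smul_of_locallyIntegrableOn hf hη hc hs).integrableOn
  simp_rw [setIntegral_smul_eq_setIntegral hs hK]
  refine tendsto_integral_of_L1 _ (hI f hf).1 (Eventually.of_forall fun n => hI _ (hF n)) ?_
  have h2 : Tendsto (fun n => ENNReal.ofReal C * ∫⁻ x in K, ‖F n x - f x‖ₑ) atTop (𝓝 0) := by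
    simpa using ENNReal.Tendsto.const_mul h (Or.inr ENNReal.ofReal_ne_top)
  refine tendsto_of_tendsto_of_tendsto_of_le_of_le tendsto_const_nhds h2 (fun _ => bot_le)
    fun n => ?_
  rw [← lintegral_const_mul' _ _ ENNReal.ofReal_ne_top]
  refine lintegral_mono fun x => ?_
  simp only [← smul_sub, enorm_smul]
  gcongr
  rw [← ofReal_norm]
  exact ENNReal.ofReal_le_ofReal (hC x)

/-- Weak differentiability passes to local `L¹` limits. -/
theorem HasWeakPartials.of_tendsto (hu : LocallyIntegrableOn u Ω)
    (hg : ∀ j, LocallyIntegrableOn (g j) Ω)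
    (H : ∀ K ⊆ Ω, IsCompact K → ∃ (w : ℕ → Space N → E) (k : ℕ → Fin N → Space N → E),
      (∀ n, HasWeakPartials Ω (w n) (k n)) ∧
      Tendsto (fun n => ∫⁻ x in K, ‖w n x - u x‖ₑ) atTop (𝓝 0) ∧
      ∀ j, Tendsto (fun n => ∫⁻ x in K, ‖k n j x - g j x‖ₑ) atTop (𝓝 0)) :
    HasWeakPartials Ω u g where
  loc := hu
  loc_partial := hg
  integral_eq η hη hc hs j := by
    obtain ⟨w, k, hwk, hw, hk⟩ := H (tsupport η) hs hc
    have h1 := tendsto_setIntegral_smul (η := fun x => fderiv ℝ η x (EuclideanSpace.single j 1))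
      ((hη.continuous_fderiv (by simp)).clm_apply continuous_const)
      (hc.of_isClosed_subset (isClosed_tsupport _) (tsupport_fderiv_apply_subset _))
      ((tsupport_fderiv_apply_subset _).trans hs) hu (fun n => (hwk n).loc)
      (tsupport_fderiv_apply_subset _) hw
    have h2 := (tendsto_setIntegral_smul hη.continuous hc hs (hg j)
      (fun n => (hwk n).loc_partial j) subset_rfl (hk j)).neg
    refine tendsto_nhds_unique h1 (h2.congr fun n => ?_)
    exact ((hwk n).integral_eq η hη hc hs j).symm

/-- True for smooth approximants w, and stable in the limit: DF(w)∂w − DF(u)g splits into DF(w)(∂w −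
g), controlled by L, and (DF(w) − DF(u))g. -/
theorem HasWeakPartials.comp [CompleteSpace E] (hΩ : IsOpen Ω) {F : E → E'} (hF : ContDiff ℝ 1 F)
    {L : ℝ} (hL : ∀ z, ‖fderiv ℝ F z‖ ≤ L) (h : HasWeakPartials Ω u g) :
    HasWeakPartials Ω (fun x => F (u x)) fun j x => fderiv ℝ F (u x) (g j x) := by
  have hL0 : 0 ≤ L := (norm_nonneg _).trans (hL 0)
  have hlip : ∀ z w, ‖F z - F w‖ ≤ L * ‖z - w‖ := fun z w =>
    Convex.norm_image_sub_le_of_norm_fderiv_le (𝕜 := ℝ) (s := univ)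
      (fun x _ => (hF.differentiable (by simp)).differentiableAt) (fun x _ => hL x) convex_univ
      (mem_univ _) (mem_univ _)
  have hlipe : ∀ z w, ‖F z - F w‖ₑ ≤ ENNReal.ofReal L * ‖z - w‖ₑ := fun z w => by
    rw [← ofReal_norm, ← ofReal_norm, ← ENNReal.ofReal_mul hL0]
    exact ENNReal.ofReal_le_ofReal (hlip z w)
  have hde : ∀ z w, ‖fderiv ℝ F z w‖ₑ ≤ ENNReal.ofReal L * ‖w‖ₑ := fun z w => by
    rw [← ofReal_norm, ← ofReal_norm, ← ENNReal.ofReal_mul hL0]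
    exact ENNReal.ofReal_le_ofReal ((fderiv ℝ F z).le_of_opNorm_le (hL z) w)
  have hFc := hF.continuous_fderiv (by simp)
  have hcont : Continuous fun p : E × E => fderiv ℝ F p.1 p.2 :=
    (hFc.comp continuous_fst).clm_apply continuous_snd
  refine HasWeakPartials.of_tendsto ?_ (fun j => ?_) fun K hKΩ hK => ?_
  · rw [locallyIntegrableOn_iff_compact hΩ]
    intro K hKΩ hK
    have h1 : IntegrableOn u K := h.loc.integrableOn_compact_subset hKΩ hK
    have : IsFiniteMeasure ((volume : Measure (Space N)).restrict K) :=
      ⟨by simpa using hK.measure_lt_top⟩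
    refine Integrable.mono' ((h1.norm.const_mul L).add (integrable_const ‖F 0‖))
      (hF.continuous.comp_aestronglyMeasurable h1.1) (Eventually.of_forall fun x => ?_)
    have := norm_sub_norm_le (F (u x)) (F 0)
    have h2 := hlip (u x) 0
    rw [sub_zero] at h2
    simp only [Pi.add_apply]
    linarith
  · rw [locallyIntegrableOn_iff_compact hΩ]
    intro K hKΩ hK
    have h1 : IntegrableOn u K := h.loc.integrableOn_compact_subset hKΩ hK
    have h2 : IntegrableOn (g j) K := (h.loc_partial j).integrableOn_compact_subset hKΩ hK
    exact Integrable.mono' (h2.norm.const_mul L)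
      (hcont.comp_aestronglyMeasurable (h1.1.prodMk h2.1))
      (Eventually.of_forall fun x => (fderiv ℝ F (u x)).le_of_opNorm_le (hL _) _)
  · obtain ⟨w, hwd, hwa, hw, hwg⟩ := h.exists_smooth_approx hΩ hK hKΩ
    have hw1 : ∀ n, ContDiff ℝ 1 (w n) := fun n => (hwd n).of_le (by norm_cast)
    refine ⟨fun n x => F (w n x), fun n j x => fderiv ℝ F (w n x)
      (fderiv ℝ (w n) x (EuclideanSpace.single j 1)), fun n => ?_, ?_, fun j => ?_⟩
    · have h1 := HasWeakPartials.of_contDiff Ω (hF.comp (hw1 n))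
      have h2 : (fun (j : Fin N) x => fderiv ℝ F (w n x)
          (fderiv ℝ (w n) x (EuclideanSpace.single j 1)))
          = fun j x => fderiv ℝ (F ∘ w n) x (EuclideanSpace.single j 1) := by
        funext j x
        rw [fderiv_comp x (hF.differentiable (by simp)).differentiableAt
          ((hw1 n).differentiable (by simp)).differentiableAt]
        rfl
      dsimp only
      exact h2 ▸ h1
    · have h2 : Tendsto (fun n => ENNReal.ofReal L * ∫⁻ x in K, ‖w n x - u x‖ₑ) atTop (𝓝 0) := by
        simpa using ENNReal.Tendsto.const_mul hw (Or.inr ENNReal.ofReal_ne_top)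
      refine tendsto_of_tendsto_of_tendsto_of_le_of_le tendsto_const_nhds h2 (fun _ => bot_le)
        fun n => ?_
      rw [← lintegral_const_mul' _ _ ENNReal.ofReal_ne_top]
      exact lintegral_mono fun x => hlipe _ _
    · have h1 : IntegrableOn u K := h.loc.integrableOn_compact_subset hKΩ hK
      have hgj : IntegrableOn (g j) K := (h.loc_partial j).integrableOn_compact_subset hKΩ hK
      have h2 : Tendsto (fun n => ENNReal.ofReal L *
          ∫⁻ x in K, ‖fderiv ℝ (w n) x (EuclideanSpace.single j 1) - g j x‖ₑ) atTop (𝓝 0) := by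
        simpa using ENNReal.Tendsto.const_mul (hwg j) (Or.inr ENNReal.ofReal_ne_top)
      -- With g fixed, 2L|g| dominates, so almost everywhere convergence of w and continuity of DF
      -- suffice.
      have h3 : Tendsto (fun n => ∫⁻ x in K, ‖fderiv ℝ F (w n x) (g j x)
          - fderiv ℝ F (u x) (g j x)‖ₑ) atTop (𝓝 0) := by
        have := tendsto_lintegral_of_dominated_convergence' (μ := volume.restrict K)
          (F := fun n x => ‖fderiv ℝ F (w n x) (g j x) - fderiv ℝ F (u x) (g j x)‖ₑ)
          (f := fun _ => 0)
          (fun x => ENNReal.ofReal L * ‖g j x‖ₑ + ENNReal.ofReal L * ‖g j x‖ₑ) (fun n => ?_)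
          (fun n => ?_) ?_ ?_
        · simpa using this
        · exact ((hcont.comp_aestronglyMeasurable ((hwd n).continuous.aestronglyMeasurable.prodMk
            hgj.1)).sub (hcont.comp_aestronglyMeasurable (h1.1.prodMk hgj.1))).enorm
        · exact Eventually.of_forall fun x => (enorm_sub_le).trans (add_le_add (hde _ _) (hde _ _))
        · rw [lintegral_add_left' (hgj.1.enorm.const_mul _),
            lintegral_const_mul' _ _ ENNReal.ofReal_ne_top]
          have := ENNReal.mul_ne_top (ENNReal.ofReal_ne_top (r := L)) hgj.2.ne
          exact ENNReal.add_ne_top.2 ⟨this, this⟩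
        · filter_upwards [hwa] with x hx
          have h4 : Tendsto (fun n => fderiv ℝ F (w n x) (g j x)) atTop
              (𝓝 (fderiv ℝ F (u x) (g j x))) :=
            ((hFc.clm_apply continuous_const).tendsto _).comp hx
          have h5 := (tendsto_sub_nhds_zero_iff.2 h4).enorm
          simpa using h5
      have h4 := h2.add h3
      rw [add_zero] at h4
      refine tendsto_of_tendsto_of_tendsto_of_le_of_le tendsto_const_nhds h4 (fun _ => bot_le)
        fun n => ?_
      dsimp only
      rw [← lintegral_const_mul' _ _ ENNReal.ofReal_ne_top, ← lintegral_add_left']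
      · refine lintegral_mono fun x => ?_
        calc _ = ‖fderiv ℝ F (w n x) (fderiv ℝ (w n) x (EuclideanSpace.single j 1) - g j x)
            + (fderiv ℝ F (w n x) (g j x) - fderiv ℝ F (u x) (g j x))‖ₑ := by
              rw [map_sub]; congr 1; abel
          _ ≤ _ := (enorm_add_le _ _).trans (add_le_add (hde _ _) le_rfl)
      · exact (((((hwd n).continuous_fderiv (by simp)).clm_apply
          continuous_const).aestronglyMeasurable.sub hgj.1).enorm).const_mul _

end Calculus

/-! ### Chain rule near a compact set of values -/

section LocalChain

variable {N : ℕ} {E E' : Type*} [NormedAddCommGroup E] [NormedSpace ℝ E] [FiniteDimensional ℝ E]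
  [NormedAddCommGroup E'] [NormedSpace ℝ E']
  {Ω : Set (Space N)} {u : Space N → E} {g : Fin N → Space N → E}

open scoped Manifold in
/-- Chain rule for a weakly differentiable map with values in a compact set near which the outer
function is continuously differentiable. -/
theorem HasWeakPartials.comp_contDiffOn (hΩ : IsOpen Ω) {F : E → E'} {U K : Set E} (hU : IsOpen U)
    (hF : ContDiffOn ℝ 1 F U) (hK : IsCompact K) (hKU : K ⊆ U)
    (h : HasWeakPartials Ω u g) (huK : ∀ᵐ x ∂(volume.restrict Ω), u x ∈ K) :
    HasWeakPartials Ω (fun x => F (u x)) fun j x => fderiv ℝ F (u x) (g j x) := by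
  obtain ⟨T, hT, hKT, hTU⟩ := exists_compact_between hK hU hKU
  -- χF is globally C¹ with compact support, hence has bounded derivative, and has the same germ as
  -- F at every point of K.
  obtain ⟨χ, hχ1, hχ0, -⟩ := exists_contMDiffMap_one_nhds_of_subset_interior (n := 1) 𝓘(ℝ, E)
    hK.isClosed hKT
  have hχ : ContDiff ℝ 1 χ := χ.contMDiff.contDiff
  set F' : E → E' := fun z => χ z • F z with hF'
  have hd : ContDiff ℝ 1 F' := by
    rw [contDiff_iff_contDiffAt]
    intro z
    by_cases hz : z ∈ U
    · exact hχ.contDiffAt.smul (hF.contDiffAt (hU.mem_nhds hz))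
    · have : F' =ᶠ[𝓝 z] fun _ => 0 := by
        filter_upwards [hT.isClosed.isOpen_compl.mem_nhds fun h => hz (hTU h)] with y hy
        simp [hF', hχ0 y hy]
      exact contDiffAt_const.congr_of_eventuallyEq this
  have hs : HasCompactSupport F' := by
    refine HasCompactSupport.intro hT fun y hy => ?_
    simp [hF', hχ0 y hy]
  obtain ⟨L, hL⟩ := (hs.fderiv ℝ).exists_bound_of_continuous (hd.continuous_fderiv (by simp))
  have heq : ∀ z ∈ K, F' =ᶠ[𝓝 z] F := by
    intro z hz
    filter_upwards [(eventually_nhdsSet_iff_forall.1 hχ1) z hz] with y hy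
    simp [hF', hy]
  refine (h.comp hΩ hd hL).congr hΩ ?_ fun j => ?_
  · filter_upwards [huK] with x hx
    exact (heq _ hx).eq_of_nhds
  · filter_upwards [huK] with x hx
    rw [(heq _ hx).fderiv_eq]

end LocalChain

/-! ### Periodic functions of the argument -/

section Angle

theorem _root_.Function.Periodic.apply_arg_eq {β : Type*} {f : ℝ → β}
    (hf : Function.Periodic f (2 * Real.pi)) {r θ : ℝ} (hr : 0 < r) :
    f (Complex.arg (r * Complex.exp (θ * Complex.I))) = f θ := by
  rw [Complex.exp_mul_I, Complex.arg_mul_cos_add_sin_mul_I_eq_toIocMod hr, toIocMod,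
    hf.sub_zsmul_eq]

variable {f : ℝ → ℝ}

/-- The jump of arg is 2π, which f does not see: near the negative axis arg w may be replaced by
arg(−w) + π. -/
theorem contDiffAt_comp_arg (hf : Function.Periodic f (2 * Real.pi)) (hd : ContDiff ℝ 1 f)
    {z : ℂ} (hz : z ≠ 0) : ContDiffAt ℝ 1 (fun z => f (Complex.arg z)) z := by
  have harg : ∀ {w : ℂ}, w ∈ Complex.slitPlane → ContDiffAt ℝ 1 Complex.arg w := by
    intro w hw
    have h1 : ContDiffAt ℝ 1 Complex.log w := (Complex.contDiffAt_log hw).restrict_scalars ℝ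
    have h2 : ContDiffAt ℝ 1 (fun w => Complex.imCLM (Complex.log w)) w :=
      Complex.imCLM.contDiff.contDiffAt.comp w h1
    simpa [Complex.log_im] using h2
  by_cases h : z ∈ Complex.slitPlane
  · exact hd.contDiffAt.comp z (harg h)
  · have h' : -z ∈ Complex.slitPlane := by
      rw [Complex.mem_slitPlane_iff] at h ⊢
      push Not at h
      left
      rcases lt_or_eq_of_le h.1 with h1 | h1
      · simpa using h1
      · exact absurd (Complex.ext h1 h.2) hz
    have h1 : ContDiffAt ℝ 1 (fun w : ℂ => f (Complex.arg (-w) + Real.pi)) z := by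
      refine hd.contDiffAt.comp z (ContDiffAt.add ?_ contDiffAt_const)
      exact (harg h').comp z contDiffAt_id.neg
    refine h1.congr_of_eventuallyEq ?_
    filter_upwards [isOpen_ne.mem_nhds hz] with w hw
    have h2 : (0 : ℝ) < ‖w‖ := norm_pos_iff.2 hw
    rw [← hf.apply_arg_eq (θ := Complex.arg (-w) + Real.pi) h2]
    congr 2
    have h3 := Complex.norm_mul_exp_arg_mul_I (-w)
    rw [norm_neg] at h3
    push_cast
    rw [add_mul, Complex.exp_add, Complex.exp_pi_mul_I, ← mul_assoc, h3]
    ring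

/-- Differentiate along the arc t ↦ e^{i(arg z + ts)}. Only tangential directions are needed, as
these are the directions of ∇u for a circle map. -/
theorem fderiv_comp_arg (hf : Function.Periodic f (2 * Real.pi)) (hd : ContDiff ℝ 1 f)
    {z : ℂ} (hz : ‖z‖ = 1) (s : ℝ) :
    fderiv ℝ (fun z => f (Complex.arg z)) z (Complex.I * z * s) = deriv f (Complex.arg z) * s := by
  have hz0 : z ≠ 0 := by rintro rfl; simp at hz
  let c : ℝ → ℂ := fun t => Complex.exp (((Complex.arg z + t * s : ℝ) : ℂ) * Complex.I)
  have hze : Complex.exp (Complex.arg z * Complex.I) = z := by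
    have := Complex.norm_mul_exp_arg_mul_I z
    rwa [hz, Complex.ofReal_one, one_mul] at this
  have hc0 : c 0 = z := by simp [c, hze]
  have hc : HasDerivAt c (Complex.I * z * s) 0 := by
    have h1 : HasDerivAt (fun t : ℝ => ((Complex.arg z + t * s : ℝ) : ℂ) * Complex.I)
        ((s : ℂ) * Complex.I) 0 := by
      have : HasDerivAt (fun t : ℝ => Complex.arg z + t * s) s 0 := by
        simpa using ((hasDerivAt_id (0 : ℝ)).mul_const s).const_add (Complex.arg z)
      exact this.ofReal_comp.mul_const _
    have := h1.cexp
    simp only [zero_mul, add_zero, hze] at this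
    convert this using 1
    ring
  have h1 : HasFDerivAt (fun z => f (Complex.arg z)) (fderiv ℝ (fun z => f (Complex.arg z)) z)
      (c 0) := by
    rw [hc0]
    exact ((contDiffAt_comp_arg hf hd hz0).differentiableAt (by simp)).hasFDerivAt
  have h2 := h1.comp_hasDerivAt 0 hc
  have h3 : ((fun z => f (Complex.arg z)) ∘ c) = fun t => f (Complex.arg z + t * s) := by
    funext t
    have := hf.apply_arg_eq (θ := Complex.arg z + t * s) one_pos
    simpa [c] using this
  rw [h3] at h2
  have h4 : HasDerivAt (fun t : ℝ => f (Complex.arg z + t * s))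
      (deriv f (Complex.arg z) * s) 0 := by
    have h5 : HasDerivAt (fun t : ℝ => Complex.arg z + t * s) s 0 := by
      simpa using ((hasDerivAt_id (0 : ℝ)).mul_const s).const_add (Complex.arg z)
    have h6 : HasDerivAt f (deriv f (Complex.arg z)) (Complex.arg z + 0 * s) := by
      rw [zero_mul, add_zero]
      exact (hd.differentiable (by simp)).differentiableAt.hasDerivAt
    exact h6.comp (0 : ℝ) h5
  exact h2.unique h4

end Angle

/-! ### Circle maps and their phase gradients -/

section CircleMaps

variable {N : ℕ} {Ω : Set (Space N)} {u v : Space N → ℂ}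
  {a b : Space N → EuclideanSpace ℝ (Fin N)}

/-- `|u| = 1` and `∇u = i u a` on `Ω`, with `a` integrable. -/
structure IsCircleMap (Ω : Set (Space N)) (u : Space N → ℂ)
    (a : Space N → EuclideanSpace ℝ (Fin N)) : Prop where
  norm_eq : ∀ᵐ x ∂(volume.restrict Ω), ‖u x‖ = 1
  partials : HasWeakPartials Ω u fun j x => Complex.I * u x * (a x j : ℂ)
  integrable : IntegrableOn a Ω

theorem HasWeakPartials.ae_eq (hΩ : IsOpen Ω) {𝕜 : Type*} [RCLike 𝕜] {u : Space N → 𝕜}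
    {g k : Fin N → Space N → 𝕜} (hg : HasWeakPartials Ω u g) (hk : HasWeakPartials Ω u k)
    (j : Fin N) : g j =ᵐ[volume.restrict Ω] k j := by
  have h1 : HasWeakGradient Ω u fun x => WithLp.toLp 2 fun j => g j x :=
    hasWeakGradient_iff.2 hg
  have h2 : HasWeakGradient Ω u fun x => WithLp.toLp 2 fun j => k j x :=
    hasWeakGradient_iff.2 hk
  filter_upwards [h1.ae_eq hΩ h2] with x hx
  exact congrArg (fun V : EuclideanSpace 𝕜 (Fin N) => V j) hx

theorem gradEnergy_eq (hΩ : IsOpen Ω) {𝕜 : Type*} [RCLike 𝕜] {u : Space N → 𝕜}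
    {g : Fin N → Space N → 𝕜} (hg : HasWeakPartials Ω u g) :
    gradEnergy Ω u
      = ∫⁻ x in Ω, ‖(WithLp.toLp 2 fun j => g j x : EuclideanSpace 𝕜 (Fin N))‖ₑ := by
  have h1 : HasWeakGradient Ω u fun x => WithLp.toLp 2 fun j => g j x :=
    hasWeakGradient_iff.2 hg
  refine lintegral_congr_ae ?_
  filter_upwards [(weakGradient_spec ⟨_, h1⟩).ae_eq hΩ h1] with x hx
  rw [hx]

theorem euclidean_norm_le_of_forall {𝕜 𝕜' : Type*} [RCLike 𝕜] [RCLike 𝕜']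
    {X : EuclideanSpace 𝕜 (Fin N)}
    {Y : EuclideanSpace 𝕜' (Fin N)} {c : ℝ} (hc : 0 ≤ c) (h : ∀ j, ‖X j‖ ≤ c * ‖Y j‖) :
    ‖X‖ ≤ c * ‖Y‖ := by
  rw [EuclideanSpace.norm_eq, EuclideanSpace.norm_eq]
  refine Real.sqrt_le_iff.2 ⟨by positivity, ?_⟩
  rw [mul_pow, Real.sq_sqrt (by positivity), Finset.mul_sum]
  refine Finset.sum_le_sum fun j _ => ?_
  rw [← mul_pow]
  gcongr
  exact h j

theorem euclidean_enorm_le_of_forall {𝕜 𝕜' : Type*} [RCLike 𝕜] [RCLike 𝕜']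
    {X : EuclideanSpace 𝕜 (Fin N)}
    {Y : EuclideanSpace 𝕜' (Fin N)} {c : ℝ} (hc : 0 ≤ c) (h : ∀ j, ‖X j‖ ≤ c * ‖Y j‖) :
    ‖X‖ₑ ≤ ENNReal.ofReal c * ‖Y‖ₑ := by
  rw [← ofReal_norm, ← ofReal_norm, ← ENNReal.ofReal_mul hc]
  exact ENNReal.ofReal_le_ofReal (euclidean_norm_le_of_forall hc h)

theorem norm_toLp_mul_ofReal (c : ℂ) (A : EuclideanSpace ℝ (Fin N)) :
    ‖(WithLp.toLp 2 fun j => c * (A j : ℂ) : EuclideanSpace ℂ (Fin N))‖ = ‖c‖ * ‖A‖ := by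
  rw [EuclideanSpace.norm_eq, EuclideanSpace.norm_eq]
  simp only [norm_mul, mul_pow, Complex.norm_real]
  rw [← Finset.mul_sum, Real.sqrt_mul (sq_nonneg _), Real.sqrt_sq (norm_nonneg c)]

theorem IsCircleMap.gradEnergy_eq (hΩ : IsOpen Ω) (h : IsCircleMap Ω u a) :
    gradEnergy Ω u = ∫⁻ x in Ω, ‖a x‖ₑ := by
  rw [CircleSobolev.gradEnergy_eq hΩ h.partials]
  refine lintegral_congr_ae ?_
  filter_upwards [h.norm_eq] with x hx
  rw [← ofReal_norm, ← ofReal_norm, norm_toLp_mul_ofReal]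
  simp [hx]

theorem IsCircleMap.congr (hΩ : IsOpen Ω) (h : IsCircleMap Ω u a)
    (e : u =ᵐ[volume.restrict Ω] v) (e' : a =ᵐ[volume.restrict Ω] b) : IsCircleMap Ω v b where
  norm_eq := by filter_upwards [h.norm_eq, e] with x h1 h2; rw [← h2, h1]
  partials := h.partials.congr hΩ e fun j => by
    filter_upwards [e, e'] with x h1 h2; rw [h1, h2]
  integrable := h.integrable.congr e'

/-- The product rule; the pair (u, v) stays in a compact ball, so the chain rule applies to
multiplication although its derivative is unbounded. -/
theorem IsCircleMap.mul (hΩ : IsOpen Ω) (hu : IsCircleMap Ω u a) (hv : IsCircleMap Ω v b) :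
    IsCircleMap Ω (fun x => u x * v x) fun x => a x + b x where
  norm_eq := by filter_upwards [hu.norm_eq, hv.norm_eq] with x h1 h2; rw [norm_mul, h1, h2, one_mul]
  partials := by
    have h1 := HasWeakPartials.comp_contDiffOn hΩ (F := fun p : ℂ × ℂ => p.1 * p.2) isOpen_univ
      (contDiff_fst.mul contDiff_snd).contDiffOn (isCompact_closedBall (0 : ℂ × ℂ) 1)
      (subset_univ _) (hu.partials.prodMk hv.partials) (by
        filter_upwards [hu.norm_eq, hv.norm_eq] with x h1 h2
        simp [Prod.norm_def, h1, h2])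
    refine h1.congr hΩ (Eventually.of_forall fun x => rfl) fun j => Eventually.of_forall fun x => ?_
    have : HasFDerivAt (fun p : ℂ × ℂ => p.1 * p.2) _ (u x, v x) :=
      (hasFDerivAt_fst (𝕜 := ℝ)).mul (hasFDerivAt_snd (𝕜 := ℝ))
    dsimp only
    rw [this.fderiv]
    simp
    ring
  integrable := hu.integrable.add hv.integrable

theorem IsCircleMap.conj (hu : IsCircleMap Ω u a) :
    IsCircleMap Ω (fun x => conj (u x)) fun x => - a x where
  norm_eq := by filter_upwards [hu.norm_eq] with x h1; simpa using h1
  partials := by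
    have h1 := hu.partials.clm_comp (Complex.conjCLE : ℂ →L[ℝ] ℂ)
    have h2 : (fun (j : Fin N) x => Complex.I * conj (u x) * ((-a x) j : ℂ))
        = fun j x => (Complex.conjCLE : ℂ →L[ℝ] ℂ) (Complex.I * u x * (a x j : ℂ)) := by
      funext j x
      show _ = conj (Complex.I * u x * (a x j : ℂ))
      simp
    rw [h2]
    exact h1
  integrable := hu.integrable.neg

theorem isCircleMap_exp (hΩ : IsOpen Ω) {φ : Space N → ℝ}
    (hφ : HasWeakPartials Ω φ fun j x => b x j) (hb : IntegrableOn b Ω) :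
    IsCircleMap Ω (fun x => Complex.exp (Complex.I * (φ x : ℂ))) b where
  norm_eq := Eventually.of_forall fun x => by rw [mul_comm, Complex.norm_exp_ofReal_mul_I]
  partials := by
    have hd : ∀ t : ℝ, HasDerivAt (fun t : ℝ => Complex.exp (Complex.I * t))
        (Complex.I * Complex.exp (Complex.I * t)) t := fun t => by
      have := ((hasDerivAt_id t).ofReal_comp.const_mul Complex.I).cexp
      simp at this
      convert this using 1
      ring
    have hc : ContDiff ℝ 1 (fun t : ℝ => Complex.exp (Complex.I * t)) :=
      (contDiff_const.mul Complex.ofRealCLM.contDiff).cexp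
    have h1 := hφ.comp hΩ hc (L := 1) fun t => by
      rw [← norm_deriv_eq_norm_fderiv, (hd t).deriv, norm_mul, mul_comm Complex.I,
        Complex.norm_exp_ofReal_mul_I]
      simp
    refine h1.congr hΩ (Eventually.of_forall fun x => rfl) fun j => Eventually.of_forall fun x => ?_
    have := (hd (φ x)).hasFDerivAt.fderiv
    simp only [this]
    simp
    ring
  integrable := hb

/-- The source of admissible phases: arg u may jump, but f(arg u) is a C¹ function of u away from 0
and is bounded. -/
theorem IsCircleMap.comp_arg (hΩ : IsOpen Ω) (hfin : volume Ω ≠ ⊤) (hu : IsCircleMap Ω u a)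
    {f : ℝ → ℝ} (hf : Function.Periodic f (2 * Real.pi)) (hd : ContDiff ℝ 1 f) :
    HasWeakPartials Ω (fun x => f (Complex.arg (u x)))
        (fun j x => (deriv f (Complex.arg (u x)) • a x) j) ∧
      IntegrableOn (fun x => f (Complex.arg (u x))) Ω ∧
      IntegrableOn (fun x => deriv f (Complex.arg (u x)) • a x) Ω := by
  have bound : ∀ {k : ℝ → ℝ}, Continuous k → ∃ C, ∀ z : ℂ, ‖k (Complex.arg z)‖ ≤ C := by
    intro k hk
    obtain ⟨C, hC⟩ := (isCompact_Icc (a := -Real.pi) (b := Real.pi)).exists_bound_of_continuousOn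
      hk.continuousOn
    exact ⟨C, fun z => hC _ ⟨(Complex.neg_pi_lt_arg z).le, Complex.arg_le_pi z⟩⟩
  have meas : ∀ {k : ℝ → ℝ}, Continuous k →
      AEStronglyMeasurable (fun x => k (Complex.arg (u x))) (volume.restrict Ω) := by
    intro k hk
    have h1 : AEMeasurable u (volume.restrict Ω) :=
      (hu.partials.loc.aestronglyMeasurable).aemeasurable
    exact (hk.measurable.comp_aemeasurable
      (Complex.measurable_arg.comp_aemeasurable h1)).aestronglyMeasurable
  have hdc : Continuous (deriv f) := hd.continuous_deriv (by simp)
  refine ⟨?_, ?_, ?_⟩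
  · have h1 := HasWeakPartials.comp_contDiffOn hΩ (F := fun z => f (Complex.arg z)) (U := {0}ᶜ)
      isOpen_compl_singleton
      (fun z hz => (contDiffAt_comp_arg hf hd hz).contDiffWithinAt) (isCompact_sphere (0 : ℂ) 1)
      (by intro z hz; rintro rfl; simp at hz) hu.partials (by
        filter_upwards [hu.norm_eq] with x hx
        simpa using hx)
    refine h1.congr hΩ EventuallyEq.rfl fun j => ?_
    filter_upwards [hu.norm_eq] with x hx
    rw [fderiv_comp_arg hf hd hx]
    simp
  · obtain ⟨C, hC⟩ := bound hd.continuous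
    have : IsFiniteMeasure ((volume : Measure (Space N)).restrict Ω) :=
      ⟨by simpa using hfin.lt_top⟩
    exact Integrable.of_bound (meas hd.continuous) C (Eventually.of_forall fun x => hC _)
  · obtain ⟨C, hC⟩ := bound hdc
    exact hu.integrable.bdd_smul C (meas hdc) (Eventually.of_forall fun x => hC _)

/-- Differentiating |u|² = 1 gives Re(ū ∂ⱼu) = 0, so ∂ⱼu = i u aⱼ with aⱼ = Im(ū ∂ⱼu), and |a| ≤
|∇u|. -/
theorem exists_isCircleMap (hΩ : IsOpen Ω) (hu : u ∈ W11Circle Ω) : ∃ a, IsCircleMap Ω u a := by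
  obtain ⟨⟨hi, G, hG, hGi⟩, hn⟩ := hu
  have hp := hasWeakGradient_iff.1 hG
  have h1 := HasWeakPartials.comp_contDiffOn hΩ (F := fun z : ℂ => z.re * z.re + z.im * z.im)
    isOpen_univ ((Complex.reCLM.contDiff.mul Complex.reCLM.contDiff).add
      (Complex.imCLM.contDiff.mul Complex.imCLM.contDiff)).contDiffOn
    (isCompact_closedBall (0 : ℂ) 1) (subset_univ _) hp (by
      filter_upwards [hn] with x h1
      simp [h1])
  have h2 := HasWeakPartials.of_contDiff Ω (contDiff_const (c := (1 : ℝ)))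
  have h3 := h1.congr hΩ (v := fun _ => 1) (by
    filter_upwards [hn] with x hx
    rw [← Complex.normSq_apply, Complex.normSq_eq_norm_sq, hx]; norm_num) fun j => EventuallyEq.rfl
  have key : ∀ j, ∀ᵐ x ∂(volume.restrict Ω), (u x).re * (G x j).re + (u x).im * (G x j).im = 0 := by
    intro j
    filter_upwards [h3.ae_eq hΩ h2 j] with x hx
    have hd : HasFDerivAt (fun z : ℂ => z.re * z.re + z.im * z.im) _ (u x) :=
      (Complex.reCLM.hasFDerivAt.mul Complex.reCLM.hasFDerivAt).add
      (Complex.imCLM.hasFDerivAt.mul Complex.imCLM.hasFDerivAt)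
    rw [hd.fderiv] at hx
    simp at hx
    linarith
  have hm : ∀ j, AEStronglyMeasurable (fun x => (conj (u x) * G x j).im) (volume.restrict Ω) := by
    intro j
    have h4 : AEStronglyMeasurable (fun x => G x j) (volume.restrict Ω) :=
      (EuclideanSpace.proj j :
        EuclideanSpace ℂ (Fin N) →L[ℂ] ℂ).continuous.comp_aestronglyMeasurable
        hGi.1
    exact Complex.continuous_im.comp_aestronglyMeasurable
      ((Complex.continuous_conj.comp_aestronglyMeasurable hi.1).mul h4)
  refine ⟨fun x => WithLp.toLp 2 fun j => (conj (u x) * G x j).im, hn, ?_, ?_⟩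
  · refine hp.congr hΩ EventuallyEq.rfl fun j => ?_
    filter_upwards [key j, hn] with x hx h1
    have h4 : (u x).re * (u x).re + (u x).im * (u x).im = 1 := by
      rw [← Complex.normSq_apply, Complex.normSq_eq_norm_sq, h1]; norm_num
    apply Complex.ext
    · simp
      linear_combination (-(G x j).re) * h4 + (u x).re * hx
    · simp
      linear_combination (-(G x j).im) * h4 + (u x).im * hx
  · refine Integrable.mono hGi ?_ ?_
    · refine (PiLp.continuous_toLp 2 _).comp_aestronglyMeasurable ?_
      exact (aemeasurable_pi_lambda _ fun j => (hm j).aemeasurable).aestronglyMeasurable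
    · filter_upwards [hn] with x hx
      have := euclidean_norm_le_of_forall (X := (WithLp.toLp 2 fun j => (conj (u x) * G x j).im :
        EuclideanSpace ℝ (Fin N))) (Y := G x) zero_le_one fun j => ?_
      · simpa using this
      · have := Complex.abs_im_le_norm (conj (u x) * G x j)
        simpa [hx] using this

end CircleMaps

/-! ### Equivalence classes and Σ -/

section Classes

variable {N : ℕ} {Ω : Set (Space N)} {u v w : Space N → ℂ}
  {a b c : Space N → EuclideanSpace ℝ (Fin N)} {φ ψ : Space N → ℝ}

theorem HasWeakPartials.add {E : Type*} [NormedAddCommGroup E] [NormedSpace ℝ E] [CompleteSpace E]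
    {u v : Space N → E} {g k : Fin N → Space N → E}
    (hu : HasWeakPartials Ω u g) (hv : HasWeakPartials Ω v k) :
    HasWeakPartials Ω (fun x => u x + v x) fun j x => g j x + k j x :=
  (hu.prodMk hv).clm_comp (ContinuousLinearMap.fst ℝ E E + ContinuousLinearMap.snd ℝ E E)

theorem HasWeakPartials.sub {E : Type*} [NormedAddCommGroup E] [NormedSpace ℝ E] [CompleteSpace E]
    {u v : Space N → E} {g k : Fin N → Space N → E}
    (hu : HasWeakPartials Ω u g) (hv : HasWeakPartials Ω v k) :
    HasWeakPartials Ω (fun x => u x - v x) fun j x => g j x - k j x :=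
  (hu.prodMk hv).clm_comp (ContinuousLinearMap.fst ℝ E E - ContinuousLinearMap.snd ℝ E E)

theorem HasWeakPartials.neg {E : Type*} [NormedAddCommGroup E] [NormedSpace ℝ E] [CompleteSpace E]
    {u : Space N → E} {g : Fin N → Space N → E} (hu : HasWeakPartials Ω u g) :
    HasWeakPartials Ω (fun x => - u x) fun j x => - g j x :=
  hu.clm_comp (-ContinuousLinearMap.id ℝ E)

theorem memW11_iff : MemW11 Ω φ ↔ IntegrableOn φ Ω ∧
    ∃ b : Space N → EuclideanSpace ℝ (Fin N), (HasWeakPartials Ω φ fun j x => b x j) ∧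
      IntegrableOn b Ω := by
  simp only [MemW11, hasWeakGradient_iff]

theorem MemW11.add' (h : MemW11 Ω φ) (h' : MemW11 Ω ψ) : MemW11 Ω fun x => φ x + ψ x := by
  rw [memW11_iff] at *
  obtain ⟨h1, b, h2, h3⟩ := h
  obtain ⟨k1, c, k2, k3⟩ := h'
  exact ⟨h1.add k1, fun x => b x + c x, h2.add k2, h3.add k3⟩

theorem MemW11.neg' (h : MemW11 Ω φ) : MemW11 Ω fun x => - φ x := by
  rw [memW11_iff] at *
  obtain ⟨h1, b, h2, h3⟩ := h
  exact ⟨h1.neg, fun x => - b x, h2.neg, h3.neg⟩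

theorem memW11_const (hfin : volume Ω ≠ ⊤) (t : ℝ) : MemW11 Ω fun _ : Space N => t := by
  rw [memW11_iff]
  refine ⟨integrableOn_const hfin, fun _ => 0, ?_, integrableOn_zero⟩
  simpa using HasWeakPartials.of_contDiff Ω (contDiff_const (c := t) (𝕜 := ℝ) (n := 1))

theorem Equivalent.symm (h : Equivalent Ω u v) : Equivalent Ω v u := by
  obtain ⟨φ, hφ, e⟩ := h
  refine ⟨_, hφ.neg', ?_⟩
  filter_upwards [e] with x hx
  rw [hx, ← mul_assoc, ← Complex.exp_add]
  simp

theorem Equivalent.trans (h : Equivalent Ω u v) (h' : Equivalent Ω v w) : Equivalent Ω u w := by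
  obtain ⟨φ, hφ, e⟩ := h
  obtain ⟨ψ, hψ, e'⟩ := h'
  refine ⟨_, hφ.add' hψ, ?_⟩
  filter_upwards [e, e'] with x hx hx'
  rw [hx, hx', ← mul_assoc, ← Complex.exp_add]
  push_cast
  ring_nf

theorem Equivalent.refl (hfin : volume Ω ≠ ⊤) (u : Space N → ℂ) : Equivalent Ω u u :=
  ⟨_, memW11_const hfin 0, by simp⟩

theorem Equivalent.of_ae_eq (hfin : volume Ω ≠ ⊤) (h : u =ᵐ[volume.restrict Ω] v) :
    Equivalent Ω u v :=
  ⟨_, memW11_const hfin 0, by simpa using h⟩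

theorem Equivalent.conj (h : Equivalent Ω u v) :
    Equivalent Ω (fun x => conj (u x)) fun x => conj (v x) := by
  obtain ⟨φ, hφ, e⟩ := h
  refine ⟨_, hφ.neg', ?_⟩
  filter_upwards [e] with x hx
  rw [hx, map_mul, ← Complex.exp_conj]
  simp

theorem Equivalent.mul {u' v' : Space N → ℂ} (h : Equivalent Ω u v) (h' : Equivalent Ω u' v') :
    Equivalent Ω (fun x => u x * u' x) fun x => v x * v' x := by
  obtain ⟨φ, hφ, e⟩ := h
  obtain ⟨ψ, hψ, e'⟩ := h'
  refine ⟨_, hφ.add' hψ, ?_⟩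
  filter_upwards [e, e'] with x hx hx'
  rw [hx, hx']
  push_cast
  rw [mul_add, Complex.exp_add]
  ring

theorem equivalent_mul_exp (hφ : MemW11 Ω φ) (u : Space N → ℂ) :
    Equivalent Ω (fun x => u x * Complex.exp (Complex.I * φ x)) u :=
  ⟨φ, hφ, Eventually.of_forall fun _ => mul_comm _ _⟩

theorem IsCircleMap.mem_W11Circle (hfin : volume Ω ≠ ⊤) (h : IsCircleMap Ω u a) :
    u ∈ W11Circle Ω := by
  have : IsFiniteMeasure ((volume : Measure (Space N)).restrict Ω) := ⟨by simpa using hfin.lt_top⟩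
  have hm := h.partials.loc.aestronglyMeasurable
  refine ⟨⟨Integrable.of_bound hm 1 ?_, fun x => WithLp.toLp 2 fun j => Complex.I * u x * a x j,
    hasWeakGradient_iff.2 h.partials, ?_⟩, h.norm_eq⟩
  · filter_upwards [h.norm_eq] with x hx using hx.le
  · refine Integrable.mono h.integrable ?_ ?_
    · refine (PiLp.continuous_toLp 2 _).comp_aestronglyMeasurable ?_
      exact (aemeasurable_pi_lambda _ fun j =>
        (h.partials.loc_partial j).aestronglyMeasurable.aemeasurable).aestronglyMeasurable
    · filter_upwards [h.norm_eq] with x hx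
      rw [norm_toLp_mul_ofReal]
      simp [hx]

theorem IsCircleMap.mul_exp (hΩ : IsOpen Ω) (hu : IsCircleMap Ω u a)
    (hφ : HasWeakPartials Ω φ fun j x => b x j) (hb : IntegrableOn b Ω) :
    IsCircleMap Ω (fun x => u x * Complex.exp (Complex.I * φ x)) fun x => a x + b x :=
  hu.mul hΩ (isCircleMap_exp hΩ hφ hb)

/-- Together with `exists_of_Sig_lt`, this identifies Σ(u) with the infimum of ∫|c| over circle maps
w ∼ u with phase gradient c; from here on Σ is used only in this form. -/
theorem Sig_le_of_equivalent (hΩ : IsOpen Ω) (hw : IsCircleMap Ω w c) (h : Equivalent Ω w u) :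
    Sig Ω u ≤ ∫⁻ x in Ω, ‖c x‖ₑ := by
  obtain ⟨φ, hφ, e⟩ := h
  refine (iInf₂_le _ hφ.neg').trans (le_of_eq ?_)
  refine IsCircleMap.gradEnergy_eq hΩ (hw.congr hΩ ?_ EventuallyEq.rfl)
  filter_upwards [e] with x hx
  rw [hx]
  simp [mul_comm]

theorem exists_of_Sig_lt (hΩ : IsOpen Ω) (hu : u ∈ W11Circle Ω) {t : ℝ≥0∞} (h : Sig Ω u < t) :
    ∃ w c, IsCircleMap Ω w c ∧ Equivalent Ω w u ∧ ∫⁻ x in Ω, ‖c x‖ₑ < t := by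
  obtain ⟨a, ha⟩ := exists_isCircleMap hΩ hu
  simp only [Sig, iInf_lt_iff] at h
  obtain ⟨φ, hφ, h⟩ := h
  obtain ⟨-, b, hb, hbi⟩ := memW11_iff.1 hφ.neg'
  have hw := ha.mul_exp hΩ hb hbi
  refine ⟨_, _, hw, equivalent_mul_exp hφ.neg' u, ?_⟩
  rw [← hw.gradEnergy_eq hΩ]
  simpa using h

theorem Sig_lt_top (hΩ : IsOpen Ω) (hfin : volume Ω ≠ ⊤) (hu : u ∈ W11Circle Ω) : Sig Ω u < ⊤ := by
  obtain ⟨a, ha⟩ := exists_isCircleMap hΩ hu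
  exact (Sig_le_of_equivalent hΩ ha (Equivalent.refl hfin u)).trans_lt ha.integrable.2

theorem Sig_le_of_equivalent_right (hΩ : IsOpen Ω) (hu : u ∈ W11Circle Ω)
    (h : Equivalent Ω u v) : Sig Ω v ≤ Sig Ω u := by
  refine le_of_forall_gt fun t ht => ?_
  obtain ⟨w, c, hw, hwu, hlt⟩ := exists_of_Sig_lt hΩ hu ht
  exact (Sig_le_of_equivalent hΩ hw (hwu.trans h)).trans_lt hlt

theorem mul_conj_mem (hΩ : IsOpen Ω) (hfin : volume Ω ≠ ⊤) (hu : u ∈ W11Circle Ω)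
    (hv : v ∈ W11Circle Ω) : (fun x => u x * conj (v x)) ∈ W11Circle Ω := by
  obtain ⟨a, ha⟩ := exists_isCircleMap hΩ hu
  obtain ⟨b, hb⟩ := exists_isCircleMap hΩ hv
  exact (ha.mul hΩ hb.conj).mem_W11Circle hfin

theorem Sig_conj_le (hΩ : IsOpen Ω) (hu : u ∈ W11Circle Ω) :
    Sig Ω (fun x => conj (u x)) ≤ Sig Ω u := by
  refine le_of_forall_gt fun t ht => ?_
  obtain ⟨w, c, hw, hwu, hlt⟩ := exists_of_Sig_lt hΩ hu ht
  refine (Sig_le_of_equivalent hΩ hw.conj hwu.conj).trans_lt ?_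
  simpa using hlt

theorem Sig_mul_conj_comm (hΩ : IsOpen Ω) (hfin : volume Ω ≠ ⊤) (hu : u ∈ W11Circle Ω)
    (hv : v ∈ W11Circle Ω) :
    Sig Ω (fun x => u x * conj (v x)) = Sig Ω (fun x => v x * conj (u x)) := by
  have h1 := Sig_conj_le hΩ (mul_conj_mem hΩ hfin hu hv)
  have h2 := Sig_conj_le hΩ (mul_conj_mem hΩ hfin hv hu)
  simp only [map_mul, Complex.conj_conj] at h1 h2
  refine le_antisymm ?_ ?_
  · simpa only [mul_comm] using h2
  · simpa only [mul_comm] using h1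

theorem IsCircleMap.gradEnergy_sub (hΩ : IsOpen Ω) (hu : IsCircleMap Ω u a)
    (hv : IsCircleMap Ω v b) :
    gradEnergy Ω (fun x => u x - v x) = ∫⁻ x in Ω, ‖(WithLp.toLp 2 fun j =>
      Complex.I * u x * a x j - Complex.I * v x * b x j : EuclideanSpace ℂ (Fin N))‖ₑ :=
  CircleSobolev.gradEnergy_eq hΩ (hu.partials.sub hv.partials)

end Classes

/-! ### Degree-one reparametrisation and the lower bound for dist -/

section Angles

/-- The periodic part `∫₀^θ ρ - θ` of the primitive of a density `ρ` of mean one. -/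
def angleShift (ρ : ℝ → ℝ) (θ : ℝ) : ℝ := (∫ s in (0 : ℝ)..θ, ρ s) - θ

variable {ρ : ℝ → ℝ}

theorem hasDerivAt_angleShift (hc : Continuous ρ) (θ : ℝ) :
    HasDerivAt (angleShift ρ) (ρ θ - 1) θ :=
  (intervalIntegral.integral_hasDerivAt_right (hc.intervalIntegrable _ _)
    (hc.stronglyMeasurableAtFilter _ _) hc.continuousAt).sub (hasDerivAt_id θ)

theorem deriv_angleShift (hc : Continuous ρ) : deriv (angleShift ρ) = fun θ => ρ θ - 1 :=
  funext fun θ => (hasDerivAt_angleShift hc θ).deriv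

theorem contDiff_angleShift (hc : Continuous ρ) : ContDiff ℝ 1 (angleShift ρ) := by
  rw [contDiff_one_iff_deriv]
  refine ⟨fun θ => (hasDerivAt_angleShift hc θ).differentiableAt, ?_⟩
  rw [deriv_angleShift hc]
  fun_prop

theorem angleShift_periodic (hc : Continuous ρ) (hp : Function.Periodic ρ (2 * Real.pi))
    (hint : ∫ s in (0 : ℝ)..2 * Real.pi, ρ s = 2 * Real.pi) :
    Function.Periodic (angleShift ρ) (2 * Real.pi) := by
  intro θ
  have h1 := hp.intervalIntegral_add_eq θ 0
  rw [zero_add, hint] at h1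
  have h2 := intervalIntegral.integral_add_adjacent_intervals (μ := volume)
    (hc.intervalIntegrable 0 θ) (hc.intervalIntegrable θ (θ + 2 * Real.pi))
  simp only [angleShift]
  rw [← h2, h1]
  ring

variable {N : ℕ} {Ω : Set (Space N)} {u v w : Space N → ℂ}
  {a b c : Space N → EuclideanSpace ℝ (Fin N)}

/-- Composition with a self-map of the circle of degree one. -/
theorem IsCircleMap.degree_one (hΩ : IsOpen Ω) (hfin : volume Ω ≠ ⊤) (hw : IsCircleMap Ω w c)
    (hc : Continuous ρ) (hp : Function.Periodic ρ (2 * Real.pi))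
    (hint : ∫ s in (0 : ℝ)..2 * Real.pi, ρ s = 2 * Real.pi) :
    IsCircleMap Ω (fun x => w x * Complex.exp (Complex.I * angleShift ρ (Complex.arg (w x))))
      (fun x => ρ (Complex.arg (w x)) • c x) ∧
    Equivalent Ω (fun x => w x * Complex.exp (Complex.I * angleShift ρ (Complex.arg (w x)))) w := by
  obtain ⟨h1, h2, h3⟩ := hw.comp_arg hΩ hfin (angleShift_periodic hc hp hint)
      (contDiff_angleShift hc)
  refine ⟨(hw.mul_exp hΩ h1 h3).congr hΩ EventuallyEq.rfl (Eventually.of_forall fun x => ?_),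
    equivalent_mul_exp (memW11_iff.2 ⟨h2, _, h1, h3⟩) w⟩
  simp only [deriv_angleShift hc, sub_smul, one_smul, add_sub_cancel]

theorem integral_abs_cos_half :
    ∫ s in (0 : ℝ)..2 * Real.pi, |Real.cos (s / 2)| = 4 := by
  have hp : Function.Periodic (fun s : ℝ => |Real.cos (s / 2)|) (2 * Real.pi) := by
    intro s
    simp only
    rw [show (s + 2 * Real.pi) / 2 = s / 2 + Real.pi by ring, Real.cos_add_pi, abs_neg]
  have h1 := hp.intervalIntegral_add_eq 0 (-Real.pi)
  rw [zero_add, show -Real.pi + 2 * Real.pi = Real.pi by ring] at h1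
  rw [h1]
  have h2 : ∫ s in (-Real.pi)..Real.pi, |Real.cos (s / 2)|
      = ∫ s in (-Real.pi)..Real.pi, Real.cos (s / 2) := by
    refine intervalIntegral.integral_congr fun s hs => ?_
    rw [uIcc_of_le (by linarith [Real.pi_pos])] at hs
    exact abs_of_nonneg (Real.cos_nonneg_of_mem_Icc ⟨by linarith [hs.1], by linarith [hs.2]⟩)
  rw [h2, intervalIntegral.integral_comp_div (fun s => Real.cos s) two_ne_zero, integral_cos,
    neg_div, Real.sin_neg, Real.sin_pi_div_two]
  norm_num

/-- With θ the angle of z w̄, the square of the right side is α² + β² − 2αβ cos θ = cos²(θ/2)(α −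
β)² + sin²(θ/2)(α + β)². -/
theorem cos_half_mul_abs_sub_le {z w : ℂ} (hz : ‖z‖ = 1) (hw : ‖w‖ = 1) (α β : ℝ) :
    |Real.cos (Complex.arg (z * conj w) / 2)| * |α - β|
      ≤ ‖Complex.I * z * α - Complex.I * w * β‖ := by
  have h1 : Real.cos (Complex.arg (z * conj w)) = z.re * w.re + z.im * w.im := by
    have hn : ‖z * conj w‖ = 1 := by simp [hz, hw]
    have h := Complex.norm_mul_cos_arg (z * conj w)
    rw [hn, one_mul] at h
    rw [h]; simp
  have hz' : z.re * z.re + z.im * z.im = 1 := by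
    rw [← Complex.normSq_apply, Complex.normSq_eq_norm_sq, hz]; norm_num
  have hw' : w.re * w.re + w.im * w.im = 1 := by
    rw [← Complex.normSq_apply, Complex.normSq_eq_norm_sq, hw]; norm_num
  rw [← abs_mul]
  refine abs_le_of_sq_le_sq ?_ (norm_nonneg _) |> fun h => h
  rw [mul_pow, Real.cos_sq, mul_div_cancel₀ _ two_ne_zero, h1, ← Complex.normSq_eq_norm_sq,
    Complex.normSq_apply]
  simp
  have hc : z.re * w.re + z.im * w.im ≤ 1 := by
    rw [← h1]; exact Real.cos_le_one _
  have e1 : (z.re * z.re + z.im * z.im) * α ^ 2 = α ^ 2 := by rw [hz', one_mul]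
  have e2 : (w.re * w.re + w.im * w.im) * β ^ 2 = β ^ 2 := by rw [hw', one_mul]
  linarith [mul_nonneg (sub_nonneg.2 hc) (sq_nonneg (α + β))]

/-- The factor |cos(θ/2)| lost in comparing |∇(u − v)| with the phase gradient a − b of u v̄ is
absorbed by reparametrising u v̄ with a density proportional to it. -/
theorem two_div_pi_mul_Sig_le (hΩ : IsOpen Ω) (hfin : volume Ω ≠ ⊤) (hu : u ∈ W11Circle Ω)
    (hv : v ∈ W11Circle Ω) :
    ENNReal.ofReal (2 / Real.pi) * Sig Ω (fun x => u x * conj (v x))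
      ≤ gradEnergy Ω fun x => u x - v x := by
  obtain ⟨a, ha⟩ := exists_isCircleMap hΩ hu
  obtain ⟨b, hb⟩ := exists_isCircleMap hΩ hv
  have hw := ha.mul hΩ hb.conj
  -- ∫|cos(s/2)| over a period is 4, so π/2 is the factor that gives mean one; this is where the
  -- constant 2/π comes from.
  set ρ : ℝ → ℝ := fun s => Real.pi / 2 * |Real.cos (s / 2)| with hρ
  have hpi := Real.pi_pos
  obtain ⟨h1, h2⟩ := hw.degree_one hΩ hfin (ρ := ρ) (by fun_prop) (by
    intro s
    simp only [hρ]
    rw [show (s + 2 * Real.pi) / 2 = s / 2 + Real.pi by ring, Real.cos_add_pi, abs_neg]) (by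
    rw [intervalIntegral.integral_const_mul, integral_abs_cos_half]; ring)
  refine (mul_le_mul_right (Sig_le_of_equivalent hΩ h1 h2) _).trans ?_
  rw [ha.gradEnergy_sub hΩ hb, ← lintegral_const_mul' _ _ ENNReal.ofReal_ne_top]
  refine lintegral_mono_ae ?_
  filter_upwards [ha.norm_eq, hb.norm_eq] with x hx hy
  rw [← ofReal_norm, ← ofReal_norm, ← ENNReal.ofReal_mul (by positivity)]
  refine ENNReal.ofReal_le_ofReal ?_
  rw [norm_smul, hρ, Real.norm_of_nonneg (by positivity)]
  rw [show 2 / Real.pi * (Real.pi / 2 * |Real.cos (Complex.arg (u x * conj (v x)) / 2)| *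
    ‖a x + -b x‖) = ‖|Real.cos (Complex.arg (u x * conj (v x)) / 2)| • (a x + -b x)‖ by
      rw [norm_smul, Real.norm_of_nonneg (abs_nonneg _)]; field_simp]
  have := euclidean_norm_le_of_forall (X := |Real.cos (Complex.arg (u x * conj (v x)) / 2)| •
    (a x + -b x)) (Y := (WithLp.toLp 2 fun j =>
      Complex.I * u x * a x j - Complex.I * v x * b x j : EuclideanSpace ℂ (Fin N)))
      zero_le_one fun j => ?_
  · simpa using this
  · rw [one_mul]
    refine le_trans (le_of_eq ?_) (cos_half_mul_abs_sub_le hx hy (a x j) (b x j))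
    rw [PiLp.smul_apply, smul_eq_mul, norm_mul, Real.norm_of_nonneg (abs_nonneg _)]
    simp [sub_eq_add_neg]

end Angles

/-! ### Averaging over rotations of the circle -/

section Averaging

theorem lintegral_shift_of_periodic {q : ℝ → ℝ} (hq : Continuous q) (hq0 : ∀ s, 0 ≤ q s)
    (hp : Function.Periodic q (2 * Real.pi)) (θ : ℝ) :
    ∫⁻ t in Ioc 0 (2 * Real.pi), ENNReal.ofReal (q (θ - t))
      = ENNReal.ofReal (∫ s in (0 : ℝ)..2 * Real.pi, q s) := by
  have hpi := Real.two_pi_pos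
  have hc : Continuous fun t => q (θ - t) := by fun_prop
  rw [← ofReal_integral_eq_lintegral_ofReal (hc.integrableOn_Ioc)
      (Eventually.of_forall fun t => hq0 _),
    ← intervalIntegral.integral_of_le hpi.le, intervalIntegral.integral_comp_sub_left]
  have := hp.intervalIntegral_add_eq (θ - 2 * Real.pi) 0
  rw [sub_add_cancel, zero_add] at this
  rw [sub_zero, this]

/-- Average over t in a period and exchange the integrals: for fixed x the shifts of q and p
integrate to the same value whatever θ(x) is. The sum is averaged as a whole because one t has to
serve both terms. -/
theorem exists_shift_le {X : Type*} [MeasurableSpace X] {μ : Measure X} [SFinite μ] {θ : X → ℝ}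
    (hθ : AEMeasurable θ μ) {q p : ℝ → ℝ} (hq : Continuous q) (hq0 : ∀ s, 0 ≤ q s)
    (hqp : Function.Periodic q (2 * Real.pi)) (hp : Continuous p) (hp0 : ∀ s, 0 ≤ p s)
    (hpp : Function.Periodic p (2 * Real.pi)) {A C : X → ℝ≥0∞} (hA : AEMeasurable A μ)
    (hC : AEMeasurable C μ) :
    ∃ t : ℝ, ∫⁻ x, (ENNReal.ofReal (q (θ x - t)) * A x + ENNReal.ofReal (p (θ x - t)) * C x) ∂μ
      ≤ ENNReal.ofReal ((∫ s in (0 : ℝ)..2 * Real.pi, q s) / (2 * Real.pi)) * ∫⁻ x, A x ∂μ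
        + ENNReal.ofReal ((∫ s in (0 : ℝ)..2 * Real.pi, p s) / (2 * Real.pi)) * ∫⁻ x, C x ∂μ := by
  have hpi := Real.two_pi_pos
  set ν := (volume : Measure ℝ).restrict (Ioc 0 (2 * Real.pi)) with hν
  have hm : ∀ {k : ℝ → ℝ} {B : X → ℝ≥0∞}, Continuous k → AEMeasurable B μ →
      AEMeasurable (fun z : ℝ × X => ENNReal.ofReal (k (θ z.2 - z.1)) * B z.2) (ν.prod μ) := by
    intro k B hk hB
    have h1 : AEMeasurable (fun z : ℝ × X => θ z.2 - z.1) (ν.prod μ) :=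
      hθ.comp_snd.sub measurable_fst.aemeasurable
    exact ((hk.measurable.comp_aemeasurable h1).ennreal_ofReal).mul hB.comp_snd
  have hm' : AEMeasurable (fun z : ℝ × X => ENNReal.ofReal (q (θ z.2 - z.1)) * A z.2
      + ENNReal.ofReal (p (θ z.2 - z.1)) * C z.2) (ν.prod μ) := (hm hq hA).add (hm hp hC)
  have hν0 : ν ≠ 0 := by
    rw [hν, Ne, Measure.restrict_eq_zero, Real.volume_Ioc]
    simpa using Real.pi_pos
  obtain ⟨t, ht⟩ := exists_le_laverage hν0 (AEMeasurable.lintegral_prod_right' hm')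
  refine ⟨t, ht.trans (le_of_eq ?_)⟩
  rw [laverage_eq, lintegral_lintegral_swap hm']
  have h1 : ∀ x, ∫⁻ t, (ENNReal.ofReal (q (θ x - t)) * A x + ENNReal.ofReal (p (θ x - t)) * C x) ∂ν
      = ENNReal.ofReal (∫ s in (0 : ℝ)..2 * Real.pi, q s) * A x
        + ENNReal.ofReal (∫ s in (0 : ℝ)..2 * Real.pi, p s) * C x := by
    intro x
    have hcq : Measurable fun t => ENNReal.ofReal (q (θ x - t)) :=
      (hq.comp (continuous_const.sub continuous_id)).measurable.ennreal_ofReal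
    have hcp : Measurable fun t => ENNReal.ofReal (p (θ x - t)) :=
      (hp.comp (continuous_const.sub continuous_id)).measurable.ennreal_ofReal
    rw [lintegral_add_left (hcq.mul_const _), lintegral_mul_const _ hcq, lintegral_mul_const _ hcp,
      lintegral_shift_of_periodic hq hq0 hqp, lintegral_shift_of_periodic hp hp0 hpp]
  simp_rw [h1]
  rw [lintegral_add_left' (hA.const_mul _), lintegral_const_mul' _ _ ENNReal.ofReal_ne_top,
    lintegral_const_mul' _ _ ENNReal.ofReal_ne_top, hν, Measure.restrict_apply_univ,
    Real.volume_Ioc, sub_zero, ENNReal.ofReal_div_of_pos hpi, ENNReal.ofReal_div_of_pos hpi,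
    ENNReal.add_div]
  simp only [div_eq_mul_inv]
  ring

end Averaging

/-! ### Competing pairs built from a reparametrised quotient -/

section Upper

variable {N : ℕ} {Ω : Set (Space N)} {u v w u₀ : Space N → ℂ}
  {a b c : Space N → EuclideanSpace ℝ (Fin N)} {ρ Ψ Ψ' : ℝ → ℝ}

/-- The circle map `s ↦ e^{iΘ(s)}`, `Θ(s) = π + ∫₀^s ρ`. -/
def windMap (ρ : ℝ → ℝ) (s : ℝ) : ℂ :=
  Complex.exp (Complex.I * ((Real.pi + (s + angleShift ρ s) : ℝ) : ℂ))

theorem continuous_windMap (hc : Continuous ρ) : Continuous (windMap ρ) := by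
  have := (contDiff_angleShift hc).continuous
  unfold windMap
  fun_prop

theorem windMap_periodic (hc : Continuous ρ) (hp : Function.Periodic ρ (2 * Real.pi))
    (hint : ∫ s in (0 : ℝ)..2 * Real.pi, ρ s = 2 * Real.pi) :
    Function.Periodic (windMap ρ) (2 * Real.pi) := by
  intro s
  simp only [windMap, angleShift_periodic hc hp hint s]
  rw [show Complex.I * ((Real.pi + (s + 2 * Real.pi + angleShift ρ s) : ℝ) : ℂ)
    = Complex.I * ((Real.pi + (s + angleShift ρ s) : ℝ) : ℂ) + 2 * Real.pi * Complex.I by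
      push_cast; ring, Complex.exp_periodic]

/-- With W = `windMap ρ (arg w - t)`, which is equivalent to w, take u = u₀ e^{iΨ(arg w − t)} and v
= u W̄. Then ∇(u − v) = i v ((W − 1) a + ((W − 1)Ψ' + ρ) c), and a good t comes from averaging. The
choice of ρ and Ψ is left open to serve both upper bounds. -/
theorem exists_pair (hΩ : IsOpen Ω) (hfin : volume Ω ≠ ⊤) (hu : IsCircleMap Ω u₀ a)
    (hw : IsCircleMap Ω w c) (hc : Continuous ρ) (hp : Function.Periodic ρ (2 * Real.pi))
    (hint : ∫ s in (0 : ℝ)..2 * Real.pi, ρ s = 2 * Real.pi)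
    (hΨ : ∀ s, HasDerivAt Ψ (Ψ' s) s) (hΨ' : Continuous Ψ')
    (hΨp : Function.Periodic Ψ (2 * Real.pi)) (hΨp' : Function.Periodic Ψ' (2 * Real.pi)) :
    ∃ (t : ℝ) (u v : Space N → ℂ),
      (u = fun x => u₀ x * Complex.exp (Complex.I * Ψ (Complex.arg (w x) - t))) ∧
      u ∈ W11Circle Ω ∧ v ∈ W11Circle Ω ∧ Equivalent Ω u u₀ ∧
      Equivalent Ω v (fun x => u₀ x * conj (w x)) ∧
      gradEnergy Ω (fun x => u x - v x) ≤
        ENNReal.ofReal ((∫ s in (0 : ℝ)..2 * Real.pi, ‖windMap ρ s - 1‖) / (2 * Real.pi))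
          * (∫⁻ x in Ω, ‖a x‖ₑ) +
        ENNReal.ofReal ((∫ s in (0 : ℝ)..2 * Real.pi, ‖(windMap ρ s - 1) * Ψ' s + ρ s‖)
          / (2 * Real.pi)) * ∫⁻ x in Ω, ‖c x‖ₑ := by
  have hcw := continuous_windMap hc
  have hpw := windMap_periodic hc hp hint
  have hθ : AEMeasurable (fun x => Complex.arg (w x)) (volume.restrict Ω) :=
    Complex.measurable_arg.comp_aemeasurable
      (hw.partials.loc.aestronglyMeasurable).aemeasurable
  obtain ⟨t, ht⟩ := exists_shift_le hθ (q := fun s => ‖windMap ρ s - 1‖)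
    (p := fun s => ‖(windMap ρ s - 1) * Ψ' s + ρ s‖) (by fun_prop) (fun _ => norm_nonneg _)
    (fun s => by simp only [hpw s]) (by fun_prop) (fun _ => norm_nonneg _)
    (fun s => by simp only [hpw s, hΨp' s, hp s]) hu.integrable.1.enorm hw.integrable.1.enorm
  have hd1 : ∀ s, HasDerivAt (fun s => Ψ (s - t)) (Ψ' (s - t)) s := fun s =>
    (hΨ (s - t)).comp_sub_const s t
  -- The periodic phase that turns w = e^{i arg w} into `windMap ρ (arg w - t)`: the non-periodic
  -- part arg w is already carried by w.
  have hd2 : ∀ s, HasDerivAt (fun s => Real.pi - t + angleShift ρ (s - t)) (ρ (s - t) - 1) s :=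
    fun s => ((hasDerivAt_angleShift hc (s - t)).comp_sub_const s t).const_add (Real.pi - t)
  have hcd : ∀ {f f' : ℝ → ℝ}, (∀ s, HasDerivAt f (f' s) s) → Continuous f' → ContDiff ℝ 1 f := by
    intro f f' h h'
    rw [contDiff_one_iff_deriv]
    refine ⟨fun s => (h s).differentiableAt, ?_⟩
    rwa [funext fun s => (h s).deriv]
  obtain ⟨p1, p2, p3⟩ := hw.comp_arg hΩ hfin (f := fun s => Ψ (s - t)) (fun s => by
    simp only; rw [← hΨp (s - t)]; ring_nf) (hcd hd1 (by fun_prop))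
  obtain ⟨q1, q2, q3⟩ := hw.comp_arg hΩ hfin (f := fun s => Real.pi - t + angleShift ρ (s - t))
    (fun s => by
      simp only; rw [← angleShift_periodic hc hp hint (s - t)]; ring_nf) (hcd hd2 (by fun_prop))
  have hU := hu.mul_exp hΩ p1 p3
  have hW := hw.mul_exp hΩ q1 q3
  have hV := hU.mul hΩ hW.conj
  have eU := equivalent_mul_exp (memW11_iff.2 ⟨p2, _, p1, p3⟩) u₀
  have eW := equivalent_mul_exp (memW11_iff.2 ⟨q2, _, q1, q3⟩) w
  refine ⟨t, _, _, rfl, hU.mem_W11Circle hfin, hV.mem_W11Circle hfin, eU, eU.mul eW.conj, ?_⟩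
  rw [hU.gradEnergy_sub hΩ hV]
  refine le_trans (lintegral_mono_ae ?_) ht
  filter_upwards [hu.norm_eq, hw.norm_eq, hV.norm_eq, hW.norm_eq] with x h1 h2 h3 h4
  set U := u₀ x * Complex.exp (Complex.I * Ψ (Complex.arg (w x) - t)) with hUdef
  set W := w x * Complex.exp (Complex.I *
    ((Real.pi - t + angleShift ρ (Complex.arg (w x) - t) : ℝ) : ℂ)) with hWdef
  have hWw : W = windMap ρ (Complex.arg (w x) - t) := by
    have : w x = Complex.exp (Complex.I * Complex.arg (w x)) := by
      have := Complex.norm_mul_exp_arg_mul_I (w x)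
      rw [h2, Complex.ofReal_one, one_mul] at this
      rw [mul_comm, this]
    rw [hWdef, windMap]
    nth_rewrite 1 [this]
    rw [← Complex.exp_add]
    congr 1
    push_cast
    ring
  have hUW : U = (U * conj W) * W := by
    rw [mul_assoc, mul_comm (conj W), Complex.mul_conj, Complex.normSq_eq_norm_sq, h4]
    simp
  -- Substitute u = v W (`hUW`) and collect the coefficients of a and c; the common factor i v has
  -- modulus one.
  have e1 : (WithLp.toLp 2 fun j =>
      Complex.I * U * ((a x + deriv (fun s => Ψ (s - t)) (Complex.arg (w x)) • c x) j : ℝ)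
      - Complex.I * (U * conj W) * ((a x + deriv (fun s => Ψ (s - t)) (Complex.arg (w x)) • c x +
        -(c x + deriv (fun s => Real.pi - t + angleShift ρ (s - t)) (Complex.arg (w x)) • c x)) j :
            ℝ)
        : EuclideanSpace ℂ (Fin N))
      = (WithLp.toLp 2 fun j => (Complex.I * (U * conj W) * (W - 1)) * (a x j : ℂ)) +
        (WithLp.toLp 2 fun j => (Complex.I * (U * conj W) *
          ((W - 1) * Ψ' (Complex.arg (w x) - t) + ρ (Complex.arg (w x) - t))) * (c x j : ℂ)) := by
    ext j
    rw [(hd1 _).deriv, (hd2 _).deriv]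
    simp
    linear_combination (Complex.I * ((a x j : ℂ) + Ψ' (Complex.arg (w x) - t) * (c x j : ℂ))) * hUW
  refine (le_of_eq (congrArg _ e1)).trans ((enorm_add_le _ _).trans (le_of_eq ?_))
  rw [← hWw]
  simp only [← ofReal_norm]
  rw [norm_toLp_mul_ofReal, norm_toLp_mul_ofReal, norm_mul, norm_mul (Complex.I * (U * conj W)),
    norm_mul Complex.I, h3, Complex.norm_I, one_mul, one_mul, one_mul,
    ENNReal.ofReal_mul (norm_nonneg _), ENNReal.ofReal_mul (norm_nonneg _)]

end Upper

/-! ### Concentrated densities -/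

section Density

theorem windMap_eq_one_of_integral {ρ : ℝ → ℝ} {s : ℝ}
    (h : ∫ r in (0 : ℝ)..s, ρ r = Real.pi ∨ ∫ r in (0 : ℝ)..s, ρ r = -Real.pi) :
    windMap ρ s = 1 := by
  rw [windMap, angleShift, add_sub_cancel]
  rcases h with h | h
  · rw [h, Complex.exp_eq_one_iff]
    exact ⟨1, by push_cast; ring⟩
  · rw [h]; simp

/-- Concentrated even probability densities on the circle. -/
theorem exists_density {ε : ℝ} (h0 : 0 < ε) (h1 : ε < Real.pi / 2) :
    ∃ ρ : ℝ → ℝ, Continuous ρ ∧ Function.Periodic ρ (2 * Real.pi) ∧ (∀ s, 0 ≤ ρ s) ∧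
      ∫ s in (0 : ℝ)..2 * Real.pi, ρ s = 2 * Real.pi ∧
      (∀ s, Real.cos s ≤ Real.cos ε → ρ s = 0 ∧ windMap ρ s = 1) := by
  have hpi := Real.pi_pos
  -- A continuous, even, periodic bump, nonzero exactly within distance ε of 2πℤ; describing that
  -- set by cosines keeps periodicity automatic.
  set k : ℝ → ℝ := fun s => max 0 (Real.cos s - Real.cos ε) with hk
  have hkc : Continuous k := by fun_prop
  have hk0 : ∀ s, 0 ≤ k s := fun s => le_max_left _ _
  have hkp : Function.Periodic k (2 * Real.pi) := fun s => by simp [hk, Real.cos_periodic s]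
  have hpos : 0 < ∫ s in (0 : ℝ)..2 * Real.pi, k s := by
    refine intervalIntegral.integral_pos (by linarith) hkc.continuousOn (fun x _ => hk0 x)
      ⟨0, ⟨le_rfl, by linarith⟩, ?_⟩
    simp only [hk, Real.cos_zero, lt_max_iff]
    right
    have : Real.cos ε < Real.cos 0 := Real.cos_lt_cos_of_nonneg_of_le_pi le_rfl (by linarith) h0
    rw [Real.cos_zero] at this
    linarith
  set I := ∫ s in (0 : ℝ)..2 * Real.pi, k s with hI
  set ρ : ℝ → ℝ := fun s => 2 * Real.pi / I * k s with hρ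
  have hc : Continuous ρ := by fun_prop
  have hp : Function.Periodic ρ (2 * Real.pi) := fun s => by simp only [hρ, hkp s]
  have hint : ∫ s in (0 : ℝ)..2 * Real.pi, ρ s = 2 * Real.pi := by
    rw [hρ, intervalIntegral.integral_const_mul, ← hI]; field_simp
  have hz : ∀ s, Real.cos s ≤ Real.cos ε → ρ s = 0 := fun s hs => by
    simp only [hρ, hk]
    rw [max_eq_left (by linarith), mul_zero]
  have heven : ∀ s, ρ (-s) = ρ s := fun s => by simp [hρ, hk]
  have hi : ∀ x y : ℝ, IntervalIntegrable ρ volume x y := fun x y => hc.intervalIntegrable x y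
  have hneg : ∀ s : ℝ, ∫ r in (0 : ℝ)..(-s), ρ r = - ∫ r in (0 : ℝ)..s, ρ r := fun s => by
    have := intervalIntegral.integral_comp_neg (a := 0) (b := s) ρ
    simp_rw [heven] at this
    rw [this, neg_zero, intervalIntegral.integral_symm]
  -- By evenness each half period carries half the mass, so beyond ±ε the primitive is ±π; with the
  -- base angle π of `windMap` this gives W = 1 there.
  have hhalf : ∫ r in (0 : ℝ)..Real.pi, ρ r = Real.pi := by
    have e1 := hp.intervalIntegral_add_eq 0 (-Real.pi)
    rw [zero_add, hint, show -Real.pi + 2 * Real.pi = Real.pi by ring] at e1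
    have e2 := intervalIntegral.integral_add_adjacent_intervals (hi (-Real.pi) 0) (hi 0 Real.pi)
    rw [intervalIntegral.integral_symm 0 (-Real.pi), hneg] at e2
    linarith
  have hright : ∀ s, ε ≤ s → s ≤ Real.pi → ∫ r in (0 : ℝ)..s, ρ r = Real.pi := by
    intro s hs1 hs2
    have e2 := intervalIntegral.integral_add_adjacent_intervals (hi 0 s) (hi s Real.pi)
    have e3 : ∫ r in s..Real.pi, ρ r = 0 := by
      rw [intervalIntegral.integral_congr (g := fun _ => 0), intervalIntegral.integral_zero]
      intro r hr
      rw [uIcc_of_le hs2] at hr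
      exact hz r (Real.cos_le_cos_of_nonneg_of_le_pi h0.le hr.2 (hs1.trans hr.1))
    linarith
  refine ⟨ρ, hc, hp, fun s => by simp only [hρ]; have := hk0 s; positivity, hint,
    fun s hs => ⟨hz s hs, ?_⟩⟩
  have hm := toIocMod_mem_Ioc Real.two_pi_pos (-Real.pi) s
  have hper : ∀ {β : Type} {f : ℝ → β}, Function.Periodic f (2 * Real.pi) →
      f (toIocMod Real.two_pi_pos (-Real.pi) s) = f s := by
    intro β f hf
    rw [toIocMod, hf.sub_zsmul_eq]
  rw [← hper (windMap_periodic hc hp hint)]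
  rw [← hper Real.cos_periodic] at hs
  set s' := toIocMod Real.two_pi_pos (-Real.pi) s
  rw [show -Real.pi + 2 * Real.pi = Real.pi by ring] at hm
  have habs : ε ≤ |s'| := by
    by_contra hlt
    push Not at hlt
    have := Real.cos_lt_cos_of_nonneg_of_le_pi (abs_nonneg s') (by linarith) hlt
    rw [Real.cos_abs] at this
    linarith
  refine windMap_eq_one_of_integral ?_
  rcases abs_cases s' with ⟨h, -⟩ | ⟨h, -⟩
  · exact Or.inl (hright s' (by linarith) hm.2)
  · right
    rw [← neg_neg s', hneg, hright (-s') (by linarith) (by linarith [hm.1])]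

variable {ρ : ℝ → ℝ} {ε : ℝ}

theorem norm_windMap (ρ : ℝ → ℝ) (s : ℝ) : ‖windMap ρ s‖ = 1 := by
  rw [windMap, mul_comm, Complex.norm_exp_ofReal_mul_I]

/-- W ≠ 1 only on an arc of length at most 2ε, where |W − 1| ≤ 2. -/
theorem integral_windMap_sub_one_le (h0 : 0 < ε) (h1 : ε < Real.pi / 2) (hc : Continuous ρ)
    (hp : Function.Periodic ρ (2 * Real.pi))
    (hint : ∫ s in (0 : ℝ)..2 * Real.pi, ρ s = 2 * Real.pi)
    (h : ∀ s, Real.cos s ≤ Real.cos ε → ρ s = 0 ∧ windMap ρ s = 1) :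
    ∫ s in (0 : ℝ)..2 * Real.pi, ‖windMap ρ s - 1‖ ≤ 4 * ε := by
  have hpi := Real.pi_pos
  have hcw := continuous_windMap hc
  have hcc : Continuous fun s => ‖windMap ρ s - 1‖ := by fun_prop
  have hpp : Function.Periodic (fun s => ‖windMap ρ s - 1‖) (2 * Real.pi) :=
    fun s => by simp only [windMap_periodic hc hp hint s]
  have e1 := hpp.intervalIntegral_add_eq 0 (-Real.pi)
  rw [zero_add, show -Real.pi + 2 * Real.pi = Real.pi by ring] at e1
  have hi : ∀ x y : ℝ, IntervalIntegrable (fun s => ‖windMap ρ s - 1‖) volume x y :=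
    fun x y => hcc.intervalIntegrable x y
  have hz : ∀ s, ε ≤ |s| → |s| ≤ Real.pi → ‖windMap ρ s - 1‖ = 0 := by
    intro s h2 h3
    rw [(h s _).2, sub_self, norm_zero]
    rw [← Real.cos_abs s]
    exact Real.cos_le_cos_of_nonneg_of_le_pi h0.le h3 h2
  rw [e1, ← intervalIntegral.integral_add_adjacent_intervals (hi _ (-ε)) (hi _ _),
    ← intervalIntegral.integral_add_adjacent_intervals (hi (-ε) ε) (hi _ _)]
  have e2 : ∫ s in (-Real.pi)..(-ε), ‖windMap ρ s - 1‖ = 0 := by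
    rw [intervalIntegral.integral_congr (g := fun _ => 0), intervalIntegral.integral_zero]
    intro s hs
    rw [uIcc_of_le (by linarith)] at hs
    have : |s| = -s := abs_of_nonpos (by linarith [hs.2])
    exact hz s (by linarith [hs.2]) (by linarith [hs.1])
  have e3 : ∫ s in ε..Real.pi, ‖windMap ρ s - 1‖ = 0 := by
    rw [intervalIntegral.integral_congr (g := fun _ => 0), intervalIntegral.integral_zero]
    intro s hs
    rw [uIcc_of_le (by linarith)] at hs
    have : |s| = s := abs_of_nonneg (by linarith [hs.1])
    exact hz s (by linarith [hs.1]) (by linarith [hs.2])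
  have e4 : ∫ s in (-ε)..ε, ‖windMap ρ s - 1‖ ≤ ∫ s in (-ε)..ε, (2 : ℝ) := by
    refine intervalIntegral.integral_mono_on (by linarith) (hi _ _) (by simp) fun s _ => ?_
    have := norm_sub_le (windMap ρ s) 1
    rw [norm_windMap, norm_one] at this
    linarith
  rw [e2, e3]
  simp at e4
  linarith

theorem norm_windMap_add_one (ρ : ℝ → ℝ) (s : ℝ) :
    ‖windMap ρ s + 1‖ = 2 * |Real.cos ((Real.pi + ∫ r in (0 : ℝ)..s, ρ r) / 2)| := by
  set x := (Real.pi + ∫ r in (0 : ℝ)..s, ρ r) / 2 with hx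
  have h1 : windMap ρ s = Complex.exp (x * Complex.I) * Complex.exp (x * Complex.I) := by
    rw [windMap, angleShift, add_sub_cancel, ← Complex.exp_add, hx]
    congr 1
    push_cast
    ring
  have h2 : windMap ρ s + 1 = Complex.exp (x * Complex.I) * (2 * Real.cos x : ℝ) := by
    rw [h1, Complex.ofReal_mul, Complex.ofReal_cos]
    rw [show ((2 : ℝ) : ℂ) = 2 by norm_num, Complex.two_cos, mul_add, ← Complex.exp_add,
      ← Complex.exp_add]
    simp
  rw [h2, norm_mul, Complex.norm_exp_ofReal_mul_I, one_mul, Complex.norm_real, Real.norm_eq_abs,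
    abs_mul, abs_two]

/-- Where W ≠ 1 the antipodal density ρ(s − π) vanishes because ε < π/2. The integrand therefore
reduces to |W + 1| ρ/2 = |cos(Θ/2)| Θ', with Θ the angle of W, and the substitution y = Θ(s) leaves
|cos(y/2)| over one period. -/
theorem integral_windMap_half (hc : Continuous ρ) (hρ0 : ∀ s, 0 ≤ ρ s)
    (hint : ∫ s in (0 : ℝ)..2 * Real.pi, ρ s = 2 * Real.pi) (h0 : 0 < ε) (h1 : ε < Real.pi / 2)
    (h : ∀ s, Real.cos s ≤ Real.cos ε → ρ s = 0 ∧ windMap ρ s = 1) :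
    ∫ s in (0 : ℝ)..2 * Real.pi,
      ‖(windMap ρ s - 1) * ((ρ s - ρ (s - Real.pi)) / 2 : ℝ) + ρ s‖ = 4 := by
  have hcos : 0 < Real.cos ε := Real.cos_pos_of_mem_Ioo ⟨by linarith, h1⟩
  have hz : ∀ s, (windMap ρ s - 1) * (ρ (s - Real.pi) : ℂ) = 0 := by
    intro s
    by_cases h2 : Real.cos s ≤ Real.cos ε
    · rw [(h s h2).2, sub_self, zero_mul]
    · rw [(h (s - Real.pi) (by rw [Real.cos_sub_pi]; linarith)).1]; simp
  have e1 : ∀ s, ‖(windMap ρ s - 1) * ((ρ s - ρ (s - Real.pi)) / 2 : ℝ) + ρ s‖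
      = |Real.cos ((Real.pi + ∫ r in (0 : ℝ)..s, ρ r) / 2)| * ρ s := by
    intro s
    have : (windMap ρ s - 1) * (((ρ s - ρ (s - Real.pi)) / 2 : ℝ) : ℂ) + ρ s
        = (windMap ρ s + 1) * ((ρ s / 2 : ℝ) : ℂ) := by
      push_cast
      linear_combination (-1 / 2) * hz s
    rw [this, norm_mul, norm_windMap_add_one, Complex.norm_real,
      Real.norm_of_nonneg (by linarith [hρ0 s])]
    ring
  simp_rw [e1]
  have hd : ∀ s ∈ uIcc (0 : ℝ) (2 * Real.pi), HasDerivAt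
      (fun s => Real.pi + ∫ r in (0 : ℝ)..s, ρ r) (ρ s) s := fun s _ =>
    (intervalIntegral.integral_hasDerivAt_right (hc.intervalIntegrable _ _)
    (hc.stronglyMeasurableAtFilter _ _) hc.continuousAt).const_add _
  have e2 := intervalIntegral.integral_comp_mul_deriv hd hc.continuousOn
    (g := fun y => |Real.cos (y / 2)|) (by fun_prop)
  simp only [Function.comp] at e2
  rw [e2, hint, intervalIntegral.integral_same, add_zero]
  have hp : Function.Periodic (fun s : ℝ => |Real.cos (s / 2)|) (2 * Real.pi) := by
    intro s
    simp only
    rw [show (s + 2 * Real.pi) / 2 = s / 2 + Real.pi by ring, Real.cos_add_pi, abs_neg]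
  rw [hp.intervalIntegral_add_eq Real.pi 0, zero_add, integral_abs_cos_half]

end Density

/-! ### Upper bounds for the distances and the value of dist -/

section UpperBounds

variable {N : ℕ} {Ω : Set (Space N)} {u v w u₀ v₀ : Space N → ℂ}
  {a b c : Space N → EuclideanSpace ℝ (Fin N)}

theorem mem_equivClass_of_mul_conj (hfin : volume Ω ≠ ⊤)
    (hu₀ : u₀ ∈ W11Circle Ω) (hv : v ∈ W11Circle Ω)
    (h : Equivalent Ω v fun x => u₀ x * conj (w x))
    (hw : Equivalent Ω w fun x => u₀ x * conj (v₀ x)) : v ∈ equivClass Ω v₀ := by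
  refine ⟨hv, h.trans (((Equivalent.refl hfin u₀).mul hw.conj).trans
    (Equivalent.of_ae_eq hfin ?_))⟩
  filter_upwards [hu₀.2] with x hx
  simp only [map_mul, Complex.conj_conj]
  rw [← mul_assoc, Complex.mul_conj, Complex.normSq_eq_norm_sq, hx]
  simp

theorem ennreal_le_of_forall_small {D A B : ℝ≥0∞} (hA : A ≠ ⊤)
    (h : ∀ ε : ℝ, 0 < ε → ε < Real.pi / 2 → D ≤ ENNReal.ofReal ε * A + B) : D ≤ B := by
  have ht : Tendsto (fun ε : ℝ => ENNReal.ofReal ε * A + B) (𝓝[>] 0)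
      (𝓝 (ENNReal.ofReal 0 * A + B)) := by
    refine Tendsto.add_const _ (ENNReal.Tendsto.mul_const ?_ (Or.inr hA))
    exact (ENNReal.continuous_ofReal.tendsto 0).mono_left nhdsWithin_le_nhds
  rw [ENNReal.ofReal_zero, zero_mul, zero_add] at ht
  refine ge_of_tendsto ht ?_
  filter_upwards [Ioo_mem_nhdsGT (show (0 : ℝ) < Real.pi / 2 by positivity)] with ε hε
  exact h ε hε.1 hε.2

/-- Take Ψ = 0, so u itself is kept; the coefficient of ∫|c| is then the mean of ρ, which is one,
and that of ∫|a| is at most ε. -/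
theorem distTo_le_Sig (hΩ : IsOpen Ω) (hfin : volume Ω ≠ ⊤) (hu : u ∈ W11Circle Ω)
    (hv : v₀ ∈ W11Circle Ω) :
    distTo Ω u (equivClass Ω v₀) ≤ Sig Ω fun x => u x * conj (v₀ x) := by
  refine le_of_forall_gt fun T hT => ?_
  obtain ⟨w, c, hw, hwe, hlt⟩ := exists_of_Sig_lt hΩ (mul_conj_mem hΩ hfin hu hv) hT
  refine lt_of_le_of_lt ?_ hlt
  obtain ⟨a, ha⟩ := exists_isCircleMap hΩ hu
  refine ennreal_le_of_forall_small ha.integrable.2.ne fun ε h0 h1 => ?_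
  obtain ⟨ρ, hc, hp, hρ0, hint, hz⟩ := exists_density h0 h1
  obtain ⟨t, u', v, hu', -, hvm, -, hve, hle⟩ := exists_pair hΩ hfin ha hw hc hp hint
      (Ψ := fun _ => 0)
    (Ψ' := fun _ => 0) (fun s => hasDerivAt_const s 0) continuous_const (fun _ => rfl)
        (fun _ => rfl)
  have huu : u' = u := by rw [hu']; simp
  rw [huu] at hle
  refine (iInf₂_le v (mem_equivClass_of_mul_conj hfin hu hvm hve hwe)).trans (hle.trans ?_)
  have e1 : ∫ s in (0 : ℝ)..2 * Real.pi, ‖(windMap ρ s - 1) * ((0 : ℝ) : ℂ) + ρ s‖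
      = 2 * Real.pi := by
    conv_rhs => rw [← hint]
    refine intervalIntegral.integral_congr fun s _ => ?_
    simp [abs_of_nonneg (hρ0 s)]
  rw [e1, div_self Real.two_pi_pos.ne', ENNReal.ofReal_one, one_mul]
  gcongr
  rw [div_le_iff₀ Real.two_pi_pos]
  have := integral_windMap_sub_one_le h0 h1 hc hp hint hz
  nlinarith [Real.pi_gt_three]

/-- Now both maps may move. Letting u and v turn by half of the jump each, in opposite directions,
shortens the path of u − v and brings the coefficient of ∫|c| down to 4/(2π). -/
theorem distInf_le_Sig (hΩ : IsOpen Ω) (hfin : volume Ω ≠ ⊤) (hu : u₀ ∈ W11Circle Ω)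
    (hv : v₀ ∈ W11Circle Ω) :
    distInf Ω (equivClass Ω u₀) (equivClass Ω v₀)
      ≤ ENNReal.ofReal (2 / Real.pi) * Sig Ω fun x => u₀ x * conj (v₀ x) := by
  have hk0 : ENNReal.ofReal (2 / Real.pi) ≠ 0 := by
    rw [Ne, ENNReal.ofReal_eq_zero, not_le]; have := Real.pi_pos; positivity
  rw [← ENNReal.div_le_iff' hk0 ENNReal.ofReal_ne_top]
  refine le_of_forall_gt fun T hT => ?_
  obtain ⟨w, c, hw, hwe, hlt⟩ := exists_of_Sig_lt hΩ (mul_conj_mem hΩ hfin hu hv) hT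
  refine lt_of_le_of_lt ?_ hlt
  rw [ENNReal.div_le_iff' hk0 ENNReal.ofReal_ne_top]
  obtain ⟨a, ha⟩ := exists_isCircleMap hΩ hu
  refine ennreal_le_of_forall_small ha.integrable.2.ne fun ε h0 h1 => ?_
  obtain ⟨ρ, hc, hp, hρ0, hint, hz⟩ := exists_density h0 h1
  have hpa := angleShift_periodic hc hp hint
  -- Ψ' = ρ/2 would be the symmetric split, but its primitive is not periodic. The term −ρ(s − π)/2
  -- restores mean zero and acts only where W = 1, so it costs nothing.
  obtain ⟨t, u, v, -, hum, hvm, hue, hve, hle⟩ := exists_pair hΩ hfin ha hw hc hp hint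
    (Ψ := fun s => (angleShift ρ s - angleShift ρ (s - Real.pi)) / 2)
    (Ψ' := fun s => (ρ s - ρ (s - Real.pi)) / 2) (fun s => by
      have := ((hasDerivAt_angleShift hc s).sub
        ((hasDerivAt_angleShift hc (s - Real.pi)).comp_sub_const s Real.pi)).div_const 2
      exact this.congr_deriv (by ring)) (by fun_prop) (fun s => by
      have := hpa (s - Real.pi)
      simp only
      rw [hpa s, ← this, sub_add_eq_add_sub]) (fun s => by
      have := hp (s - Real.pi)
      simp only
      rw [hp s, ← this, sub_add_eq_add_sub])
  refine (iInf₂_le u ⟨hum, hue⟩).trans ((iInf₂_le v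
    (mem_equivClass_of_mul_conj hfin hu hvm hve hwe)).trans (hle.trans ?_))
  rw [integral_windMap_half hc hρ0 hint h0 h1 hz, show 4 / (2 * Real.pi) = 2 / Real.pi by
    field_simp; norm_num]
  gcongr
  rw [div_le_iff₀ Real.two_pi_pos]
  have := integral_windMap_sub_one_le h0 h1 hc hp hint hz
  nlinarith [Real.pi_gt_three]

theorem le_distInf (hΩ : IsOpen Ω) (hfin : volume Ω ≠ ⊤) (u₀ v₀ : Space N → ℂ) :
    ENNReal.ofReal (2 / Real.pi) * Sig Ω (fun x => u₀ x * conj (v₀ x))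
      ≤ distInf Ω (equivClass Ω u₀) (equivClass Ω v₀) := by
  refine le_iInf₂ fun u hu' => le_iInf₂ fun v hv' => ?_
  refine le_trans (mul_le_mul_right ?_ _) (two_div_pi_mul_Sig_le hΩ hfin hu'.1 hv'.1)
  exact Sig_le_of_equivalent_right hΩ (mul_conj_mem hΩ hfin hu'.1 hv'.1) (hu'.2.mul hv'.2.conj)

end UpperBounds

/-! ### Oscillating integrals against weakly differentiable functions -/

section Oscillation

variable {N : ℕ} {Ω : Set (Space N)}

/-- Quantitative Riemann–Lebesgue lemma for weakly differentiable functions. -/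
theorem exists_oscillation_bound {p : ℝ → ℝ} (hp : ContDiff ℝ ∞ p)
    (hper : Function.Periodic p (2 * Real.pi)) (hint : ∫ s in (0 : ℝ)..2 * Real.pi, p s = 0)
    (j : Fin N) {η : Space N → ℝ} (hη : ContDiff ℝ ∞ η) (hηc : HasCompactSupport η)
    (hηs : tsupport η ⊆ Ω) :
    ∃ B : ℝ, 0 ≤ B ∧ ∀ k : ℝ, 0 < k → ∀ (G : Space N → ℝ) (gr : Fin N → Space N → ℝ),
      HasWeakPartials Ω G gr → (∀ᵐ x ∂(volume.restrict Ω), |G x| ≤ 2) → IntegrableOn (gr j) Ω →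
      |∫ x in Ω, η x * p (k * x j) * G x| ≤ B / k * (1 + ∫ x in Ω, |gr j x|) := by
  -- Since p has mean zero, P is periodic and hence bounded.
  set P : ℝ → ℝ := fun t => ∫ s in (0 : ℝ)..t, p s with hPdef
  have hP' : ∀ t, HasDerivAt P (p t) t := fun t =>
    intervalIntegral.integral_hasDerivAt_right (hp.continuous.intervalIntegrable _ _)
      (hp.continuous.stronglyMeasurableAtFilter _ _) hp.continuous.continuousAt
  have hP : ContDiff ℝ ∞ P := by
    rw [contDiff_infty_iff_deriv]
    refine ⟨fun t => (hP' t).differentiableAt, ?_⟩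
    rwa [funext fun t => (hP' t).deriv]
  have hPper : Function.Periodic P (2 * Real.pi) := by
    intro t
    have h1 := hper.intervalIntegral_add_eq t 0
    rw [zero_add, hint] at h1
    have h2 := intervalIntegral.integral_add_adjacent_intervals (μ := volume)
      (hp.continuous.intervalIntegrable 0 t) (hp.continuous.intervalIntegrable t (t + 2 * Real.pi))
    simp only [hPdef]
    rw [← h2, h1, add_zero]
  obtain ⟨B₁, hB₁⟩ : ∃ B₁, ∀ t, |P t| ≤ B₁ := by
    obtain ⟨C, hC⟩ := (isCompact_Icc (a := 0) (b := 2 * Real.pi)).exists_bound_of_continuousOn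
      hP.continuous.continuousOn
    refine ⟨C, fun t => ?_⟩
    obtain ⟨y, hy, hyt⟩ := hPper.exists_mem_Ico₀ Real.two_pi_pos t
    rw [hyt]
    exact hC y ⟨hy.1, hy.2.le⟩
  obtain ⟨M, hM⟩ := hηc.exists_bound_of_continuous hη.continuous
  have hM0 : 0 ≤ M := (norm_nonneg _).trans (hM 0)
  have hB0 : 0 ≤ B₁ := (abs_nonneg _).trans (hB₁ 0)
  set e : Space N := EuclideanSpace.single j 1 with he
  have hηd : Continuous fun x => fderiv ℝ η x e :=
    (hη.continuous_fderiv (by simp)).clm_apply continuous_const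
  have hηdc : HasCompactSupport fun x => fderiv ℝ η x e :=
    hηc.of_isClosed_subset (isClosed_tsupport _) (tsupport_fderiv_apply_subset _)
  have hηi : Integrable fun x => fderiv ℝ η x e := hηd.integrable_of_hasCompactSupport hηdc
  set D := ∫ x in Ω, |fderiv ℝ η x e| with hD
  have hD0 : 0 ≤ D := integral_nonneg fun x => abs_nonneg _
  refine ⟨B₁ * (2 * D + M), by positivity, fun k hk G gr hG hG2 hgr => ?_⟩
  have hI0 : 0 ≤ ∫ x in Ω, |gr j x| := integral_nonneg fun x => abs_nonneg _
  let ℓ : Space N →L[ℝ] ℝ := EuclideanSpace.proj j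
  have hℓe : ℓ e = 1 := by simp [ℓ, he]
  -- The test function for the weak equation: ∂ⱼζ contains k η p(k xⱼ), and all other terms stay
  -- bounded as k grows.
  set ζ : Space N → ℝ := fun x => η x * P (k * x j) with hζ
  have hQ : ContDiff ℝ ∞ fun x : Space N => P (k * x j) :=
    hP.comp (contDiff_const.mul ℓ.contDiff)
  have hζd : ContDiff ℝ ∞ ζ := hη.mul hQ
  have hζc : HasCompactSupport ζ := hηc.mul_right
  have hζs : tsupport ζ ⊆ Ω := (closure_mono (fun x hx => left_ne_zero_of_mul hx)).trans hηs
  have hQd : ∀ x : Space N, HasFDerivAt (fun x : Space N => P (k * x j)) (p (k * x j) • (k • ℓ))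
      x :=
    fun x => by
      have h1 : HasFDerivAt (fun x : Space N => k * x j) (k • ℓ) x := ℓ.hasFDerivAt.const_mul k
      exact (hP' (k * x j)).comp_hasFDerivAt x h1
  have hζ' : ∀ x, fderiv ℝ ζ x e = fderiv ℝ η x e * P (k * x j) + k * (η x * p (k * x j)) := by
    intro x
    have h1 := ((hη.differentiable (by simp)).differentiableAt (x := x)).hasFDerivAt.mul (hQd x)
    have h2 : fderiv ℝ ζ x = _ := h1.fderiv
    rw [h2]
    simp [hℓe]
    ring
  have key := hG.integral_eq ζ hζd hζc hζs j
  have hloc := hG.loc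
  have i1 : IntegrableOn (fun x => (fderiv ℝ η x e * P (k * x j)) * G x) Ω :=
    (integrable_smul_of_locallyIntegrableOn (η := fun x => fderiv ℝ η x e * P (k * x j)) hloc
      (hηd.mul hQ.continuous) hηdc.mul_right
      (((closure_mono (fun x hx => left_ne_zero_of_mul hx)).trans
        (tsupport_fderiv_apply_subset (η := η) e)).trans hηs)).integrableOn
  have hpc : Continuous fun x : Space N => p (k * x j) :=
    hp.continuous.comp (continuous_const.mul ℓ.continuous)
  have i2 : IntegrableOn (fun x => (η x * p (k * x j)) * G x) Ω :=
    (integrable_smul_of_locallyIntegrableOn (η := fun x => η x * p (k * x j)) hloc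
      (hη.continuous.mul hpc) hηc.mul_right
      ((closure_mono (fun x hx => left_ne_zero_of_mul hx)).trans hηs)).integrableOn
  have e1 : ∫ x in Ω, fderiv ℝ ζ x e • G x = (∫ x in Ω, (fderiv ℝ η x e * P (k * x j)) * G x)
      + k * ∫ x in Ω, η x * p (k * x j) * G x := by
    rw [← integral_const_mul, ← integral_add i1 (i2.const_mul k)]
    refine integral_congr_ae (Eventually.of_forall fun x => ?_)
    simp only [hζ', smul_eq_mul]
    ring
  rw [e1] at key
  have b1 : |∫ x in Ω, (fderiv ℝ η x e * P (k * x j)) * G x| ≤ B₁ * 2 * D := by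
    rw [hD, ← integral_const_mul]
    refine (abs_integral_le_integral_abs).trans (integral_mono_ae i1.abs
      (hηi.abs.integrableOn.const_mul _) ?_)
    filter_upwards [hG2] with x hx
    rw [abs_mul, abs_mul]
    calc |fderiv ℝ η x e| * |P (k * x j)| * |G x| ≤ |fderiv ℝ η x e| * B₁ * 2 := by
          gcongr; exact hB₁ _
      _ = B₁ * 2 * |fderiv ℝ η x e| := by ring
  have b2 : |∫ x in Ω, ζ x • gr j x| ≤ B₁ * M * ∫ x in Ω, |gr j x| := by
    rw [← integral_const_mul]
    refine (abs_integral_le_integral_abs).trans (integral_mono_ae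
      (integrable_smul_of_locallyIntegrableOn (hG.loc_partial j) hζd.continuous hζc
        hζs).integrableOn.abs (hgr.abs.const_mul _) (Eventually.of_forall fun x => ?_))
    simp only [hζ, smul_eq_mul, abs_mul]
    calc |η x| * |P (k * x j)| * |gr j x| ≤ M * B₁ * |gr j x| := by
          gcongr
          · exact hM x
          · exact hB₁ _
      _ = B₁ * M * |gr j x| := by ring
  have b3 : k * |∫ x in Ω, η x * p (k * x j) * G x| ≤ B₁ * 2 * D + B₁ * M * ∫ x in Ω, |gr j x| := by
    rw [← abs_of_pos hk, ← abs_mul, abs_of_pos hk]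
    have : k * ∫ x in Ω, η x * p (k * x j) * G x = -(∫ x in Ω, ζ x • gr j x)
        - ∫ x in Ω, (fderiv ℝ η x e * P (k * x j)) * G x := by linarith
    rw [this]
    refine (abs_sub _ _).trans ?_
    rw [abs_neg]
    linarith
  rw [div_mul_eq_mul_div, le_div_iff₀ hk, mul_comm]
  refine b3.trans ?_
  nlinarith [mul_nonneg hB0 hM0, mul_nonneg hB0 hD0, mul_nonneg (mul_nonneg hB0 hD0) hI0]

theorem integral_eq_zero_of_odd {p : ℝ → ℝ} (hper : Function.Periodic p (2 * Real.pi))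
    (hodd : ∀ s, p (-s) = - p s) : ∫ s in (0 : ℝ)..2 * Real.pi, p s = 0 := by
  have e1 := hper.intervalIntegral_add_eq 0 (-Real.pi)
  rw [zero_add, show -Real.pi + 2 * Real.pi = Real.pi by ring] at e1
  have e2 := intervalIntegral.integral_comp_neg (a := -Real.pi) (b := Real.pi) p
  simp_rw [hodd, neg_neg] at e2
  rw [intervalIntegral.integral_neg] at e2
  linarith

theorem exists_oscillation_bound_mean {p : ℝ → ℝ} (hp : ContDiff ℝ ∞ p)
    (hper : Function.Periodic p (2 * Real.pi)) {m : ℝ}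
    (hint : ∫ s in (0 : ℝ)..2 * Real.pi, p s = 2 * Real.pi * m)
    (j : Fin N) {η : Space N → ℝ} (hη : ContDiff ℝ ∞ η) (hηc : HasCompactSupport η)
    (hηs : tsupport η ⊆ Ω) :
    ∃ B : ℝ, 0 ≤ B ∧ ∀ k : ℝ, 0 < k → ∀ (G : Space N → ℝ) (gr : Fin N → Space N → ℝ),
      HasWeakPartials Ω G gr → (∀ᵐ x ∂(volume.restrict Ω), |G x| ≤ 2) → IntegrableOn (gr j) Ω →
      |(∫ x in Ω, η x * p (k * x j) * G x) - m * ∫ x in Ω, η x * G x|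
        ≤ B / k * (1 + ∫ x in Ω, |gr j x|) := by
  obtain ⟨B, hB, h⟩ := exists_oscillation_bound (p := fun s => p s - m) (hp.sub contDiff_const)
    (fun s => by simp only [hper s]) (by
      rw [intervalIntegral.integral_sub (hp.continuous.intervalIntegrable _ _) (by simp), hint]
      simp) j hη hηc hηs
  refine ⟨B, hB, fun k hk G gr hG hG2 hgr => ?_⟩
  have := h k hk G gr hG hG2 hgr
  have hpc : Continuous fun x : Space N => p (k * x j) :=
    hp.continuous.comp (continuous_const.mul (EuclideanSpace.proj j : Space N →L[ℝ] ℝ).continuous)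
  have i1 : IntegrableOn (fun x => (η x * p (k * x j)) * G x) Ω :=
    (integrable_smul_of_locallyIntegrableOn (η := fun x => η x * p (k * x j)) hG.loc
      (hη.continuous.mul hpc) hηc.mul_right
      ((closure_mono (fun x hx => left_ne_zero_of_mul hx)).trans hηs)).integrableOn
  have i2 : IntegrableOn (fun x => η x * G x) Ω :=
    (integrable_smul_of_locallyIntegrableOn hG.loc hη.continuous hηc hηs).integrableOn
  have e : ∫ x in Ω, η x * (p (k * x j) - m) * G x
      = (∫ x in Ω, η x * p (k * x j) * G x) - m * ∫ x in Ω, η x * G x := by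
    rw [← integral_const_mul, ← integral_sub i1 (i2.const_mul m)]
    refine integral_congr_ae (Eventually.of_forall fun x => ?_)
    simp only
    ring
  rwa [e] at this

end Oscillation

/-! ### Choice of the frequency -/

section Frequency

variable {N : ℕ} {Ω : Set (Space N)}

set_option maxHeartbeats 800000 in
-- Meant for g = e − s with e = e^{iψ}, ψ = δ sin(k xⱼ) and |s| = 1. Then Re(ē g) = |g|²/2, and Im(ē
-- g) ∂ⱼψ is bounded by |∂ⱼg|, so Im(ē g) is of order 1/k in a weighted L¹ sense. Testing it against
-- sin · cos² makes ∫ η Re g small, and then Re(ē g) makes ∫ η|g|² small. The frequency depends on g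
-- only through C, so one k serves all competitors.
theorem exists_frequency {δ : ℝ} (hδ0 : 0 < δ) (hδ1 : δ ≤ 1) (j : Fin N) {η : Space N → ℝ}
    (hη : ContDiff ℝ ∞ η) (hηc : HasCompactSupport η) (hηs : tsupport η ⊆ Ω)
    {C τ : ℝ} (hτ : 0 < τ) :
    ∃ k : ℝ, 0 < k ∧ ∀ (g : Space N → ℂ) (gr : Fin N → Space N → ℂ), HasWeakPartials Ω g gr →
      (∀ᵐ x ∂(volume.restrict Ω), ‖g x‖ ≤ 2) → IntegrableOn (gr j) Ω →
      (∫ x in Ω, ‖gr j x‖) ≤ C →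
      (∀ᵐ x ∂(volume.restrict Ω), Real.cos (δ * Real.sin (k * x j)) * (g x).re
        + Real.sin (δ * Real.sin (k * x j)) * (g x).im = ‖g x‖ ^ 2 / 2) →
      (∀ᵐ x ∂(volume.restrict Ω), |Real.cos (δ * Real.sin (k * x j)) * (g x).im
        - Real.sin (δ * Real.sin (k * x j)) * (g x).re| * |δ * k * Real.cos (k * x j)|
          ≤ ‖gr j x‖) →
      ∫ x in Ω, η x * ‖g x‖ ^ 2 ≤ τ := by
  have hpi := Real.pi_pos
  -- p₁ Im g − p₂ Re g = sin · cos² · Im(ē g), and p₃ Re g + p₄ Im g = Re(ē g). p₁ and p₄ are odd,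
  -- hence of mean zero; p₂ ≥ 0 has positive mean. A single factor cos would match the bound on Im(ē
  -- g), but the mean of p₂ would then vanish; hence the square.
  set p₁ : ℝ → ℝ := fun t => Real.sin t * Real.cos t ^ 2 * Real.cos (δ * Real.sin t) with hp₁
  set p₂ : ℝ → ℝ := fun t => Real.sin t * Real.cos t ^ 2 * Real.sin (δ * Real.sin t) with hp₂
  set p₃ : ℝ → ℝ := fun t => Real.cos (δ * Real.sin t) with hp₃
  set p₄ : ℝ → ℝ := fun t => Real.sin (δ * Real.sin t) with hp₄
  have c₁ : ContDiff ℝ ∞ p₁ := by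
    exact (Real.contDiff_sin.mul (Real.contDiff_cos.pow 2)).mul
      (Real.contDiff_cos.comp (contDiff_const.mul Real.contDiff_sin))
  have c₂ : ContDiff ℝ ∞ p₂ := (Real.contDiff_sin.mul (Real.contDiff_cos.pow 2)).mul
      (Real.contDiff_sin.comp (contDiff_const.mul Real.contDiff_sin))
  have c₃ : ContDiff ℝ ∞ p₃ := Real.contDiff_cos.comp (contDiff_const.mul Real.contDiff_sin)
  have c₄ : ContDiff ℝ ∞ p₄ := Real.contDiff_sin.comp (contDiff_const.mul Real.contDiff_sin)
  have per₁ : Function.Periodic p₁ (2 * Real.pi) := fun t => by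
    simp only [hp₁, Real.sin_periodic t, Real.cos_periodic t]
  have per₂ : Function.Periodic p₂ (2 * Real.pi) := fun t => by
    simp only [hp₂, Real.sin_periodic t, Real.cos_periodic t]
  have per₃ : Function.Periodic p₃ (2 * Real.pi) := fun t => by
    simp only [hp₃, Real.sin_periodic t]
  have per₄ : Function.Periodic p₄ (2 * Real.pi) := fun t => by
    simp only [hp₄, Real.sin_periodic t]
  have z₁ := integral_eq_zero_of_odd per₁ fun s => by simp [hp₁]
  have z₄ := integral_eq_zero_of_odd per₄ fun s => by simp [hp₄]
  have hp₂0 : ∀ t, 0 ≤ p₂ t := by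
    intro t
    have h1 : 0 ≤ Real.sin t * Real.sin (δ * Real.sin t) := by
      have hs := Real.sin_le_one t
      have hs' := Real.neg_one_le_sin t
      rcases le_total 0 (Real.sin t) with h | h
      · exact mul_nonneg h (Real.sin_nonneg_of_nonneg_of_le_pi (by positivity)
          (by nlinarith [Real.pi_gt_three]))
      · refine mul_nonneg_of_nonpos_of_nonpos h (Real.sin_nonpos_of_nonpos_of_neg_pi_le
          (by nlinarith) (by nlinarith [Real.pi_gt_three]))
    simp only [hp₂]
    nlinarith [mul_nonneg h1 (sq_nonneg (Real.cos t))]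
  have hm₂ : 0 < ∫ s in (0 : ℝ)..2 * Real.pi, p₂ s := by
    refine intervalIntegral.integral_pos (by linarith) c₂.continuous.continuousOn
      (fun x _ => hp₂0 x) ⟨Real.pi / 4, ⟨by positivity, by linarith⟩, ?_⟩
    simp only [hp₂]
    have h1 : 0 < Real.sin (Real.pi / 4) := by rw [Real.sin_pi_div_four]; positivity
    have h2 : 0 < Real.cos (Real.pi / 4) := by rw [Real.cos_pi_div_four]; positivity
    have h3 : 0 < Real.sin (δ * Real.sin (Real.pi / 4)) :=
      Real.sin_pos_of_pos_of_lt_pi (by positivity)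
        (by nlinarith [Real.pi_gt_three, Real.sin_le_one (Real.pi / 4)])
    positivity
  set m₂ := (∫ s in (0 : ℝ)..2 * Real.pi, p₂ s) / (2 * Real.pi) with hm₂d
  have hm₂0 : 0 < m₂ := by positivity
  set m₃ := (∫ s in (0 : ℝ)..2 * Real.pi, p₃ s) / (2 * Real.pi) with hm₃d
  obtain ⟨B₁, hB₁, H₁⟩ := exists_oscillation_bound c₁ per₁ z₁ j hη hηc hηs
  obtain ⟨B₂, hB₂, H₂⟩ := exists_oscillation_bound_mean c₂ per₂ (m := m₂)
    (by rw [hm₂d]; field_simp) j hη hηc hηs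
  obtain ⟨B₃, hB₃, H₃⟩ := exists_oscillation_bound_mean c₃ per₃ (m := m₃)
    (by rw [hm₃d]; field_simp) j hη hηc hηs
  obtain ⟨B₄, hB₄, H₄⟩ := exists_oscillation_bound c₄ per₄ z₄ j hη hηc hηs
  obtain ⟨M, hM⟩ := hηc.exists_bound_of_continuous hη.continuous
  have hM0 : 0 ≤ M := (norm_nonneg _).trans (hM 0)
  set C' := max C 0 with hC'
  have hC'0 : 0 ≤ C' := le_max_right _ _
  -- All error terms together amount to K/k; k = (K + 1)/τ is positive and makes this at most τ.
  set K := 2 * (|m₃| / m₂ * ((B₁ + B₂) * (1 + C') + M * C' / δ) + (B₃ + B₄) * (1 + C')) with hK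
  have hK0 : 0 ≤ K := by positivity
  refine ⟨(K + 1) / τ, by positivity, fun g gr hg hg2 hgi hgC hre him => ?_⟩
  set k := (K + 1) / τ with hk
  have hk0 : 0 < k := by positivity
  have hR := hg.clm_comp Complex.reCLM
  have hI := hg.clm_comp Complex.imCLM
  have hRb : ∀ᵐ x ∂(volume.restrict Ω), |Complex.reCLM (g x)| ≤ 2 := by
    filter_upwards [hg2] with x hx using (Complex.abs_re_le_norm _).trans hx
  have hIb : ∀ᵐ x ∂(volume.restrict Ω), |Complex.imCLM (g x)| ≤ 2 := by
    filter_upwards [hg2] with x hx using (Complex.abs_im_le_norm _).trans hx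
  have hRi : IntegrableOn (fun x => Complex.reCLM (gr j x)) Ω := Complex.reCLM.integrable_comp hgi
  have hIi : IntegrableOn (fun x => Complex.imCLM (gr j x)) Ω := Complex.imCLM.integrable_comp hgi
  have hRC : ∫ x in Ω, |Complex.reCLM (gr j x)| ≤ C' :=
    (integral_mono hRi.abs hgi.norm fun x => Complex.abs_re_le_norm _).trans
      (hgC.trans (le_max_left _ _))
  have hIC : ∫ x in Ω, |Complex.imCLM (gr j x)| ≤ C' :=
    (integral_mono hIi.abs hgi.norm fun x => Complex.abs_im_le_norm _).trans
      (hgC.trans (le_max_left _ _))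
  have hle : ∀ {B I : ℝ}, 0 ≤ B → I ≤ C' → B / k * (1 + I) ≤ B * (1 + C') / k := by
    intro B I hB h
    rw [div_mul_eq_mul_div]
    gcongr
  have b₁ := (H₁ k hk0 _ _ hI hIb hIi).trans (hle hB₁ hIC)
  have b₂ := (H₂ k hk0 _ _ hR hRb hRi).trans (hle hB₂ hRC)
  have b₃ := (H₃ k hk0 _ _ hR hRb hRi).trans (hle hB₃ hRC)
  have b₄ := (H₄ k hk0 _ _ hI hIb hIi).trans (hle hB₄ hIC)
  simp only [Complex.reCLM_apply, Complex.imCLM_apply] at b₁ b₂ b₃ b₄ hR hI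
  have ii : ∀ {p : ℝ → ℝ} {G : Space N → ℝ}, Continuous p → LocallyIntegrableOn G Ω →
      IntegrableOn (fun x => η x * p (k * x j) * G x) Ω := by
    intro p G hp hG
    have hpc : Continuous fun x : Space N => p (k * x j) :=
      hp.comp (continuous_const.mul (EuclideanSpace.proj j : Space N →L[ℝ] ℝ).continuous)
    exact (integrable_smul_of_locallyIntegrableOn (η := fun x => η x * p (k * x j)) hG
      (hη.continuous.mul hpc) hηc.mul_right
      ((closure_mono (fun x hx => left_ne_zero_of_mul hx)).trans hηs)).integrableOn
  have i₁ := ii c₁.continuous hI.loc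
  have i₂ := ii c₂.continuous hR.loc
  have i₃ := ii c₃.continuous hR.loc
  have i₄ := ii c₄.continuous hI.loc
  set X := ∫ x in Ω, η x * (g x).re with hX
  -- One factor |cos(k xⱼ)| is spent on the bound δk |cos(k xⱼ)| |Im(ē g)| ≤ |∂ⱼg|; the remaining
  -- factors are at most one.
  have s1 : |∫ x in Ω, (η x * p₁ (k * x j) * (g x).im - η x * p₂ (k * x j) * (g x).re)|
      ≤ M * C' / δ / k := by
    have : ∫ x in Ω, M / (δ * k) * ‖gr j x‖ ≤ M * C' / δ / k := by
      rw [integral_const_mul]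
      calc M / (δ * k) * ∫ x in Ω, ‖gr j x‖ ≤ M / (δ * k) * C' := by
            gcongr; exact hgC.trans (le_max_left _ _)
        _ = M * C' / δ / k := by field_simp
    refine (abs_integral_le_integral_abs).trans ((integral_mono_ae (i₁.sub i₂).abs
      (hgi.norm.const_mul _) ?_).trans this)
    filter_upwards [him] with x hx
    simp only [Pi.sub_apply]
    rw [show η x * p₁ (k * x j) * (g x).im - η x * p₂ (k * x j) * (g x).re
      = η x * (Real.sin (k * x j) * Real.cos (k * x j) ^ 2 *
        (Real.cos (δ * Real.sin (k * x j)) * (g x).im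
        - Real.sin (δ * Real.sin (k * x j)) * (g x).re)) by simp only [hp₁, hp₂]; ring]
    rw [abs_mul, abs_mul, abs_mul, abs_pow]
    rw [abs_mul, abs_of_pos (show 0 < δ * k by positivity)] at hx
    set A := |Real.cos (δ * Real.sin (k * x j)) * (g x).im
        - Real.sin (δ * Real.sin (k * x j)) * (g x).re|
    set c := |Real.cos (k * x j)|
    have hA : 0 ≤ A := abs_nonneg _
    have hc0 : 0 ≤ c := abs_nonneg _
    have hc1 : c ≤ 1 := Real.abs_cos_le_one _
    have hs1 : |Real.sin (k * x j)| ≤ 1 := Real.abs_sin_le_one _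
    have h2 : |Real.sin (k * x j)| * c ^ 2 * A ≤ c * A := by
      have : |Real.sin (k * x j)| * c ^ 2 ≤ 1 * (c * 1) := by
        rw [sq]; gcongr
      calc _ ≤ 1 * (c * 1) * A := by gcongr
        _ = c * A := by ring
    have h3 : c * A ≤ ‖gr j x‖ / (δ * k) := by
      rw [le_div_iff₀ (by positivity)]; linarith
    calc |η x| * (|Real.sin (k * x j)| * c ^ 2 * A) ≤ M * (‖gr j x‖ / (δ * k)) :=
          mul_le_mul (hM x) (h2.trans h3) (by positivity) hM0
      _ = M / (δ * k) * ‖gr j x‖ := by ring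
  rw [integral_sub i₁ i₂] at s1
  -- The p₁ integral is small by oscillation and the p₂ integral is m₂X up to an oscillation error,
  -- so positivity of m₂ controls X.
  have s2 : m₂ * |X| ≤ ((B₁ + B₂) * (1 + C') + M * C' / δ) / k := by
    have e : m₂ * |X| = |m₂ * X| := by rw [abs_mul, abs_of_pos hm₂0]
    rw [e, add_div, add_mul, add_div, abs_le]
    have h₁ := abs_le.1 b₁
    have h₂ := abs_le.1 b₂
    have h₃ := abs_le.1 s1
    constructor
    · linarith only [h₁.1, h₂.2, h₃.2]
    · linarith only [h₁.2, h₂.1, h₃.1]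
  have s3 : ∫ x in Ω, η x * ‖g x‖ ^ 2 = 2 * ((∫ x in Ω, η x * p₃ (k * x j) * (g x).re)
      + ∫ x in Ω, η x * p₄ (k * x j) * (g x).im) := by
    rw [← integral_add i₃ i₄, ← integral_const_mul]
    refine integral_congr_ae ?_
    filter_upwards [hre] with x hx
    simp only [hp₃, hp₄]
    linear_combination (-2 * η x) * hx
  have s4 : |m₃ * X| ≤ |m₃| / m₂ * (((B₁ + B₂) * (1 + C') + M * C' / δ) / k) := by
    rw [abs_mul, div_mul_eq_mul_div, le_div_iff₀ hm₂0]
    calc |m₃| * |X| * m₂ = |m₃| * (m₂ * |X|) := by ring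
      _ ≤ _ := mul_le_mul_of_nonneg_left s2 (abs_nonneg m₃)
  have s5 : ∫ x in Ω, η x * ‖g x‖ ^ 2 ≤ K / k := by
    rw [s3, hK]
    have e : 2 * (|m₃| / m₂ * ((B₁ + B₂) * (1 + C') + M * C' / δ) + (B₃ + B₄) * (1 + C')) / k
      = 2 * (|m₃| / m₂ * (((B₁ + B₂) * (1 + C') + M * C' / δ) / k) + B₃ * (1 + C') / k
        + B₄ * (1 + C') / k) := by ring
    rw [e]
    linarith only [(abs_le.1 b₃).2, (abs_le.1 b₄).2, (abs_le.1 s4).2]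
  refine s5.trans ?_
  rw [hk, div_div_eq_mul_div, div_le_iff₀ (by positivity)]
  linarith only [hτ, mul_comm τ K]

end Frequency

/-! ### Smooth nonnegative weights -/

section Approximation

variable {N : ℕ} {Ω : Set (Space N)}

theorem exists_isCompact_lintegral_diff_lt (hΩ : IsOpen Ω) {f : Space N → ℝ≥0∞}
    (hf : ∫⁻ x in Ω, f x ≠ ⊤) {ε : ℝ≥0∞} (hε : ε ≠ 0) :
    ∃ K ⊆ Ω, IsCompact K ∧ ∫⁻ x in Ω \ K, f x < ε := by
  have : IsFiniteMeasure ((volume.restrict Ω).withDensity f) := isFiniteMeasure_withDensity hf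
  obtain ⟨K, hKΩ, hK, h⟩ := hΩ.measurableSet.exists_isCompact_sdiff_lt
    (μ := (volume.restrict Ω).withDensity f) (measure_ne_top _ _) hε
  refine ⟨K, hKΩ, hK, ?_⟩
  have hm := hΩ.measurableSet.diff hK.measurableSet
  rwa [withDensity_apply _ hm, Measure.restrict_restrict hm,
    inter_eq_left.2 sdiff_subset] at h

/-- Used for T = |a|: the oscillation estimates need a smooth compactly supported weight, and
nonnegativity is needed to read smallness of ∫ η|g|² as smallness of g. -/
theorem exists_smooth_nonneg_approx (hΩ : IsOpen Ω) {T : Space N → ℝ} (hT : IntegrableOn T Ω)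
    (hT0 : ∀ x, 0 ≤ T x) {ε : ℝ≥0∞} (hε : ε ≠ 0) :
    ∃ η : Space N → ℝ, ContDiff ℝ ∞ η ∧ HasCompactSupport η ∧ tsupport η ⊆ Ω ∧ (∀ x, 0 ≤ η x) ∧
      ∫⁻ x in Ω, ‖T x - η x‖ₑ ≤ ε := by
  have hε2 : ε / 2 ≠ 0 := (ENNReal.half_pos hε).ne'
  obtain ⟨K, hKΩ, hK, hKε⟩ := exists_isCompact_lintegral_diff_lt hΩ hT.2.ne hε2
  obtain ⟨r, hr, hrΩ⟩ := hK.exists_cthickening_subset_open hΩ hKΩ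
  set U := K.indicator T with hU
  have hUi : Integrable U := (integrable_indicator_iff hK.measurableSet).2 (hT.mono_set hKΩ)
  let φ : ℕ → ContDiffBump (0 : Space N) := fun n =>
    ⟨r / (2 * (n + 1)), r / (n + 1), by positivity, by
      apply div_lt_div_of_pos_left hr (by positivity); linarith [n.cast_nonneg (α := ℝ)]⟩
  have hφ : Tendsto (fun n => (φ n).rOut) atTop (𝓝 0) := by
    show Tendsto (fun n : ℕ => r / ((n : ℝ) + 1)) atTop (𝓝 0)
    have := (tendsto_one_div_add_atTop_nhds_zero_nat (𝕜 := ℝ)).const_mul r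
    simpa [div_eq_mul_inv] using this
  obtain ⟨n, hn⟩ := ((tendsto_lintegral_mollify hφ hUi).eventually
    (gt_mem_nhds (pos_iff_ne_zero.2 hε2))).exists
  set η := (φ n).normed volume ⋆[ContinuousLinearMap.lsmul ℝ ℝ, volume] U with hη
  have hφr : (φ n).rOut ≤ r := by
    show r / ((n : ℝ) + 1) ≤ r
    exact div_le_self hr.le (by linarith [n.cast_nonneg (α := ℝ)])
  have hsup : tsupport η ⊆ Metric.cthickening r K := by
    refine closure_minimal ?_ Metric.isClosed_cthickening
    refine (support_convolution_subset _).trans ?_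
    rintro _ ⟨y, hy, z, hz, rfl⟩
    rw [(φ n).support_normed_eq] at hy
    have hzK : z ∈ K := by
      by_contra h
      exact hz (indicator_of_notMem h T)
    refine Metric.mem_cthickening_of_dist_le _ z _ _ hzK ?_
    have := Metric.mem_ball.1 hy
    simp only [dist_eq_norm, sub_zero, add_sub_cancel_right] at this ⊢
    linarith
  refine ⟨η, (φ n).hasCompactSupport_normed.contDiff_convolution_left _ (φ n).contDiff_normed
      hUi.locallyIntegrable, hK.cthickening.of_isClosed_subset (isClosed_tsupport _) hsup,
      hsup.trans hrΩ, fun x => ?_, ?_⟩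
  · refine integral_nonneg fun t => ?_
    simp only [ContinuousLinearMap.lsmul_apply, smul_eq_mul]
    exact mul_nonneg ((φ n).nonneg_normed t) (indicator_nonneg (fun x _ => hT0 x) _)
  · have hm : AEStronglyMeasurable U (volume.restrict Ω) := hUi.1.restrict
    calc ∫⁻ x in Ω, ‖T x - η x‖ₑ ≤ ∫⁻ x in Ω, (‖T x - U x‖ₑ + ‖η x - U x‖ₑ) := by
          refine lintegral_mono fun x => ?_
          rw [show T x - η x = (T x - U x) - (η x - U x) by ring]
          exact enorm_sub_le
      _ = (∫⁻ x in Ω, ‖T x - U x‖ₑ) + ∫⁻ x in Ω, ‖η x - U x‖ₑ :=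
          lintegral_add_left' (hT.1.sub hm).enorm _
      _ ≤ ε / 2 + ε / 2 := by
          refine add_le_add ?_ ((setLIntegral_le_lintegral _ _).trans hn.le)
          refine le_trans (le_of_eq ?_) hKε.le
          rw [← lintegral_indicator hΩ.measurableSet,
            ← lintegral_indicator (hΩ.measurableSet.diff hK.measurableSet)]
          refine lintegral_congr fun x => ?_
          by_cases h1 : x ∈ Ω <;> by_cases h2 : x ∈ K <;> simp [hU, h1, h2, indicator]
      _ = ε := ENNReal.add_halves ε

end Approximation

/-! ### Energy of e − s for e near 1 -/

section Retraction

variable {N : ℕ} {Ω : Set (Space N)} {u s e : Space N → ℂ}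
  {a b σ : Space N → EuclideanSpace ℝ (Fin N)}

theorem integrableOn_toLp {𝕜 : Type*} [RCLike 𝕜] {g : Fin N → Space N → 𝕜}
    (hg : ∀ j, IntegrableOn (g j) Ω) :
    IntegrableOn (fun x => (WithLp.toLp 2 fun j => g j x : EuclideanSpace 𝕜 (Fin N))) Ω := by
  have h1 : IntegrableOn (fun x => fun j => g j x) Ω := Integrable.of_eval fun j => hg j
  exact (PiLp.continuousLinearEquiv 2 ℝ
    fun _ : Fin N => 𝕜).symm.toContinuousLinearMap.integrable_comp h1

theorem IsCircleMap.integrableOn_partial (h : IsCircleMap Ω u a) (j : Fin N) :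
    IntegrableOn (fun x => Complex.I * u x * (a x j : ℂ)) Ω := by
  refine Integrable.mono h.integrable (h.partials.loc_partial j).aestronglyMeasurable ?_
  filter_upwards [h.norm_eq] with x hx
  rw [norm_mul, norm_mul, Complex.norm_I, hx, one_mul, one_mul, Complex.norm_real]
  exact PiLp.norm_apply_le _ _

theorem fderiv_arg_apply {z : ℂ} (hz : z ∈ Complex.slitPlane) (h : ℂ) :
    fderiv ℝ Complex.arg z h = (h / z).im := by
  have h1 : HasFDerivAt Complex.log _ z :=
    ((Complex.hasStrictDerivAt_log hz).hasDerivAt.hasFDerivAt).restrictScalars ℝ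
  have h2 : HasFDerivAt (fun w => Complex.imCLM (Complex.log w)) _ z :=
    Complex.imCLM.hasFDerivAt.comp z h1
  have h3 : (fun w => Complex.imCLM (Complex.log w)) = Complex.arg := by
    funext w; simp [Complex.log_im]
  rw [h3] at h2
  rw [h2.fderiv]
  simp [div_eq_mul_inv]

/-- If `e` is uniformly close to `1`, the energy of `e - s` controls `Σ(e s̄)`. -/
theorem Sig_mul_conj_le_of_near_one (hΩ : IsOpen Ω) (hfin : volume Ω ≠ ⊤) (he : IsCircleMap Ω e b)
    (hs : IsCircleMap Ω s σ) {δ : ℝ} (hδ0 : 0 ≤ δ) (hδ : δ ≤ 1 / 4)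
    (hclose : ∀ᵐ x ∂(volume.restrict Ω), ‖e x - 1‖ ≤ δ) :
    ENNReal.ofReal (1 - 2 * δ) * Sig Ω (fun x => e x * conj (s x))
      ≤ ∫⁻ x in Ω, ‖(WithLp.toLp 2 fun j =>
        Complex.I * e x * b x j - Complex.I * s x * σ x j : EuclideanSpace ℂ (Fin N))‖ₑ := by
  have hw := he.mul hΩ hs.conj
  have hew := he.mul hΩ hw
  set w : Space N → ℂ := fun x => e x * conj (s x) with hwdef
  -- As w s = e, q = w(1 − g) with g = e − s, so ∇q = i(b − σ)q − w∇g. Also q − 1 = (e − 1)(1 − w)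
  -- is small, so arg q is a genuine W^{1,1} phase.
  set q : Space N → ℂ := fun x => e x + w x - e x * w x with hq
  have hqp := (he.partials.add hw.partials).sub hew.partials
  have hq1 : ∀ᵐ x ∂(volume.restrict Ω), ‖q x - 1‖ ≤ 2 * δ := by
    filter_upwards [hclose, hw.norm_eq] with x h1 h2
    rw [show q x - 1 = (e x - 1) * (1 - w x) by simp only [hq]; ring, norm_mul]
    have h3 : ‖1 - w x‖ ≤ 2 := by
      refine (norm_sub_le _ _).trans ?_
      rw [h2, norm_one]; norm_num
    nlinarith [norm_nonneg (e x - 1), norm_nonneg (1 - w x)]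
  have hKsub : Metric.closedBall (1 : ℂ) (1 / 2) ⊆ Complex.slitPlane := by
    intro z hz
    left
    have h1 := (Complex.abs_re_le_norm (z - 1)).trans (mem_closedBall_iff_norm.1 hz)
    rw [Complex.sub_re, Complex.one_re] at h1
    linarith [(abs_le.1 h1).1]
  have hqK : ∀ᵐ x ∂(volume.restrict Ω), q x ∈ Metric.closedBall (1 : ℂ) (1 / 2) := by
    filter_upwards [hq1] with x h1
    rw [mem_closedBall_iff_norm]
    linarith
  have hargd : ContDiffOn ℝ 1 Complex.arg Complex.slitPlane := by
    intro z hz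
    have h1 : ContDiffAt ℝ 1 Complex.log z := (Complex.contDiffAt_log hz).restrict_scalars ℝ
    have h2 : ContDiffAt ℝ 1 (fun w => Complex.imCLM (Complex.log w)) z :=
      Complex.imCLM.contDiff.contDiffAt.comp z h1
    have h3 : (fun w => Complex.imCLM (Complex.log w)) = Complex.arg := by
      funext w; simp [Complex.log_im]
    rw [h3] at h2
    exact h2.contDiffWithinAt
  have hκ := hqp.comp_contDiffOn hΩ Complex.isOpen_slitPlane hargd (isCompact_closedBall 1 (1 / 2))
    hKsub hqK
  set gq : Fin N → Space N → ℂ := fun j x => Complex.I * e x * (b x j : ℂ)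
    + Complex.I * w x * ((b x + -σ x) j : ℂ)
    - Complex.I * (e x * w x) * ((b x + (b x + -σ x)) j : ℂ) with hgq
  have hgqi : ∀ j, IntegrableOn (gq j) Ω := fun j =>
    ((he.integrableOn_partial j).add (hw.integrableOn_partial j)).sub (hew.integrableOn_partial j)
  have hqn : ∀ᵐ x ∂(volume.restrict Ω), 1 - 2 * δ ≤ ‖q x‖ := by
    filter_upwards [hq1] with x h1
    have := norm_sub_norm_le (1 : ℂ) (1 - q x)
    rw [norm_one, norm_sub_rev, sub_sub_cancel] at this
    linarith
  have hκ' := hκ.neg.congr hΩ (v := fun x => -Complex.arg (q x))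
    (g' := fun j x => -(gq j x / q x).im) EventuallyEq.rfl fun j => by
      filter_upwards [hqK] with x hx
      rw [fderiv_arg_apply (hKsub hx)]
  have hci : IntegrableOn (fun x => (WithLp.toLp 2 fun j => -(gq j x / q x).im :
      EuclideanSpace ℝ (Fin N))) Ω := by
    refine integrableOn_toLp fun j => Integrable.mono ((hgqi j).norm.const_mul 2) ?_ ?_
    · exact (hκ'.loc_partial j).aestronglyMeasurable
    · filter_upwards [hqn] with x hx
      rw [norm_neg, Real.norm_eq_abs, norm_mul, norm_norm, Real.norm_eq_abs, abs_two]
      refine (Complex.abs_im_le_norm _).trans ?_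
      rw [norm_div, div_le_iff₀ (by linarith)]
      nlinarith [norm_nonneg (gq j x)]
  have : IsFiniteMeasure ((volume : Measure (Space N)).restrict Ω) := ⟨by simpa using hfin.lt_top⟩
  have hκi : IntegrableOn (fun x => -Complex.arg (q x)) Ω :=
    Integrable.of_bound hκ'.loc.aestronglyMeasurable Real.pi (Eventually.of_forall fun x => by
      rw [norm_neg]; exact Complex.abs_arg_le_pi _)
  -- The map w e^{−i arg q} is the conjugate of (1 − g)/|1 − g|, the radial projection of s + (1 −
  -- e). Its phase gradient is Im(w∇g/q), of size at most |∇g|/(1 − 2δ).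
  have hfinal := hw.mul_exp hΩ (b := fun x => WithLp.toLp 2 fun j => -(gq j x / q x).im) hκ' hci
  have hle := Sig_le_of_equivalent hΩ hfinal
    (equivalent_mul_exp (memW11_iff.2 ⟨hκi, (fun x => WithLp.toLp 2 fun j => -(gq j x / q x).im),
      hκ', hci⟩) w)
  refine (mul_le_mul_right hle _).trans ?_
  rw [← lintegral_const_mul' _ _ ENNReal.ofReal_ne_top]
  refine lintegral_mono_ae ?_
  filter_upwards [hqn, hw.norm_eq, hs.norm_eq] with x h1 h2 h3
  have hq0 : 0 < ‖q x‖ := by linarith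
  have hqne : q x ≠ 0 := norm_pos_iff.1 hq0
  have h4 : ‖((b x + -σ x) + (WithLp.toLp 2 fun j => -(gq j x / q x).im :
      EuclideanSpace ℝ (Fin N)))‖ₑ ≤ ENNReal.ofReal (1 / ‖q x‖) * ‖(WithLp.toLp 2 fun j =>
        Complex.I * e x * b x j - Complex.I * s x * σ x j : EuclideanSpace ℂ (Fin N))‖ₑ := by
    refine euclidean_enorm_le_of_forall (by positivity) fun j => ?_
    set G := Complex.I * e x * b x j - Complex.I * s x * σ x j with hG
    have h5 : w x * s x = e x := by
      simp only [hwdef]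
      rw [mul_assoc, mul_comm (conj (s x)), Complex.mul_conj, Complex.normSq_eq_norm_sq, h3]
      simp
    have h6 : gq j x = Complex.I * ((b x j - σ x j : ℝ) : ℂ) * q x - w x * G := by
      simp only [hgq, hq, hG]
      simp
      linear_combination (-Complex.I * (σ x j : ℂ)) * h5
    have h7 : (b x j - σ x j) + -(gq j x / q x).im = (w x * G / q x).im := by
      rw [h6, sub_div, mul_div_assoc, div_self hqne, Complex.sub_im]
      simp
    have h8 : ((b x + -σ x) + (WithLp.toLp 2 fun j => -(gq j x / q x).im :
      EuclideanSpace ℝ (Fin N))) j = (w x * G / q x).im := by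
      rw [← h7]; simp [sub_eq_add_neg]
    rw [h8]
    refine (Complex.abs_im_le_norm _).trans (le_of_eq ?_)
    rw [norm_div, norm_mul, h2]
    ring
  refine (mul_le_mul_right h4 _).trans ?_
  rw [← mul_assoc, ← ENNReal.ofReal_mul (by linarith)]
  refine mul_le_of_le_one_left bot_le ?_
  rw [ENNReal.ofReal_le_one, mul_one_div]
  exact div_le_one_of_le₀ h1 (norm_nonneg _)

end Retraction

/-! ### Lower bound for Dist by rapidly oscillating phases -/

section Dist

variable {N : ℕ} {Ω : Set (Space N)} {u v u₀ v₀ e s : Space N → ℂ}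
  {a b σ : Space N → EuclideanSpace ℝ (Fin N)}

theorem hasWeakPartials_sine_phase (Ω : Set (Space N)) (δ k : ℝ) (j : Fin N) :
    HasWeakPartials Ω (fun x : Space N => δ * Real.sin (k * x j)) fun i x =>
      (EuclideanSpace.single j (δ * k * Real.cos (k * x j)) : EuclideanSpace ℝ (Fin N)) i := by
  let ℓ : Space N →L[ℝ] ℝ := EuclideanSpace.proj j
  have hd : ContDiff ℝ 1 fun x : Space N => δ * Real.sin (k * x j) :=
    contDiff_const.mul (Real.contDiff_sin.comp (contDiff_const.mul ℓ.contDiff))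
  have h := HasWeakPartials.of_contDiff Ω hd
  have e : (fun (i : Fin N) (x : Space N) =>
      (EuclideanSpace.single j (δ * k * Real.cos (k * x j)) : EuclideanSpace ℝ (Fin N)) i)
      = fun i x => fderiv ℝ (fun x : Space N => δ * Real.sin (k * x j)) x
        (EuclideanSpace.single i 1) := by
    funext i x
    have h1 : HasFDerivAt (fun x : Space N => k * x j) (k • ℓ) x := ℓ.hasFDerivAt.const_mul k
    have h2 := ((Real.hasDerivAt_sin (k * x j)).comp_hasFDerivAt x h1).const_mul δ
    have h3 : fderiv ℝ (fun x : Space N => δ * Real.sin (k * x j)) x = _ := h2.fderiv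
    rw [h3]
    by_cases hij : i = j
    · subst hij; simp [ℓ]; ring
    · simp [ℓ, hij, Ne.symm hij]
  rw [e]
  exact h

theorem memW11_sine_phase (hfin : volume Ω ≠ ⊤) (δ k : ℝ) (j : Fin N) :
    IntegrableOn (fun x : Space N => δ * Real.sin (k * x j)) Ω ∧
    IntegrableOn (fun x => (EuclideanSpace.single j (δ * k * Real.cos (k * x j)) :
      EuclideanSpace ℝ (Fin N))) Ω := by
  have : IsFiniteMeasure ((volume : Measure (Space N)).restrict Ω) := ⟨by simpa using hfin.lt_top⟩
  have hc : Continuous fun x : Space N => x j :=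
      (EuclideanSpace.proj j : Space N →L[ℝ] ℝ).continuous
  constructor
  · refine Integrable.of_bound (by fun_prop) |δ| (Eventually.of_forall fun x => ?_)
    rw [Real.norm_eq_abs, abs_mul]
    exact mul_le_of_le_one_right (abs_nonneg _) (Real.abs_sin_le_one _)
  · have hcs : Continuous fun z : ℝ => (EuclideanSpace.single j z : EuclideanSpace ℝ (Fin N)) :=
      (PiLp.continuous_toLp 2 _).comp (continuous_single (A := fun _ : Fin N => ℝ) j)
    refine Integrable.of_bound (hcs.comp (by fun_prop)).aestronglyMeasurable |δ * k|
      (Eventually.of_forall fun x => ?_)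
    simp only [PiLp.norm_single, Real.norm_eq_abs]
    rw [abs_mul]
    exact mul_le_of_le_one_right (abs_nonneg _) (Real.abs_cos_le_one _)

/-- Multiplying zα − wβ by w̄ makes the β term real, so the imaginary part no longer sees the
unknown derivative β. -/
theorem abs_im_mul_le {z w : ℂ} (hw : ‖w‖ = 1) (α β : ℝ) :
    |(z * conj w).im| * |α| ≤ ‖Complex.I * z * α - Complex.I * w * β‖ := by
  have h1 : (z * conj w).im * α = ((z * α - w * β) * conj w).im := by
    have h2 : (z * α - w * β) * conj w = (z * conj w) * α - (w * conj w) * β := by ring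
    rw [h2, Complex.mul_conj, Complex.normSq_eq_norm_sq, hw]
    simp
  rw [← abs_mul, h1]
  refine (Complex.abs_im_le_norm _).trans (le_of_eq ?_)
  rw [norm_mul, RCLike.norm_conj, hw, mul_one, mul_assoc, mul_assoc, ← mul_sub, norm_mul,
    Complex.norm_I, one_mul]

/-- Product rule for e − ū₀v = ū₀(u₀e − v): the rotation by ū₀ is an isometry, and its own
derivative contributes |e − ū₀v| |a|. -/
theorem lintegral_gradient_rotate_le (hΩ : IsOpen Ω) (hu₀ : IsCircleMap Ω u₀ a)
    (he : IsCircleMap Ω e b) (hv : IsCircleMap Ω v σ) :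
    ∫⁻ x in Ω, ‖(WithLp.toLp 2 fun j => Complex.I * e x * b x j
        - Complex.I * (conj (u₀ x) * v x) * (-a x + σ x) j : EuclideanSpace ℂ (Fin N))‖ₑ
      ≤ gradEnergy Ω (fun x => u₀ x * e x - v x)
        + ∫⁻ x in Ω, ‖e x - conj (u₀ x) * v x‖ₑ * ‖a x‖ₑ := by
  rw [(hu₀.mul hΩ he).gradEnergy_sub hΩ hv, ← lintegral_add_right']
  · refine lintegral_mono_ae ?_
    filter_upwards [hu₀.norm_eq] with x hx
    have h1 : conj (u₀ x) * u₀ x = 1 := by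
      rw [mul_comm, Complex.mul_conj, Complex.normSq_eq_norm_sq, hx]; simp
    set V : EuclideanSpace ℂ (Fin N) := WithLp.toLp 2 fun j =>
      Complex.I * (u₀ x * e x) * ((a x + b x) j : ℝ) - Complex.I * v x * σ x j
    have h2 : (WithLp.toLp 2 fun j => Complex.I * e x * b x j
        - Complex.I * (conj (u₀ x) * v x) * (-a x + σ x) j : EuclideanSpace ℂ (Fin N))
        = conj (u₀ x) • V - WithLp.toLp 2 fun j =>
          (Complex.I * (e x - conj (u₀ x) * v x)) * (a x j : ℂ) := by
      ext j
      simp [V]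
      linear_combination (-Complex.I * e x * ((a x j : ℂ) + b x j)) * h1
    rw [h2]
    refine enorm_sub_le.trans (add_le_add (le_of_eq ?_) (le_of_eq ?_))
    · rw [← ofReal_norm, ← ofReal_norm, norm_smul, RCLike.norm_conj, hx, one_mul]
    · rw [← ofReal_norm, norm_toLp_mul_ofReal, norm_mul, Complex.norm_I, one_mul,
        ENNReal.ofReal_mul (norm_nonneg _), ofReal_norm, ofReal_norm]
  · exact (he.partials.loc.aestronglyMeasurable.sub
      ((Complex.continuous_conj.comp_aestronglyMeasurable
        hu₀.partials.loc.aestronglyMeasurable).mul hv.partials.loc.aestronglyMeasurable)).enorm.mul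
      hu₀.integrable.1.enorm

/-- Replace |a| by η at the cost 2 ||a| − η|, and use |g| ≤ l + |g|²/l to pass from weighted L² to
weighted L¹. -/
theorem lintegral_mul_le_of_approx {g : Space N → ℂ} {a : Space N → EuclideanSpace ℝ (Fin N)}
    {η : Space N → ℝ} (hη : IntegrableOn η Ω) (hη0 : ∀ x, 0 ≤ η x)
    (hg : AEStronglyMeasurable g (volume.restrict Ω)) (ha : IntegrableOn a Ω)
    (hg2 : ∀ᵐ x ∂(volume.restrict Ω), ‖g x‖ ≤ 2) {δ : ℝ} (hδ : 0 < δ)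
    (h1 : ∫⁻ x in Ω, ‖‖a x‖ - η x‖ₑ ≤ ENNReal.ofReal (δ / 4))
    (h2 : ∫ x in Ω, η x * ‖g x‖ ^ 2 ≤ (δ / (4 * ((∫ x in Ω, η x) + 1))) * (δ / 4)) :
    ∫⁻ x in Ω, ‖g x‖ₑ * ‖a x‖ₑ ≤ ENNReal.ofReal δ := by
  set I := ∫ x in Ω, η x with hI
  have hI0 : 0 ≤ I := integral_nonneg hη0
  -- Makes l∫η at most δ/4; the summand 1 covers η = 0.
  set l := δ / (4 * (I + 1)) with hl
  have hl0 : 0 < l := by positivity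
  have hi2 : IntegrableOn (fun x => η x * ‖g x‖ ^ 2) Ω := by
    have h3 : IntegrableOn (fun x => ‖g x‖ ^ 2 * η x) Ω := by
      refine Integrable.bdd_mul (c := 4) hη (hg.norm.pow 2) ?_
      filter_upwards [hg2] with x hx
      rw [Real.norm_of_nonneg (by positivity)]
      nlinarith [norm_nonneg (g x)]
    simpa only [mul_comm] using h3
  have hi3 : IntegrableOn (fun x => l * η x + η x * ‖g x‖ ^ 2 / l) Ω :=
    (hη.const_mul l).add (hi2.div_const l)
  have h4 : ∫ x in Ω, (l * η x + η x * ‖g x‖ ^ 2 / l) ≤ δ / 2 := by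
    rw [integral_add (hη.const_mul l) (hi2.div_const l), integral_const_mul, integral_div]
    have h5 : l * I ≤ δ / 4 := by
      rw [hl, div_mul_eq_mul_div, div_le_div_iff₀ (by positivity) (by norm_num)]
      nlinarith
    have h6 : (∫ x in Ω, η x * ‖g x‖ ^ 2) / l ≤ δ / 4 := by
      rw [div_le_iff₀ hl0, mul_comm]; exact h2
    linarith
  have hpt : ∀ᵐ x ∂(volume.restrict Ω), ‖g x‖ₑ * ‖a x‖ₑ
      ≤ 2 * ‖‖a x‖ - η x‖ₑ + ENNReal.ofReal (l * η x + η x * ‖g x‖ ^ 2 / l) := by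
    filter_upwards [hg2] with x hx
    have h5 : ‖g x‖ * ‖a x‖ ≤ 2 * |‖a x‖ - η x| + (l * η x + η x * ‖g x‖ ^ 2 / l) := by
      have h6 : ‖g x‖ ≤ l + ‖g x‖ ^ 2 / l := by
        rw [← sub_le_iff_le_add', le_div_iff₀ hl0]
        nlinarith [sq_nonneg (‖g x‖ - l), norm_nonneg (g x)]
      have h7 : η x * ‖g x‖ ≤ l * η x + η x * ‖g x‖ ^ 2 / l := by
        have := mul_le_mul_of_nonneg_left h6 (hη0 x)
        calc η x * ‖g x‖ ≤ η x * (l + ‖g x‖ ^ 2 / l) := this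
          _ = _ := by ring
      have h8 : ‖g x‖ * (‖a x‖ - η x) ≤ 2 * |‖a x‖ - η x| :=
        (mul_le_mul_of_nonneg_left (le_abs_self _) (norm_nonneg _)).trans
          (mul_le_mul_of_nonneg_right hx (abs_nonneg _))
      linarith
    have h9 := ENNReal.ofReal_le_ofReal h5
    have h10 := hη0 x
    rw [ENNReal.ofReal_mul (norm_nonneg _), ENNReal.ofReal_add (by positivity) (by positivity),
      ENNReal.ofReal_mul (by norm_num), ofReal_norm, ofReal_norm, ← Real.norm_eq_abs,
      ofReal_norm] at h9
    simpa using h9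
  have hm : AEMeasurable (fun x => ‖‖a x‖ - η x‖ₑ) (volume.restrict Ω) :=
    (ha.1.norm.sub hη.1).enorm
  refine (lintegral_mono_ae hpt).trans ?_
  rw [lintegral_add_left' (hm.const_mul _), lintegral_const_mul'' _ hm,
    ← ofReal_integral_eq_lintegral_ofReal hi3 (Eventually.of_forall fun x => by
      have := hη0 x; show 0 ≤ _; positivity)]
  refine (add_le_add (mul_le_mul_right h1 2) (ENNReal.ofReal_le_ofReal h4)).trans (le_of_eq ?_)
  rw [show (2 : ℝ≥0∞) = ENNReal.ofReal 2 by simp, ← ENNReal.ofReal_mul (by norm_num),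
    ← ENNReal.ofReal_add (by positivity) (by positivity)]
  congr 1
  ring

/-- The element u₀ e^{iδ sin(k xᵢ)} of the class of u₀ nearly realises the supremum: a competitor
with small energy would have to follow the oscillation closely, and then the error term ∫|g||a|
disappears and the estimate for e near 1 applies. -/
theorem Sig_le_distSup (hΩ : IsOpen Ω) (hfin : volume Ω ≠ ⊤) (i : Fin N) (hu₀ : u₀ ∈ W11Circle Ω)
    (hv₀ : v₀ ∈ W11Circle Ω) :
    Sig Ω (fun x => u₀ x * conj (v₀ x)) ≤ distSup Ω (equivClass Ω u₀) (equivClass Ω v₀) := by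
  set S := Sig Ω (fun x => u₀ x * conj (v₀ x)) with hS
  have hSfin : S ≠ ⊤ := (Sig_lt_top hΩ hfin (mul_conj_mem hΩ hfin hu₀ hv₀)).ne
  obtain ⟨a, ha⟩ := exists_isCircleMap hΩ hu₀
  refine ennreal_le_of_forall_small (A := 1 + 2 * S)
    (ENNReal.add_ne_top.2 ⟨ENNReal.one_ne_top, ENNReal.mul_ne_top (by norm_num) hSfin⟩)
    fun ε hε0 _ => ?_
  set δ := min ε (1 / 4) with hδ
  have hδ0 : 0 < δ := lt_min hε0 (by norm_num)
  have hδε : δ ≤ ε := min_le_left _ _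
  have hδ4 : δ ≤ 1 / 4 := min_le_right _ _
  obtain ⟨η, hηd, hηc, hηs, hη0, hηT⟩ := exists_smooth_nonneg_approx hΩ ha.integrable.norm
    (fun x => norm_nonneg _) (ε := ENNReal.ofReal (δ / 4)) (by simpa using hδ0)
  have hηi : IntegrableOn η Ω :=
    (hηd.continuous.integrable_of_hasCompactSupport hηc).integrableOn
  have hI0 : 0 ≤ ∫ x in Ω, η x := integral_nonneg hη0
  -- A bound for ∫|∇g| valid for every competitor of energy below S, since |g| ≤ 2; it is available
  -- before k is chosen.
  set C := S + 2 * ∫⁻ x in Ω, ‖a x‖ₑ with hC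
  have hCfin : C ≠ ⊤ :=
    ENNReal.add_ne_top.2 ⟨hSfin, ENNReal.mul_ne_top (by norm_num) ha.integrable.2.ne⟩
  obtain ⟨k, hk, H⟩ := exists_frequency (Ω := Ω) hδ0 (by linarith) i hηd hηc hηs (C := C.toReal)
    (τ := (δ / (4 * ((∫ x in Ω, η x) + 1))) * (δ / 4)) (by positivity)
  set b : Space N → EuclideanSpace ℝ (Fin N) := fun x =>
    EuclideanSpace.single i (δ * k * Real.cos (k * x i)) with hb
  obtain ⟨hψi, hbi⟩ := memW11_sine_phase hfin δ k i
  have hψ := hasWeakPartials_sine_phase Ω δ k i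
  have he := isCircleMap_exp hΩ (b := b) hψ hbi
  set e : Space N → ℂ := fun x =>
    Complex.exp (Complex.I * ((δ * Real.sin (k * x i) : ℝ) : ℂ)) with hedef
  have heu : Equivalent Ω (fun x => u₀ x * e x) u₀ :=
    equivalent_mul_exp (memW11_iff.2 ⟨hψi, b, hψ, hbi⟩) u₀
  have hu := ha.mul hΩ he
  have humem : (fun x => u₀ x * e x) ∈ equivClass Ω u₀ := ⟨hu.mem_W11Circle hfin, heu⟩
  have key : ENNReal.ofReal (1 - 2 * δ) * S
      ≤ distTo Ω (fun x => u₀ x * e x) (equivClass Ω v₀) + ENNReal.ofReal δ := by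
    rw [← tsub_le_iff_right]
    refine le_iInf₂ fun v hv => ?_
    rw [tsub_le_iff_right]
    -- Competitors of energy at least S satisfy the claim trivially; the others have the energy
    -- bound entering the choice of k.
    by_cases hE : S ≤ gradEnergy Ω fun x => u₀ x * e x - v x
    · refine le_trans ?_ (hE.trans le_self_add)
      exact mul_le_of_le_one_left bot_le (by rw [ENNReal.ofReal_le_one]; linarith)
    push Not at hE
    obtain ⟨c, hc⟩ := exists_isCircleMap hΩ hv.1
    have hs := ha.conj.mul hΩ hc
    set s : Space N → ℂ := fun x => conj (u₀ x) * v x with hsdef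
    have hclose : ∀ᵐ x ∂(volume.restrict Ω), ‖e x - 1‖ ≤ δ := by
      refine Eventually.of_forall fun x => (Real.norm_exp_I_mul_ofReal_sub_one_le).trans ?_
      rw [Real.norm_eq_abs, abs_mul, abs_of_pos hδ0]
      exact mul_le_of_le_one_right hδ0.le (Real.abs_sin_le_one _)
    have h1 := Sig_mul_conj_le_of_near_one hΩ hfin he hs hδ0.le hδ4 hclose
    have h2 : S ≤ Sig Ω (fun x => e x * conj (s x)) := by
      refine Sig_le_of_equivalent_right hΩ (he.mul hΩ hs.conj |>.mem_W11Circle hfin) ?_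
      refine (Equivalent.of_ae_eq hfin ?_).trans (heu.mul hv.2.conj)
      exact Eventually.of_forall fun x => by simp [hsdef]; ring
    have h3 := lintegral_gradient_rotate_le hΩ ha he hc
    have hg2 : ∀ᵐ x ∂(volume.restrict Ω), ‖e x - s x‖ ≤ 2 := by
      filter_upwards [he.norm_eq, hs.norm_eq] with x h4 h5
      refine (norm_sub_le _ _).trans ?_
      rw [h4, h5]; norm_num
    have hgp := he.partials.sub hs.partials
    have hgi : IntegrableOn (fun x => Complex.I * e x * b x i
        - Complex.I * s x * (-a x + c x) i) Ω :=
      (he.integrableOn_partial i).sub (hs.integrableOn_partial i)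
    have h4 : ∫⁻ x in Ω, ‖e x - s x‖ₑ * ‖a x‖ₑ ≤ ENNReal.ofReal δ := by
      refine lintegral_mul_le_of_approx hηi hη0 hgp.loc.aestronglyMeasurable ha.integrable hg2 hδ0
        hηT (H _ _ hgp hg2 hgi ?_ ?_ ?_)
      · rw [integral_norm_eq_lintegral_enorm hgi.1]
        refine ENNReal.toReal_mono hCfin ?_
        refine le_trans (lintegral_mono fun x => ?_) (h3.trans (add_le_add hE.le ?_))
        · rw [← ofReal_norm, ← ofReal_norm]
          refine ENNReal.ofReal_le_ofReal ?_
          exact PiLp.norm_apply_le (WithLp.toLp 2 fun j => Complex.I * e x * b x j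
            - Complex.I * (conj (u₀ x) * v x) * (-a x + c x) j : EuclideanSpace ℂ (Fin N)) i
        · rw [← lintegral_const_mul' _ _ (by norm_num)]
          refine lintegral_mono_ae ?_
          filter_upwards [hg2] with x hx
          refine mul_le_mul_left ?_ _
          rw [← ofReal_norm]
          exact (ENNReal.ofReal_le_ofReal hx).trans (by simp)
      · filter_upwards [hs.norm_eq] with x hx
        have h5 : (s x).re * (s x).re + (s x).im * (s x).im = 1 := by
          rw [← Complex.normSq_apply, Complex.normSq_eq_norm_sq, hx]; norm_num
        have h6 : (e x).re = Real.cos (δ * Real.sin (k * x i)) := by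
          simp only [hedef]; rw [mul_comm, Complex.exp_ofReal_mul_I_re]
        have h7 : (e x).im = Real.sin (δ * Real.sin (k * x i)) := by
          simp only [hedef]; rw [mul_comm, Complex.exp_ofReal_mul_I_im]
        rw [← Complex.normSq_eq_norm_sq, Complex.normSq_apply, Complex.sub_re, Complex.sub_im,
          h6, h7]
        linear_combination (-1 / 2) * h5 +
          (1 / 2) * Real.sin_sq_add_cos_sq (δ * Real.sin (k * x i))
      · filter_upwards [hs.norm_eq] with x hx
        have h6 : (e x).re = Real.cos (δ * Real.sin (k * x i)) := by
          simp only [hedef]; rw [mul_comm, Complex.exp_ofReal_mul_I_re]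
        have h7 : (e x).im = Real.sin (δ * Real.sin (k * x i)) := by
          simp only [hedef]; rw [mul_comm, Complex.exp_ofReal_mul_I_im]
        have h8 := abs_im_mul_le (z := e x) hx (b x i) ((-a x + c x) i)
        refine le_trans (le_of_eq ?_) h8
        have h9 : b x i = δ * k * Real.cos (k * x i) := by simp [hb]
        rw [h9]
        congr 2
        rw [Complex.sub_im, Complex.sub_re, ← h6, ← h7]
        simp
        ring
    calc ENNReal.ofReal (1 - 2 * δ) * S
        ≤ ENNReal.ofReal (1 - 2 * δ) * Sig Ω (fun x => e x * conj (s x)) := mul_le_mul_right h2 _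
      _ ≤ _ := h1
      _ ≤ _ := h3
      _ ≤ _ := add_le_add le_rfl h4
  have hD : distTo Ω (fun x => u₀ x * e x) (equivClass Ω v₀)
      ≤ distSup Ω (equivClass Ω u₀) (equivClass Ω v₀) :=
    le_iSup₂_of_le (f := fun u _ => distTo Ω u (equivClass Ω v₀)) _ humem le_rfl
  calc S = ENNReal.ofReal (1 - 2 * δ) * S + ENNReal.ofReal (2 * δ) * S := by
        rw [← add_mul, ← ENNReal.ofReal_add (by linarith) (by linarith)]
        simp
    _ ≤ (distSup Ω (equivClass Ω u₀) (equivClass Ω v₀) + ENNReal.ofReal ε)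
        + ENNReal.ofReal (2 * ε) * S := by
        refine add_le_add (key.trans (add_le_add hD (ENNReal.ofReal_le_ofReal hδε)))
          (mul_le_mul_left (ENNReal.ofReal_le_ofReal (by linarith)) _)
    _ = ENNReal.ofReal ε * (1 + 2 * S) + distSup Ω (equivClass Ω u₀) (equivClass Ω v₀) := by
        rw [ENNReal.ofReal_mul (by norm_num)]
        simp
        ring

end Dist

/-! ### Translation estimates by the gradient -/

section Translation

variable {N : ℕ} {E : Type*} [NormedAddCommGroup E] [NormedSpace ℝ E]
  {Ω : Set (Space N)} {u : Space N → E} {g : Fin N → Space N → E}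

theorem enorm_clm_apply_le_sum (L : Space N →L[ℝ] E) (h : Space N) :
    ‖L h‖ₑ ≤ ‖h‖ₑ * ∑ j, ‖L (EuclideanSpace.single j 1)‖ₑ := by
  have h1 : L h = ∑ j, h j • L (EuclideanSpace.single j 1) := by
    conv_lhs => rw [← (EuclideanSpace.basisFun (Fin N) ℝ).sum_repr h]
    simp [map_sum]
  rw [h1, Finset.mul_sum]
  refine (enorm_sum_le _ _).trans (Finset.sum_le_sum fun j _ => ?_)
  rw [enorm_smul]
  refine mul_le_mul_left ?_ _
  rw [← ofReal_norm, ← ofReal_norm]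
  exact ENNReal.ofReal_le_ofReal (PiLp.norm_apply_le h j)

theorem enorm_translate_sub_le [CompleteSpace E] {v : Space N → E} (hv : ContDiff ℝ 1 v)
    (x h : Space N) :
    ‖v (x + h) - v x‖ₑ ≤ ∫⁻ t in Icc (0 : ℝ) 1,
      ‖h‖ₑ * ∑ j, ‖fderiv ℝ v (x + t • h) (EuclideanSpace.single j 1)‖ₑ := by
  have h1 : ∀ t : ℝ, HasDerivAt (fun t : ℝ => v (x + t • h)) (fderiv ℝ v (x + t • h) h) t := by
    intro t
    have h2 : HasDerivAt (fun t : ℝ => x + t • h) h t := by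
      simpa using ((hasDerivAt_id t).smul_const h).const_add x
    exact ((hv.differentiable (by simp)) _).hasFDerivAt.comp_hasDerivAt t h2
  have hcont : Continuous fun t : ℝ => fderiv ℝ v (x + t • h) h :=
    ((hv.continuous_fderiv (by simp)).comp (by fun_prop)).clm_apply continuous_const
  have h3 := intervalIntegral.integral_eq_sub_of_hasDerivAt (a := 0) (b := 1)
    (fun t _ => h1 t) (hcont.intervalIntegrable _ _)
  simp only [one_smul, zero_smul, add_zero] at h3
  rw [← h3, intervalIntegral.integral_of_le zero_le_one, ← integral_Icc_eq_integral_Ioc]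
  exact (enorm_integral_le_lintegral_enorm _).trans
    (lintegral_mono fun t => enorm_clm_apply_le_sum _ _)

theorem lintegral_translate_sub_le_of_contDiff [CompleteSpace E] {v : Space N → E}
    (hv : ContDiff ℝ 1 v) {A K : Set (Space N)} {h : Space N} (hA : MeasurableSet A)
    (hAK : ∀ x ∈ A, ∀ t ∈ Icc (0 : ℝ) 1, x + t • h ∈ K) :
    ∫⁻ x in A, ‖v (x + h) - v x‖ₑ
      ≤ ‖h‖ₑ * ∑ j, ∫⁻ x in K, ‖fderiv ℝ v x (EuclideanSpace.single j 1)‖ₑ := by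
  set F : Space N → ℝ≥0∞ := fun y =>
    ‖h‖ₑ * ∑ j, ‖fderiv ℝ v y (EuclideanSpace.single j 1)‖ₑ with hF
  have hFc : Continuous F := by
    refine ENNReal.continuous_const_mul (by simp) |>.comp ?_
    refine continuous_finsetSum _ fun j _ => ?_
    exact ((hv.continuous_fderiv (by simp)).clm_apply continuous_const).enorm
  calc ∫⁻ x in A, ‖v (x + h) - v x‖ₑ
      ≤ ∫⁻ x in A, ∫⁻ t in Icc (0 : ℝ) 1, F (x + t • h) :=
        lintegral_mono fun x => enorm_translate_sub_le hv x h
    _ = ∫⁻ t in Icc (0 : ℝ) 1, ∫⁻ x in A, F (x + t • h) := by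
        refine lintegral_lintegral_swap (Continuous.aemeasurable ?_)
        exact hFc.comp (by fun_prop)
    _ ≤ ∫⁻ t in Icc (0 : ℝ) 1, ∫⁻ x in K, F x := by
        refine setLIntegral_mono' measurableSet_Icc fun t ht => ?_
        rw [← lintegral_indicator hA]
        have h1 : ∀ x, A.indicator (fun x => F (x + t • h)) x
            ≤ K.indicator F (x + t • h) := fun x => by
          by_cases hx : x ∈ A
          · rw [indicator_of_mem hx, indicator_of_mem (hAK x hx t ht)]
          · rw [indicator_of_notMem hx]; exact bot_le
        refine (lintegral_mono h1).trans ?_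
        rw [lintegral_add_right_eq_self (fun x => K.indicator F x)]
        exact lintegral_indicator_le _ _
    _ = ∫⁻ x in K, F x := by simp
    _ = _ := by
        rw [hF, lintegral_const_mul' _ _ (by simp), lintegral_finsetSum]
        intro j _
        exact (((hv.continuous_fderiv (by simp)).clm_apply continuous_const).enorm).measurable

/-- For smooth maps this is the fundamental theorem of calculus along the segments, which stay in
the compact set K; smooth approximation on K then passes it to u. -/
theorem HasWeakPartials.lintegral_translate_sub_le_of_isCompact [CompleteSpace E] (hΩ : IsOpen Ω)
    (hu : HasWeakPartials Ω u g) (hm : StronglyMeasurable u) {A K : Set (Space N)} {h : Space N}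
    (hA : MeasurableSet A) (hK : IsCompact K) (hKΩ : K ⊆ Ω)
    (hAK : ∀ x ∈ A, ∀ t ∈ Icc (0 : ℝ) 1, x + t • h ∈ K) :
    ∫⁻ x in A, ‖u (x + h) - u x‖ₑ ≤ ‖h‖ₑ * ∑ j, ∫⁻ x in Ω, ‖g j x‖ₑ := by
  obtain ⟨v, hv, -, hv0, hv1⟩ := hu.exists_smooth_approx hΩ hK hKΩ
  have hvc : ∀ n, Continuous (v n) := fun n => (hv n).continuous
  have hA0 : A ⊆ K := fun x hx => by simpa using hAK x hx 0 (by simp)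
  have hA1 : ∀ f : Space N → ℝ≥0∞, ∫⁻ x in A, f (x + h) ≤ ∫⁻ x in K, f x := fun f => by
    rw [← lintegral_indicator hA]
    have h1 : ∀ x, A.indicator (fun x => f (x + h)) x ≤ K.indicator f (x + h) := fun x => by
      by_cases hx : x ∈ A
      · rw [indicator_of_mem hx, indicator_of_mem (by simpa using hAK x hx 1 (by simp))]
      · rw [indicator_of_notMem hx]; exact bot_le
    refine (lintegral_mono h1).trans ?_
    rw [lintegral_add_right_eq_self (fun x => K.indicator f x)]
    exact lintegral_indicator_le _ _
  have hbound : ∀ n, ∫⁻ x in A, ‖u (x + h) - u x‖ₑ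
      ≤ (∫⁻ x in K, ‖v n x - u x‖ₑ) + (∫⁻ x in K, ‖v n x - u x‖ₑ)
        + ‖h‖ₑ * ∑ j, ((∫⁻ x in K, ‖fderiv ℝ (v n) x (EuclideanSpace.single j 1) - g j x‖ₑ)
          + ∫⁻ x in Ω, ‖g j x‖ₑ) := by
    intro n
    have hmm : ∀ n, StronglyMeasurable fun x => v n x - u x :=
      fun n => (hvc n).stronglyMeasurable.sub hm
    have htr : Measurable fun x : Space N => x + h := by fun_prop
    have h1 : ∀ x, ‖u (x + h) - u x‖ₑ ≤ ‖v n (x + h) - u (x + h)‖ₑ + ‖v n x - u x‖ₑ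
        + ‖v n (x + h) - v n x‖ₑ := fun x => by
      have h2 : u (x + h) - u x = -(v n (x + h) - u (x + h)) + (v n x - u x)
        + (v n (x + h) - v n x) := by abel
      rw [h2]
      refine (enorm_add_le _ _).trans (add_le_add ((enorm_add_le _ _).trans ?_) le_rfl)
      rw [enorm_neg]
    refine (lintegral_mono h1).trans ?_
    have m1 : Measurable fun x => ‖v n (x + h) - u (x + h)‖ₑ := (hmm n).enorm.comp htr
    have m2 : Measurable fun x => ‖v n x - u x‖ₑ := (hmm n).enorm
    have m3 : Measurable fun x => ‖v n (x + h) - u (x + h)‖ₑ + ‖v n x - u x‖ₑ := m1.add m2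
    rw [lintegral_add_left m3, lintegral_add_left m1]
    refine add_le_add (add_le_add (hA1 fun x => ‖v n x - u x‖ₑ) (lintegral_mono_set hA0)) ?_
    refine (lintegral_translate_sub_le_of_contDiff ((hv n).of_le (by exact_mod_cast le_top))
      hA hAK).trans (mul_le_mul_right (Finset.sum_le_sum fun j _ => ?_) _)
    have h3 : ∀ x, ‖fderiv ℝ (v n) x (EuclideanSpace.single j 1)‖ₑ
        ≤ ‖fderiv ℝ (v n) x (EuclideanSpace.single j 1) - g j x‖ₑ + ‖g j x‖ₑ := fun x => by
      conv_lhs => rw [← sub_add_cancel (fderiv ℝ (v n) x (EuclideanSpace.single j 1)) (g j x)]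
      exact enorm_add_le _ _
    refine (lintegral_mono h3).trans ?_
    rw [lintegral_add_right']
    · exact add_le_add le_rfl (lintegral_mono_set hKΩ)
    · exact ((hu.loc_partial j).integrableOn_compact_subset hKΩ hK).1.enorm
  have h4 : Tendsto (fun n => ∑ j,
      ((∫⁻ x in K, ‖fderiv ℝ (v n) x (EuclideanSpace.single j 1) - g j x‖ₑ)
        + ∫⁻ x in Ω, ‖g j x‖ₑ)) atTop (𝓝 (∑ j, (0 + ∫⁻ x in Ω, ‖g j x‖ₑ))) :=
    tendsto_finsetSum _ fun j _ => (hv1 j).add tendsto_const_nhds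
  have h5 := (hv0.add hv0).add (ENNReal.Tendsto.const_mul (a := ‖h‖ₑ) h4 (Or.inr (by simp)))
  simp only [add_zero, zero_add] at h5
  exact ge_of_tendsto' h5 hbound

theorem HasWeakPartials.lintegral_translate_sub_le [CompleteSpace E] (hΩ : IsOpen Ω)
    (hu : HasWeakPartials Ω u g) (hm : StronglyMeasurable u) {A : Set (Space N)} {h : Space N}
    (hA : IsOpen A) (hAΩ : ∀ x ∈ A, ∀ t ∈ Icc (0 : ℝ) 1, x + t • h ∈ Ω) :
    ∫⁻ x in A, ‖u (x + h) - u x‖ₑ ≤ ‖h‖ₑ * ∑ j, ∫⁻ x in Ω, ‖g j x‖ₑ := by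
  obtain ⟨F, hFc, hFA, hFU, hFm⟩ := hA.exists_iUnion_isClosed
  -- A compact exhaustion of A; the segments issuing from one C n sweep out a compact subset of Ω.
  set C : ℕ → Set (Space N) := fun n => F n ∩ Metric.closedBall 0 n with hC
  have hCc : ∀ n, IsCompact (C n) := fun n => (isCompact_closedBall _ _).inter_left (hFc n)
  have hCm : Monotone C := fun m n hmn => inter_subset_inter (hFm hmn)
    (Metric.closedBall_subset_closedBall (by exact_mod_cast hmn))
  have hCU : ⋃ n, C n = A := by
    refine subset_antisymm (iUnion_subset fun n => inter_subset_left.trans (hFA n)) fun x hx => ?_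
    rw [← hFU] at hx
    obtain ⟨m, hm⟩ := mem_iUnion.1 hx
    obtain ⟨k, hk⟩ := exists_nat_ge ‖x‖
    refine mem_iUnion.2 ⟨max m k, hFm (le_max_left _ _) hm, ?_⟩
    rw [mem_closedBall_zero_iff]
    exact hk.trans (by exact_mod_cast le_max_right _ _)
  rw [← hCU, setLIntegral_iUnion_of_directed _ hCm.directed_le]
  refine iSup_le fun n => ?_
  refine hu.lintegral_translate_sub_le_of_isCompact hΩ hm (hCc n).measurableSet
    (K := (fun p : Space N × ℝ => p.1 + p.2 • h) '' (C n ×ˢ Icc 0 1))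
    (((hCc n).prod isCompact_Icc).image (by fun_prop)) ?_ ?_
  · rintro _ ⟨⟨x, t⟩, ⟨hx, ht⟩, rfl⟩
    exact hAΩ x (hFA n hx.1) t ht
  · exact fun x hx t ht => ⟨(x, t), ⟨hx, ht⟩, rfl⟩

end Translation

/-! ### Propagating L¹ control through the domain -/

section Control

variable {N : ℕ} {E : Type*} [NormedAddCommGroup E] [NormedSpace ℝ E]
  {Ω B S T : Set (Space N)}

/-- The `L¹` norm on `S` of a function is controlled by its `L¹` norm on `B` and by the `L¹` norm of
its gradient on `Ω`. -/
def ControlledOn (E : Type*) [NormedAddCommGroup E] [NormedSpace ℝ E] (Ω B S : Set (Space N)) :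
    Prop :=
  ∃ C : NNReal, ∀ (u : Space N → E) (g : Fin N → Space N → E), HasWeakPartials Ω u g →
    StronglyMeasurable u →
    ∫⁻ x in S, ‖u x‖ₑ ≤ C * ((∫⁻ x in B, ‖u x‖ₑ) + ∑ j, ∫⁻ x in Ω, ‖g j x‖ₑ)

theorem ControlledOn.self : ControlledOn E Ω B B :=
  ⟨1, fun u g _ _ => by simp⟩

theorem ControlledOn.empty : ControlledOn E Ω B ∅ :=
  ⟨1, fun u g _ _ => by simp⟩

theorem ControlledOn.mono (h : ControlledOn E Ω B S) (hT : T ⊆ S) : ControlledOn E Ω B T := by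
  obtain ⟨C, hC⟩ := h
  exact ⟨C, fun u g hu hm => (lintegral_mono_set hT).trans (hC u g hu hm)⟩

theorem ControlledOn.union (h : ControlledOn E Ω B S) (h' : ControlledOn E Ω B T) :
    ControlledOn E Ω B (S ∪ T) := by
  obtain ⟨C, hC⟩ := h
  obtain ⟨C', hC'⟩ := h'
  refine ⟨C + C', fun u g hu hm => (lintegral_union_le _ _ _).trans ?_⟩
  rw [ENNReal.coe_add, add_mul]
  exact add_le_add (hC u g hu hm) (hC' u g hu hm)

/-- |u(x + w)| ≤ |u(x)| + |u(x + w) − u(x)|, and the increment costs only the gradient as long as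
the segments remain in Ω. -/
theorem ControlledOn.translate [CompleteSpace E] (hΩ : IsOpen Ω) (h : ControlledOn E Ω B S)
    {w : Space N} (hS : IsOpen S) (hSΩ : ∀ x ∈ S, ∀ t ∈ Icc (0 : ℝ) 1, x + t • w ∈ Ω)
    (hT : ∀ x ∈ T, x - w ∈ S) : ControlledOn E Ω B T := by
  obtain ⟨C, hC⟩ := h
  refine ⟨C + ‖w‖₊, fun u g hu hm => ?_⟩
  have htr : Measurable fun x : Space N => x + w := by fun_prop
  have m1 : Measurable fun x => ‖u (x + w) - u x‖ₑ :=
    ((hm.comp_measurable htr).sub hm).enorm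
  have h1 : ∫⁻ x in T, ‖u x‖ₑ ≤ ∫⁻ x in S, ‖u (x + w)‖ₑ := by
    rw [← lintegral_indicator hS.measurableSet]
    calc ∫⁻ x in T, ‖u x‖ₑ ≤ ∫⁻ x in (fun x => x - w) ⁻¹' S, ‖u x‖ₑ := lintegral_mono_set hT
      _ = ∫⁻ x, ((fun x => x - w) ⁻¹' S).indicator (fun x => ‖u x‖ₑ) x :=
          (lintegral_indicator (hS.measurableSet.preimage (by fun_prop)) _).symm
      _ = ∫⁻ x, ((fun x => x - w) ⁻¹' S).indicator (fun x => ‖u x‖ₑ) (x + w) :=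
          (lintegral_add_right_eq_self _ w).symm
      _ ≤ _ := lintegral_mono fun x => le_of_eq (by
          by_cases hx : x ∈ S <;> simp [indicator, hx])
  have h2 : ∀ x, ‖u (x + w)‖ₑ ≤ ‖u x‖ₑ + ‖u (x + w) - u x‖ₑ := fun x => by
    conv_lhs => rw [← add_sub_cancel (u x) (u (x + w))]
    exact enorm_add_le _ _
  have h3 : ∫⁻ x in S, ‖u (x + w)‖ₑ ≤ (∫⁻ x in S, ‖u x‖ₑ)
      + ∫⁻ x in S, ‖u (x + w) - u x‖ₑ := by
    rw [← lintegral_add_right _ m1]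
    exact lintegral_mono h2
  refine (h1.trans h3).trans ?_
  rw [ENNReal.coe_add, add_mul]
  refine add_le_add (hC u g hu hm) ((hu.lintegral_translate_sub_le hΩ hm hS hSΩ).trans ?_)
  exact mul_le_mul_right le_add_self _

/-- Connectedness: the points having a controlled ball form an open set, and a translation by a
short vector shows it to be closed in Ω. -/
theorem exists_ball_controlledOn [CompleteSpace E] (hΩ : IsOpen Ω) (hc : IsPreconnected Ω)
    {x₀ : Space N} {r₀ : ℝ} (hr₀ : 0 < r₀) (hB : Metric.ball x₀ r₀ ⊆ Ω) {x : Space N} (hx : x ∈ Ω) :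
    ∃ r > 0, ControlledOn E Ω (Metric.ball x₀ r₀) (Metric.ball x r) := by
  set U : Set (Space N) := {x | ∃ r > 0, ControlledOn E Ω (Metric.ball x₀ r₀) (Metric.ball x r)}
  have hU : IsOpen U := by
    refine Metric.isOpen_iff.2 fun y ⟨r, hr, h⟩ => ⟨r, hr, fun z hz => ?_⟩
    exact ⟨r - dist z y, sub_pos.2 hz, h.mono (Metric.ball_subset_ball' (by linarith))⟩
  refine hc.subset_of_closure_inter_subset hU
    ⟨x₀, hB (Metric.mem_ball_self hr₀), r₀, hr₀, .self⟩ ?_ hx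
  rintro y ⟨hyU, hyΩ⟩
  obtain ⟨R, hR, hRΩ⟩ := Metric.isOpen_iff.1 hΩ y hyΩ
  obtain ⟨z, ⟨r, hr, h⟩, hzy⟩ := Metric.mem_closure_iff.1 hyU (R / 2) (by positivity)
  refine ⟨min r (R / 2), by positivity, ?_⟩
  refine (h.mono (Metric.ball_subset_ball (min_le_left _ (R / 2)))).translate hΩ (w := y - z)
    Metric.isOpen_ball (fun p hp t ht => hRΩ ?_) fun p hp => ?_
  · rw [Metric.mem_ball, dist_eq_norm] at hp ⊢
    rw [dist_eq_norm] at hzy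
    have h1 : p + t • (y - z) - y = (p - z) + (1 - t) • (z - y) := by module
    rw [h1]
    have h2 : ‖(1 - t) • (z - y)‖ ≤ ‖y - z‖ := by
      rw [norm_smul, Real.norm_eq_abs, abs_of_nonneg (by linarith [ht.2]), norm_sub_rev]
      exact mul_le_of_le_one_left (norm_nonneg _) (by linarith [ht.1])
    have := norm_add_le (p - z) ((1 - t) • (z - y))
    have := min_le_right r (R / 2)
    linarith
  · rw [Metric.mem_ball, dist_eq_norm] at hp ⊢
    rwa [show p - (y - z) - z = p - y by abel]

/-- Choose e with dρ(e) < 0 at x. Near x the function ρ decreases along e, so the part of Ω near x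
can be pushed by s·e into a controlled interior ball along segments in Ω. -/
theorem IsSmoothBoundedDomain.exists_ball_controlledOn_of_frontier [CompleteSpace E]
    (hΩ : IsSmoothBoundedDomain Ω) {x₀ : Space N} {r₀ : ℝ} (hr₀ : 0 < r₀)
    (hB : Metric.ball x₀ r₀ ⊆ Ω) {x : Space N} (hx : x ∈ frontier Ω) :
    ∃ r > 0, ControlledOn E Ω (Metric.ball x₀ r₀) (Metric.ball x r ∩ Ω) := by
  obtain ⟨U, ρ, hU, hxU, hρ, hd, hiff⟩ := hΩ.smooth_boundary x hx
  have hxΩ : x ∉ Ω := by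
    rw [hΩ.isOpen.frontier_eq] at hx; exact hx.2
  have hρx : ρ x = 0 := by
    refine le_antisymm ?_ (not_lt.1 fun h => hxΩ ((hiff x hxU).2 h))
    have h1 : x ∈ closure (U ∩ Ω) := hU.inter_closure ⟨hxU, frontier_subset_closure hx⟩
    exact closure_minimal (fun y hy => ((hiff y hy.1).1 hy.2).le)
      (isClosed_le hρ.continuous continuous_const) h1
  obtain ⟨e, he⟩ : ∃ e, fderiv ℝ ρ x e < 0 := by
    by_contra! h
    refine hd (ContinuousLinearMap.ext fun e => le_antisymm ?_ (h e))
    have := h (-e)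
    rw [map_neg] at this
    simpa using this
  have hcont : Continuous fun y => fderiv ℝ ρ y e :=
    (hρ.continuous_fderiv (by simp)).clm_apply continuous_const
  obtain ⟨δ, hδ, hδU⟩ := Metric.isOpen_iff.1 (hU.inter (isOpen_lt hcont continuous_const)) x
      ⟨hxU, he⟩
  have hray : ∀ y ∈ Metric.ball x δ, ∀ s : ℝ, 0 < s → y + s • e ∈ Metric.ball x δ →
      ρ (y + s • e) < ρ y := by
    intro y hy s hs hys
    have hder : ∀ t : ℝ, HasDerivAt (fun t : ℝ => ρ (y + t • e)) (fderiv ℝ ρ (y + t • e) e) t := by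
      intro t
      have h2 : HasDerivAt (fun t : ℝ => y + t • e) e t := by
        simpa using ((hasDerivAt_id t).smul_const e).const_add y
      exact ((hρ.differentiable (by simp)) _).hasFDerivAt.comp_hasDerivAt t h2
    obtain ⟨t, ht, hts⟩ := exists_hasDerivAt_eq_slope (fun t : ℝ => ρ (y + t • e))
      (fun t => fderiv ℝ ρ (y + t • e) e) hs
      (fun t _ => (hder t).continuousAt.continuousWithinAt) fun t _ => hder t
    have hmem : y + t • e ∈ Metric.ball x δ := by
      have h3 := (convex_ball x δ) hy hys (a := 1 - t / s) (b := t / s)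
        (by rw [sub_nonneg, div_le_one hs]; exact ht.2.le) (div_nonneg ht.1.le hs.le) (by ring)
      convert h3 using 1
      rw [smul_add, smul_smul, div_mul_cancel₀ _ hs.ne']
      module
    have h4 := (hδU hmem).2
    simp only [mem_ofPred_eq, sub_zero, zero_smul, add_zero] at h4 hts
    rw [hts, div_lt_iff₀ hs] at h4
    linarith
  obtain ⟨s, hs, hse⟩ : ∃ s : ℝ, 0 < s ∧ s * ‖e‖ < δ / 2 := by
    refine ⟨δ / (2 * (‖e‖ + 1)), by positivity, ?_⟩
    rw [div_mul_eq_mul_div, div_lt_div_iff₀ (by positivity) (by positivity)]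
    nlinarith [norm_nonneg e]
  have hin : ∀ y ∈ Metric.ball x (δ / 2), ∀ t : ℝ, 0 ≤ t → t ≤ s → y + t • e ∈ Metric.ball x δ := by
    intro y hy t ht hts
    rw [Metric.mem_ball, dist_eq_norm] at hy ⊢
    rw [show y + t • e - x = (y - x) + t • e by abel]
    have := norm_add_le (y - x) (t • e)
    rw [norm_smul, Real.norm_of_nonneg ht] at this
    have := mul_le_mul_of_nonneg_right hts (norm_nonneg e)
    linarith
  have hball : Metric.ball x (δ / 2) ⊆ Metric.ball x δ := Metric.ball_subset_ball (by linarith)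
  have hx2 : x ∈ Metric.ball x (δ / 2) := Metric.mem_ball_self (by positivity)
  have hxs : x + s • e ∈ Ω := by
    have h1 := hin x hx2 s hs.le le_rfl
    rw [hiff _ (hδU h1).1, ← hρx]
    exact hray x (hball hx2) s hs h1
  obtain ⟨r, hr, hC⟩ := exists_ball_controlledOn (E := E) hΩ.isOpen hΩ.isConnected.isPreconnected
    hr₀ hB hxs
  set r' := min r (δ / 2)
  have hr' : 0 < r' := by positivity
  refine ⟨r', hr', ?_⟩
  -- Start from the pushed-in copy and travel back by −s·e. Every point on the way lies on an inward
  -- ray from a point of Ω, so ρ is negative there.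
  refine (hC.mono (T := (fun y => y - s • e) ⁻¹' (Metric.ball x r' ∩ Ω)) ?_).translate hΩ.isOpen
    (w := -(s • e)) ((Metric.isOpen_ball.inter hΩ.isOpen).preimage (by fun_prop)) ?_ ?_
  · rintro y ⟨hy, -⟩
    rw [Metric.mem_ball, dist_eq_norm] at hy ⊢
    rw [show y - (x + s • e) = y - s • e - x by abel]
    exact hy.trans_le (min_le_left _ _)
  · rintro y ⟨hy, hyΩ⟩ t ht
    have hy2 : y - s • e ∈ Metric.ball x (δ / 2) := Metric.ball_subset_ball (min_le_right _ _) hy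
    have h1 : y + t • -(s • e) = (y - s • e) + ((1 - t) * s) • e := by module
    have h2 : (1 - t) * s ≤ s := by nlinarith [ht.1]
    have h3 : 0 ≤ (1 - t) * s := mul_nonneg (by linarith [ht.2]) hs.le
    rw [h1]
    rcases h3.eq_or_lt with h4 | h4
    · rwa [← h4, zero_smul, add_zero]
    have h5 := hin _ hy2 _ h3 h2
    rw [hiff _ (hδU h5).1]
    exact (hray _ (hball hy2) _ h4 h5).trans ((hiff _ (hδU (hball hy2)).1).1 hyΩ)
  · intro y hy
    simpa using hy

/-- Control passes to subsets and finite unions, so compactness of the closure reduces the claim to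
neighbourhoods of interior and of frontier points. -/
theorem IsSmoothBoundedDomain.controlledOn [CompleteSpace E]
    (hΩ : IsSmoothBoundedDomain Ω) {x₀ : Space N} {r₀ : ℝ} (hr₀ : 0 < r₀)
    (hB : Metric.ball x₀ r₀ ⊆ Ω) : ControlledOn E Ω (Metric.ball x₀ r₀) Ω := by
  have hcomp : IsCompact (closure Ω) := hΩ.isBounded.isCompact_closure
  suffices H : ControlledOn E Ω (Metric.ball x₀ r₀) (closure Ω ∩ Ω) from
    H.mono fun x hx => ⟨subset_closure hx, hx⟩
  refine hcomp.induction_on (p := fun S => ControlledOn E Ω (Metric.ball x₀ r₀) (S ∩ Ω))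
    ?_ (fun s t hst ht => ht.mono (inter_subset_inter_left _ hst)) (fun s t hs ht => ?_)
    fun x hx => ?_
  · simpa using ControlledOn.empty
  · rw [union_inter_distrib_right]; exact hs.union ht
  · by_cases hxΩ : x ∈ Ω
    · obtain ⟨r, hr, h⟩ := exists_ball_controlledOn (E := E) hΩ.isOpen
        hΩ.isConnected.isPreconnected hr₀ hB hxΩ
      exact ⟨_, mem_nhdsWithin_of_mem_nhds (Metric.ball_mem_nhds x hr), h.mono inter_subset_left⟩
    · obtain ⟨r, hr, h⟩ := hΩ.exists_ball_controlledOn_of_frontier (E := E) hr₀ hB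
        (show x ∈ frontier Ω by rw [hΩ.isOpen.frontier_eq]; exact ⟨hx, hxΩ⟩)
      exact ⟨_, mem_nhdsWithin_of_mem_nhds (Metric.ball_mem_nhds x hr), h⟩

end Control

/-! ### Poincaré inequality and the vanishing of Σ -/

section Poincare

variable {N : ℕ} {E : Type*} [NormedAddCommGroup E] [NormedSpace ℝ E]
  {Ω : Set (Space N)}

/-- Substitute y = x + h and integrate in x first: by convexity the segments stay in the ball, and
only |h| < 2r occurs. -/
theorem HasWeakPartials.lintegral_ball_sub_le [CompleteSpace E] (hΩ : IsOpen Ω)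
    {u : Space N → E} {g : Fin N → Space N → E}
    (hu : HasWeakPartials Ω u g) (hm : StronglyMeasurable u) {x₀ : Space N} {r : ℝ}
    (hB : Metric.ball x₀ r ⊆ Ω) :
    ∫⁻ x in Metric.ball x₀ r, ∫⁻ y in Metric.ball x₀ r, ‖u y - u x‖ₑ
      ≤ volume (Metric.ball (0 : Space N) (2 * r)) *
        (ENNReal.ofReal (2 * r) * ∑ j, ∫⁻ x in Ω, ‖g j x‖ₑ) := by
  set B := Metric.ball x₀ r with hBdef
  have hBo : IsOpen B := Metric.isOpen_ball
  set F : Space N → Space N → ℝ≥0∞ := fun x h =>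
    ({p : Space N × Space N | p.1 ∈ B ∧ p.1 + p.2 ∈ B}).indicator
      (fun p => ‖u (p.1 + p.2) - u p.1‖ₑ) (x, h) with hF
  have hset : MeasurableSet {p : Space N × Space N | p.1 ∈ B ∧ p.1 + p.2 ∈ B} :=
    ((hBo.preimage continuous_fst).inter (hBo.preimage (by fun_prop))).measurableSet
  have hFm : Measurable (Function.uncurry F) := by
    refine Measurable.indicator ?_ hset
    exact ((hm.comp_measurable (by fun_prop)).sub (hm.comp_measurable measurable_fst)).enorm
  have h1 : ∫⁻ x in B, ∫⁻ y in B, ‖u y - u x‖ₑ = ∫⁻ x, ∫⁻ h, F x h := by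
    rw [← lintegral_indicator hBo.measurableSet]
    refine lintegral_congr fun x => ?_
    by_cases hx : x ∈ B
    · rw [indicator_of_mem hx, ← lintegral_indicator hBo.measurableSet,
        ← lintegral_add_left_eq_self _ x]
      refine lintegral_congr fun h => ?_
      by_cases hxh : x + h ∈ B <;> simp [hF, indicator, hx, hxh]
    · rw [indicator_of_notMem hx]
      simp [hF, indicator, hx]
  rw [h1, lintegral_lintegral_swap hFm.aemeasurable]
  have h2 : ∀ h, ∫⁻ x, F x h ≤ (Metric.ball (0 : Space N) (2 * r)).indicator
      (fun _ => ENNReal.ofReal (2 * r) * ∑ j, ∫⁻ x in Ω, ‖g j x‖ₑ) h := by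
    intro h
    set A : Set (Space N) := {x | x ∈ B ∧ x + h ∈ B} with hA
    have hAo : IsOpen A := hBo.inter (hBo.preimage (by fun_prop))
    have h3 : ∫⁻ x, F x h = ∫⁻ x in A, ‖u (x + h) - u x‖ₑ := by
      rw [← lintegral_indicator hAo.measurableSet]
      refine lintegral_congr fun x => ?_
      by_cases hx : x ∈ B <;> by_cases hxh : x + h ∈ B <;> simp [hF, indicator, hA, hx, hxh]
    rw [h3]
    by_cases hh : h ∈ Metric.ball (0 : Space N) (2 * r)
    · rw [indicator_of_mem hh]
      refine (hu.lintegral_translate_sub_le hΩ hm hAo fun x hx t ht => hB ?_).trans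
        (mul_le_mul_left ?_ _)
      · have := (convex_ball x₀ r).add_smul_sub_mem hx.1 hx.2 ht
        rwa [add_sub_cancel_left] at this
      · rw [← ofReal_norm]
        exact ENNReal.ofReal_le_ofReal (mem_ball_zero_iff.1 hh).le
    · have : A = ∅ := by
        refine eq_empty_of_forall_notMem fun x hx => hh ?_
        have h4 := dist_triangle_right (x + h) x x₀
        have h5 := Metric.mem_ball.1 hx.1
        have h6 := Metric.mem_ball.1 hx.2
        rw [mem_ball_zero_iff]
        rw [dist_self_add_left] at h4
        linarith
      simp [this]
  refine (lintegral_mono h2).trans ?_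
  rw [lintegral_indicator Metric.isOpen_ball.measurableSet, setLIntegral_const, mul_comm]

/-- The Poincaré inequality in `W^{1,1}` on a smooth bounded domain. -/
theorem IsSmoothBoundedDomain.exists_poincare (E : Type*) [NormedAddCommGroup E] [NormedSpace ℝ E]
    [CompleteSpace E] (hΩ : IsSmoothBoundedDomain Ω) :
    ∃ (B : Set (Space N)) (C : NNReal), ∀ (u : Space N → E) (g : Fin N → Space N → E),
      HasWeakPartials Ω u g → IntegrableOn u B ∧
        ∫⁻ x in Ω, ‖u x - ⨍ y in B, u y‖ₑ ≤ C * ∑ j, ∫⁻ x in Ω, ‖g j x‖ₑ := by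
  obtain ⟨x₀, hx₀⟩ := hΩ.isConnected.nonempty
  obtain ⟨r, hr, hrΩ⟩ := Metric.nhds_basis_closedBall.mem_iff.1 (hΩ.isOpen.mem_nhds hx₀)
  set B := Metric.ball x₀ r with hBdef
  have hBΩ : B ⊆ Ω := Metric.ball_subset_closedBall.trans hrΩ
  obtain ⟨C, hC⟩ := hΩ.controlledOn (E := E) hr hBΩ
  set m := volume.real B with hmdef
  set K : ℝ≥0∞ := ‖m⁻¹‖ₑ * (volume (Metric.ball (0 : Space N) (2 * r)) * ENNReal.ofReal (2 * r))
    with hK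
  have hKt : K ≠ ⊤ := ENNReal.mul_ne_top (by simp)
    (ENNReal.mul_ne_top measure_ball_lt_top.ne ENNReal.ofReal_ne_top)
  have hBvol : volume B ≠ 0 := (Metric.measure_ball_pos volume x₀ hr).ne'
  have hm0 : m ≠ 0 := by
    rw [hmdef, Measure.real, ENNReal.toReal_ne_zero]
    exact ⟨hBvol, measure_ball_lt_top.ne⟩
  -- K bounds the deviation from the mean on the ball B; the summand 1 is the gradient term in the
  -- control of Ω by B.
  refine ⟨B, C * (K.toNNReal + 1), fun u g hu => ?_⟩
  have hint : ∀ v : Space N → E, LocallyIntegrableOn v Ω → IntegrableOn v B := fun v hv =>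
    (hv.integrableOn_compact_subset hrΩ (isCompact_closedBall _ _)).mono_set
      Metric.ball_subset_closedBall
  refine ⟨hint u hu.loc, ?_⟩
  have huae := hu.loc.aestronglyMeasurable
  set v := huae.mk u with hv
  have hvm : StronglyMeasurable v := huae.stronglyMeasurable_mk
  have huv : u =ᵐ[volume.restrict Ω] v := huae.ae_eq_mk
  have hvp : HasWeakPartials Ω v g := hu.congr hΩ.isOpen huv fun _ => EventuallyEq.rfl
  have hvi := hint v hvp.loc
  have havg : ⨍ y in B, u y = ⨍ y in B, v y :=
    average_congr (ae_mono (Measure.restrict_mono hBΩ le_rfl) huv)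
  set c := ⨍ y in B, v y with hc
  set G := ∑ j, ∫⁻ x in Ω, ‖g j x‖ₑ with hG
  have h1 : ∫⁻ x in Ω, ‖u x - c‖ₑ = ∫⁻ x in Ω, ‖v x - c‖ₑ :=
    lintegral_congr_ae (by filter_upwards [huv] with x hx; rw [hx])
  have hcp : HasWeakPartials Ω (fun x => v x - c) g := by
    have := hvp.sub (HasWeakPartials.of_contDiff Ω (contDiff_const (c := c)))
    simpa using this
  have h2 := hC _ g hcp (hvm.sub stronglyMeasurable_const)
  have h3 : ∫⁻ x in B, ‖v x - c‖ₑ ≤ K * G := by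
    have h4 : ∀ x, ‖v x - c‖ₑ ≤ ‖m⁻¹‖ₑ * ∫⁻ y in B, ‖v y - v x‖ₑ := by
      intro x
      have h5 : v x - c = m⁻¹ • ∫ y in B, (v x - v y) := by
        have h6 : IntegrableOn (fun _ => v x) B := integrableOn_const measure_ball_lt_top.ne
        rw [integral_sub h6 hvi, setIntegral_const,
          smul_sub, smul_smul, inv_mul_cancel₀ hm0, one_smul, hc, setAverage_eq]
      rw [h5, enorm_smul]
      refine mul_le_mul_right ((enorm_integral_le_lintegral_enorm _).trans (le_of_eq ?_)) _
      exact lintegral_congr fun y => enorm_sub_rev _ _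
    refine (lintegral_mono h4).trans ?_
    rw [lintegral_const_mul' _ _ (by simp), hK, mul_assoc, mul_assoc]
    exact mul_le_mul_right (hvp.lintegral_ball_sub_le hΩ.isOpen hvm hBΩ) _
  rw [havg, h1]
  refine h2.trans ?_
  rw [ENNReal.coe_mul, ENNReal.coe_add, ENNReal.coe_toNNReal hKt, mul_assoc, add_mul,
    ENNReal.coe_one, one_mul]
  exact mul_le_mul_right (add_le_add h3 le_rfl) _

/-- By Poincaré a circle map with zero gradient is a constant c; necessarily |c| = 1, and u =
e^{i(arg c − φ)}. -/
theorem mem_liftable_of_isCircleMap_zero (hΩ : IsSmoothBoundedDomain Ω) {u : Space N → ℂ}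
    {φ : Space N → ℝ} (hu : u ∈ W11Circle Ω) (hφ : MemW11 Ω φ)
    (h : IsCircleMap Ω (fun x => u x * Complex.exp (Complex.I * φ x)) 0) : u ∈ liftable Ω := by
  have hfin : volume Ω ≠ ⊤ := hΩ.isBounded.measure_lt_top.ne
  obtain ⟨B, C, hC⟩ := hΩ.exists_poincare ℂ
  have h1 := (hC _ _ h.partials).2
  set c := ⨍ y in B, u y * Complex.exp (Complex.I * φ y)
  have h2 : ∫⁻ x in Ω, ‖u x * Complex.exp (Complex.I * φ x) - c‖ₑ = 0 := by
    simpa using h1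
  have hm : AEMeasurable (fun x => ‖u x * Complex.exp (Complex.I * φ x) - c‖ₑ)
      (volume.restrict Ω) :=
    (h.partials.loc.aestronglyMeasurable.sub aestronglyMeasurable_const).enorm
  rw [lintegral_eq_zero_iff' hm] at h2
  have hne : (ae (volume.restrict Ω)).NeBot := by
    rw [ae_neBot, ne_eq, Measure.restrict_eq_zero]
    exact (hΩ.isOpen.measure_pos volume hΩ.isConnected.nonempty).ne'
  have hc : ‖c‖ = 1 := by
    obtain ⟨x, h3, h4⟩ := (h2.and h.norm_eq).exists
    simp only [Pi.zero_apply, enorm_eq_zero, sub_eq_zero] at h3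
    rw [← h3, h4]
  refine ⟨hu, _, hφ.neg'.add' (memW11_const hfin c.arg), ?_⟩
  filter_upwards [h2] with x h3
  simp only [Pi.zero_apply, enorm_eq_zero, sub_eq_zero] at h3
  have h5 : c = Complex.exp (Complex.I * c.arg) := by
    conv_lhs => rw [← Complex.norm_mul_exp_arg_mul_I c, hc]
    simp [mul_comm]
  push_cast
  rw [mul_add, Complex.exp_add, ← h5, ← h3, mul_neg, Complex.exp_neg]
  field_simp

/-- A minimising sequence of phases has gradients tending to −a in L¹. Normalised to mean zero on B,
the phases are Cauchy in L¹ by Poincaré, and their limit θ has ∇θ = −a, so u e^{iθ} has zero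
gradient. -/
theorem mem_liftable_of_Sig_eq_zero (hΩ : IsSmoothBoundedDomain Ω) {u : Space N → ℂ}
    (hu : u ∈ W11Circle Ω) (h : Sig Ω u = 0) : u ∈ liftable Ω := by
  have hfin : volume Ω ≠ ⊤ := hΩ.isBounded.measure_lt_top.ne
  obtain ⟨a, ha⟩ := exists_isCircleMap hΩ.isOpen hu
  obtain ⟨B, C, hC⟩ := hΩ.exists_poincare ℝ
  -- Geometric decay, because the completeness criterion for L¹ asks for summable bounds.
  set ε : ℕ → ℝ≥0∞ := fun n => 2⁻¹ ^ n with hε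
  have hε0 : ∀ n, 0 < ε n := fun n => ENNReal.pow_pos (by simp) n
  have hεt : ∀ n, ε n ≠ ⊤ := fun n => ENNReal.pow_ne_top (by simp)
  have hεm : ∀ {k n}, k ≤ n → ε n ≤ ε k := fun hkn =>
    pow_le_pow_of_le_one bot_le (by simp) hkn
  have hφ : ∀ n : ℕ, ∃ (φ : Space N → ℝ) (b : Space N → EuclideanSpace ℝ (Fin N)),
      IntegrableOn φ Ω ∧ (HasWeakPartials Ω φ fun j x => b x j) ∧ IntegrableOn b Ω ∧
      ∫⁻ x in Ω, ‖a x + b x‖ₑ ≤ ε n := by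
    intro n
    have h1 : Sig Ω u < ε n := by rw [h]; exact hε0 n
    simp only [Sig, iInf_lt_iff] at h1
    obtain ⟨φ, hφ, h1⟩ := h1
    obtain ⟨hi, b, hb, hbi⟩ := memW11_iff.1 hφ.neg'
    refine ⟨_, b, hi, hb, hbi, ?_⟩
    rw [← (ha.mul_exp hΩ.isOpen hb hbi).gradEnergy_eq hΩ.isOpen]
    simpa using h1.le
  choose φ b hφi hb hbi hab using hφ
  set ψ : ℕ → Space N → ℝ := fun n x => φ n x - ⨍ y in B, φ n y with hψ
  have hψi : ∀ n, IntegrableOn (ψ n) Ω := fun n => (hφi n).sub (integrableOn_const hfin)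
  have hψb : ∀ n, HasWeakPartials Ω (ψ n) fun j x => b n x j := fun n => by
    simpa using (hb n).sub (HasWeakPartials.of_contDiff Ω (contDiff_const (c := ⨍ y in B, φ n y)))
  have hdiff : ∀ k n m, k ≤ n → k ≤ m →
      ∫⁻ x in Ω, ‖ψ n x - ψ m x‖ₑ ≤ C * (N * (2 * ε k)) := by
    intro k n m hn hm
    have h1 := (hC _ _ ((hb n).sub (hb m))).2
    have h2 : ⨍ y in B, (φ n y - φ m y) = (⨍ y in B, φ n y) - ⨍ y in B, φ m y := by
      rw [setAverage_eq, setAverage_eq, setAverage_eq,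
        integral_sub (hC _ _ (hb n)).1 (hC _ _ (hb m)).1, smul_sub]
    rw [h2] at h1
    have h3 : ∀ j, ∫⁻ x in Ω, ‖b n x j - b m x j‖ₑ ≤ 2 * ε k := by
      intro j
      have h4 : ∀ x, ‖b n x j - b m x j‖ₑ ≤ ‖a x + b n x‖ₑ + ‖a x + b m x‖ₑ := fun x => by
        have h5 : ‖b n x j - b m x j‖ₑ ≤ ‖(a x + b n x) - (a x + b m x)‖ₑ := by
          rw [add_sub_add_left_eq_sub, ← ofReal_norm, ← ofReal_norm]
          exact ENNReal.ofReal_le_ofReal (PiLp.norm_apply_le (b n x - b m x) j)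
        exact h5.trans enorm_sub_le
      refine (lintegral_mono h4).trans ?_
      have hae : AEMeasurable (fun x => ‖a x + b n x‖ₑ) (volume.restrict Ω) :=
        (ha.integrable.1.add (hbi n).1).enorm
      rw [lintegral_add_left' hae, two_mul]
      exact add_le_add ((hab n).trans (hεm hn)) ((hab m).trans (hεm hm))
    calc ∫⁻ x in Ω, ‖ψ n x - ψ m x‖ₑ
        = ∫⁻ x in Ω, ‖φ n x - φ m x - ((⨍ y in B, φ n y) - ⨍ y in B, φ m y)‖ₑ :=
          lintegral_congr fun x => by simp only [hψ]; congr 1; ring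
      _ ≤ _ := h1
      _ ≤ C * ∑ _j : Fin N, 2 * ε k := mul_le_mul_right (Finset.sum_le_sum fun j _ => h3 j) _
      _ = _ := by simp
  have hDt : ∀ k, (C : ℝ≥0∞) * (N * (2 * ε k)) ≠ ⊤ := fun k =>
    ENNReal.mul_ne_top (by simp)
        (ENNReal.mul_ne_top (by simp) (ENNReal.mul_ne_top (by simp) (hεt k)))
  obtain ⟨θ, hθ, hlim⟩ := Lp.cauchy_complete_eLpNorm (μ := volume.restrict Ω) (p := 1) le_rfl
    (f := ψ) (fun n => memLp_one_iff_integrable.2 (hψi n))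
    -- The extra ε k turns the Poincaré bound into the strict inequality that the criterion demands.
    (B := fun k => (C : ℝ≥0∞) * (N * (2 * ε k)) + ε k)
    (by
      rw [ENNReal.tsum_add, ENNReal.tsum_mul_left, ENNReal.tsum_mul_left, ENNReal.tsum_mul_left,
        hε, ENNReal.tsum_geometric]
      simp [ENNReal.mul_eq_top])
    (fun k n m hn hm => by
      rw [eLpNorm_one_eq_lintegral_enorm]
      exact (hdiff k n m hn hm).trans_lt (ENNReal.lt_add_right (hDt k) (hε0 k).ne'))
  have hθi : IntegrableOn θ Ω := memLp_one_iff_integrable.1 hθ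
  have hθp : HasWeakPartials Ω θ fun j x => (-a x) j := by
    refine HasWeakPartials.of_tendsto hθi.locallyIntegrableOn
      (fun j => ha.integrable.neg.locallyIntegrableOn.clm_comp
        (EuclideanSpace.proj j : EuclideanSpace ℝ (Fin N) →L[ℝ] ℝ)) fun K hKΩ _ =>
            ⟨ψ, fun n j x => b n x j, hψb, ?_,
        fun j => ?_⟩
    · refine tendsto_of_tendsto_of_tendsto_of_le_of_le tendsto_const_nhds hlim
        (fun _ => bot_le) fun n => ?_
      rw [eLpNorm_one_eq_lintegral_enorm]
      exact lintegral_mono_set hKΩ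
    · refine tendsto_of_tendsto_of_tendsto_of_le_of_le tendsto_const_nhds
        (ENNReal.tendsto_pow_atTop_nhds_zero_of_lt_one (r := 2⁻¹) (by simp)) (fun _ => bot_le)
        fun n => ?_
      refine (lintegral_mono_set hKΩ).trans (le_trans (lintegral_mono fun x => ?_) (hab n))
      rw [← ofReal_norm, ← ofReal_norm]
      refine ENNReal.ofReal_le_ofReal ((le_of_eq ?_).trans (PiLp.norm_apply_le (a x + b n x) j))
      congr 1
      simp [add_comm]
  refine mem_liftable_of_isCircleMap_zero hΩ hu
    (memW11_iff.2 ⟨hθi, fun x => -a x, hθp, ha.integrable.neg⟩) ?_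
  have := ha.mul_exp hΩ.isOpen hθp ha.integrable.neg
  simp only [add_neg_cancel] at this
  exact this

end Poincare

/-! ### Integrability of the vortex singularity -/

section Vortex

variable {N : ℕ} {Ω : Set (Space N)}

/-- One weight plays both roles in a product majorant: |t|^{−1/2} in the two singular coordinates,
and at least 1 in all the others. -/
theorem exists_integrable_weight (R : ℝ) : ∃ w : ℝ → ℝ, Integrable w ∧
    ∀ t, |t| ≤ R → 1 ≤ w t ∧ |t| ^ (-(1 / 2) : ℝ) ≤ w t := by
  set h : ℝ → ℝ := (Icc 0 R).indicator fun t => t ^ (-(1 / 2) : ℝ) with hh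
  have hi : Integrable h := by
    rw [hh, integrable_indicator_iff measurableSet_Icc, integrableOn_Icc_iff_integrableOn_Ioc]
    exact (intervalIntegral.intervalIntegrable_rpow' (a := 0) (b := R) (by norm_num)).1
  have hnn : ∀ t, 0 ≤ h t := fun t => indicator_nonneg (fun s hs => Real.rpow_nonneg hs.1 _) t
  set c : ℝ → ℝ := (Icc (-R) R).indicator fun _ => 1 with hc
  have hci : Integrable c := by
    rw [hc, integrable_indicator_iff measurableSet_Icc]
    exact integrableOn_const (by simp)
  refine ⟨fun t => c t + (h t + h (-t)), hci.add (hi.add hi.comp_neg), fun t ht => ?_⟩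
  have h1 : c t = 1 := indicator_of_mem (s := Icc (-R) R) (abs_le.1 ht) _
  have h2 := hnn t
  have h3 := hnn (-t)
  refine ⟨by linarith, ?_⟩
  rcases le_total 0 t with h0 | h0
  · rw [abs_of_nonneg h0] at ht ⊢
    have : h t = t ^ (-(1 / 2) : ℝ) := indicator_of_mem (s := Icc 0 R) ⟨h0, ht⟩ _
    linarith
  · rw [abs_of_nonpos h0] at ht ⊢
    have : h (-t) = (-t) ^ (-(1 / 2) : ℝ) := indicator_of_mem (s := Icc 0 R) ⟨by linarith, ht⟩ _
    linarith

/-- The complex coordinate `xᵢ + i xⱼ`. -/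
def planarCLM (i j : Fin N) : Space N →L[ℝ] ℂ :=
  Complex.ofRealCLM.comp (EuclideanSpace.proj i) +
    Complex.I • Complex.ofRealCLM.comp (EuclideanSpace.proj j)

theorem planarCLM_re (i j : Fin N) (x : Space N) : (planarCLM i j x).re = x i := by
  simp [planarCLM]

theorem planarCLM_im (i j : Fin N) (x : Space N) : (planarCLM i j x).im = x j := by
  simp [planarCLM]

/-- Giving half of the exponent to each coordinate separates the variables, and |t|^{−1/2} is
locally integrable on the line. -/
theorem inv_norm_le_rpow_mul_rpow (z : ℂ) (h : z.re ≠ 0) (h' : z.im ≠ 0) :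
    ‖z‖⁻¹ ≤ |z.re| ^ (-(1 / 2) : ℝ) * |z.im| ^ (-(1 / 2) : ℝ) := by
  have h1 : 0 < |z.re| := abs_pos.2 h
  have h2 : 0 < |z.im| := abs_pos.2 h'
  have h3 : 0 < ‖z‖ := h1.trans_le (Complex.abs_re_le_norm z)
  have h4 : ‖z‖⁻¹ = ‖z‖ ^ (-(1 / 2) : ℝ) * ‖z‖ ^ (-(1 / 2) : ℝ) := by
    rw [← Real.rpow_add h3, ← Real.rpow_neg_one]; norm_num
  rw [h4]
  exact mul_le_mul (Real.rpow_le_rpow_of_nonpos h1 (Complex.abs_re_le_norm z) (by norm_num))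
    (Real.rpow_le_rpow_of_nonpos h2 (Complex.abs_im_le_norm z) (by norm_num))
    (by positivity) (by positivity)

theorem ae_apply_ne (i : Fin N) (c : ℝ) : ∀ᵐ x : Space N, x i ≠ c := by
  have h := Measure.pi_hyperplane (fun _ : Fin N => (volume : Measure ℝ)) i c
  rw [← volume_pi] at h
  have h1 := (PiLp.volume_preserving_ofLp (Fin N)).quasiMeasurePreserving.preimage_null h
  rw [ae_iff]
  simpa using h1

theorem integrableOn_inv_norm_planarCLM (hb : Bornology.IsBounded Ω) {i j : Fin N} (hij : i ≠ j)
    (p : Space N) : IntegrableOn (fun x => ‖planarCLM i j (x - p)‖⁻¹) Ω := by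
  obtain ⟨R, hR⟩ := hb.subset_closedBall p
  obtain ⟨w, hw, hwR⟩ := exists_integrable_weight R
  have h1 : Integrable fun x : Fin N → ℝ => ∏ k, w (x k - p k) :=
    Integrable.fintype_prod fun k => hw.comp_sub_right (p k)
  have h2 : Integrable fun x : Space N => ∏ k, w (x k - p k) :=
    (PiLp.volume_preserving_ofLp (Fin N)).integrable_comp_of_integrable h1
  have hm : Continuous fun x : Space N => planarCLM i j (x - p) := by fun_prop
  have hm' : Measurable fun x : Space N => ‖planarCLM i j (x - p)‖⁻¹ := hm.norm.measurable.inv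
  have hM : IntegrableOn (fun x => ‖planarCLM i j (x - p)‖⁻¹) (Metric.closedBall p R) := by
    refine Integrable.mono' h2.integrableOn hm'.aestronglyMeasurable ?_
    refine (ae_restrict_iff' measurableSet_closedBall).2 ?_
    filter_upwards [ae_apply_ne i (p i), ae_apply_ne j (p j)] with x hi hj hx
    rw [Real.norm_of_nonneg (by positivity)]
    have hk : ∀ k, |x k - p k| ≤ R := fun k => by
      rw [Metric.mem_closedBall, dist_eq_norm] at hx
      exact (PiLp.norm_apply_le (x - p) k).trans hx
    have hz := inv_norm_le_rpow_mul_rpow (planarCLM i j (x - p))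
      (by rw [planarCLM_re]; exact sub_ne_zero.2 hi) (by rw [planarCLM_im]; exact sub_ne_zero.2 hj)
    rw [planarCLM_re, planarCLM_im] at hz
    refine hz.trans ?_
    have h3 : w (x i - p i) * w (x j - p j) ≤ ∏ k, w (x k - p k) := by
      calc w (x i - p i) * w (x j - p j)
          = ∏ k, ((if k = i then w (x k - p k) else 1) * (if k = j then w (x k - p k) else 1)) := by
            rw [Finset.prod_mul_distrib]; simp
        _ ≤ _ := by
            refine Finset.prod_le_prod (fun k _ => ?_) fun k _ => ?_
            · have := (hwR _ (hk k)).1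
              split_ifs <;> positivity
            · have := (hwR _ (hk k)).1
              by_cases h4 : k = i
              · simp [h4, hij]
              · simp only [h4, if_false, one_mul]
                split_ifs
                · exact le_rfl
                · exact this
    exact (mul_le_mul (hwR _ (hk i)).2 (hwR _ (hk j)).2 (by positivity)
      (zero_le_one.trans (hwR _ (hk i)).1)).trans h3
  exact hM.mono_set hR

end Vortex

/-! ### The vortex as a circle map -/

section VortexMap

variable {N : ℕ} {Ω : Set (Space N)}

/-- The derivative of `z ↦ z / √(|z|² + s)` in the direction `ζ`. -/
def regDeriv (s : ℝ) (z ζ : ℂ) : ℂ :=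
  ((√(‖z‖ ^ 2 + s))⁻¹ : ℝ) * ζ - (((conj z * ζ).re * (√(‖z‖ ^ 2 + s))⁻¹ ^ 3 : ℝ) : ℂ) * z

theorem hasDerivAt_regularized {s : ℝ} (hs : 0 < s) (z ζ : ℂ) :
    HasDerivAt (fun t : ℝ => (((√(‖z + t * ζ‖ ^ 2 + s))⁻¹ : ℝ) : ℂ) * (z + t * ζ))
      (regDeriv s z ζ) 0 := by
  have h1 : HasDerivAt (fun t : ℝ => z + t * ζ) ζ 0 := by
    simpa using ((Complex.ofRealCLM.hasDerivAt (x := (0 : ℝ))).mul_const ζ).const_add z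
  have h2 : HasDerivAt (fun t : ℝ => ‖z + t * ζ‖ ^ 2 + s) (2 * (conj z * ζ).re) 0 := by
    have e : (fun t : ℝ => ‖z + t * ζ‖ ^ 2 + s)
        = fun t : ℝ => (z.re + t * ζ.re) ^ 2 + (z.im + t * ζ.im) ^ 2 + s := by
      funext t
      rw [← Complex.normSq_eq_norm_sq, Complex.normSq_apply]
      simp
      ring
    rw [e]
    have h3 : ∀ a b : ℝ, HasDerivAt (fun t : ℝ => (a + t * b) ^ 2) (2 * (a * b)) 0 := fun a b => by
      have := (((hasDerivAt_id' (0 : ℝ)).mul_const b).const_add a).fun_pow 2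
      simpa [mul_assoc] using this
    refine (((h3 z.re ζ.re).fun_add (h3 z.im ζ.im)).add_const s).congr_deriv ?_
    rw [Complex.mul_re, Complex.conj_re, Complex.conj_im]
    ring
  have hq : ‖z + ((0 : ℝ) : ℂ) * ζ‖ ^ 2 + s ≠ 0 := by positivity
  have h4 := (h2.sqrt hq).inv (Real.sqrt_ne_zero'.2 (by positivity))
  refine (h4.ofReal_comp.fun_mul h1).congr_deriv ?_
  have hq' : √(‖z‖ ^ 2 + s) ≠ 0 := Real.sqrt_ne_zero'.2 (by positivity)
  simp only [regDeriv, Complex.ofReal_zero, zero_mul, add_zero]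
  rw [add_comm, sub_eq_add_neg, ← neg_mul]
  simp only [Pi.inv_apply, Complex.ofReal_zero, zero_mul, add_zero]
  congr 2
  rw [← Complex.ofReal_neg]
  congr 1
  field_simp

theorem contDiff_regularized (L : Space N →L[ℝ] ℂ) (p : Space N) {s : ℝ} (hs : 0 < s) :
    ContDiff ℝ 1 fun x => (((√(‖L (x - p)‖ ^ 2 + s))⁻¹ : ℝ) : ℂ) * L (x - p) := by
  have h1 : ContDiff ℝ 1 fun x : Space N => L (x - p) :=
    L.contDiff.comp (contDiff_id.sub contDiff_const)
  have h2 : ContDiff ℝ 1 fun x : Space N => ‖L (x - p)‖ ^ 2 + s := (h1.norm_sq ℝ).add contDiff_const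
  exact (Complex.ofRealCLM.contDiff.comp ((h2.sqrt fun x => by positivity).inv
    fun x => Real.sqrt_ne_zero'.2 (by positivity))).mul h1

theorem fderiv_regularized (L : Space N →L[ℝ] ℂ) (p : Space N) {s : ℝ} (hs : 0 < s) (x e : Space N)
    :
    fderiv ℝ (fun x => (((√(‖L (x - p)‖ ^ 2 + s))⁻¹ : ℝ) : ℂ) * L (x - p)) x e
      = regDeriv s (L (x - p)) (L e) := by
  have h1 : HasDerivAt (fun t : ℝ => x + t • e) e 0 := by
    simpa using ((hasDerivAt_id (0 : ℝ)).smul_const e).const_add x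
  have h2 := (((contDiff_regularized L p hs).differentiable (by simp))
      (x + (0 : ℝ) • e)).hasFDerivAt
    |>.comp_hasDerivAt (0 : ℝ) h1
  rw [zero_smul, add_zero] at h2
  refine h2.unique ?_
  have h3 : ∀ t : ℝ, L (x + t • e - p) = L (x - p) + t * L e := fun t => by
    rw [add_sub_right_comm, map_add, map_smul, Complex.real_smul]
  have h4 := hasDerivAt_regularized hs (L (x - p)) (L e)
  simp only [← h3] at h4
  exact h4

/-- Uniform in s, so |z|⁻¹ dominates all the regularised gradients. -/
theorem norm_regDeriv_le {s : ℝ} (hs : 0 ≤ s) {z : ℂ} (hz : z ≠ 0) (ζ : ℂ) :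
    ‖regDeriv s z ζ‖ ≤ 2 * ‖ζ‖ * ‖z‖⁻¹ := by
  have hr : 0 < ‖z‖ := norm_pos_iff.2 hz
  set q := √(‖z‖ ^ 2 + s) with hq
  have hrq : ‖z‖ ≤ q := Real.le_sqrt_of_sq_le (by linarith)
  have hq0 : 0 < q := hr.trans_le hrq
  have h1 : q⁻¹ ≤ ‖z‖⁻¹ := inv_anti₀ hr hrq
  refine (norm_sub_le _ _).trans ?_
  rw [norm_mul, norm_mul, Complex.norm_real, Complex.norm_real, Real.norm_eq_abs, Real.norm_eq_abs,
    abs_mul, abs_of_pos (inv_pos.2 hq0), abs_of_pos (pow_pos (inv_pos.2 hq0) 3)]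
  have h2 : |(conj z * ζ).re| ≤ ‖z‖ * ‖ζ‖ := by
    refine (Complex.abs_re_le_norm _).trans (le_of_eq ?_)
    rw [norm_mul, RCLike.norm_conj]
  have h3 : |(conj z * ζ).re| * q⁻¹ ^ 3 * ‖z‖ ≤ (‖z‖ * ‖ζ‖) * ‖z‖⁻¹ ^ 3 * ‖z‖ := by
    gcongr
  have h4 : (‖z‖ * ‖ζ‖) * ‖z‖⁻¹ ^ 3 * ‖z‖ = ‖ζ‖ * ‖z‖⁻¹ := by field_simp
  have h5 : q⁻¹ * ‖ζ‖ ≤ ‖ζ‖ * ‖z‖⁻¹ := by rw [mul_comm]; gcongr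
  linarith

/-- In the limit z/|z| only the angular part of ζ, read off from Im(z̄ζ), survives; the radial part
cancels. -/
theorem regDeriv_zero {z : ℂ} (hz : z ≠ 0) (ζ : ℂ) :
    regDeriv 0 z ζ = Complex.I * ((‖z‖⁻¹ : ℝ) * z) * ((‖z‖⁻¹ ^ 2 * (conj z * ζ).im : ℝ) : ℂ) := by
  have hr : (‖z‖ : ℂ) ≠ 0 := by simpa using hz
  have h1 : z * conj z = (‖z‖ : ℂ) ^ 2 := by
    rw [Complex.mul_conj, Complex.normSq_eq_norm_sq]; push_cast; rfl
  have h2 : (((conj z * ζ).re : ℝ) : ℂ) + ((conj z * ζ).im : ℝ) * Complex.I = conj z * ζ :=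
    Complex.re_add_im _
  have h3 : z * (((conj z * ζ).re : ℝ) : ℂ) + z * (((conj z * ζ).im : ℝ) * Complex.I)
      = (‖z‖ : ℂ) ^ 2 * ζ := by
    rw [← mul_add, h2, ← mul_assoc, h1]
  rw [regDeriv, add_zero, Real.sqrt_sq (norm_nonneg z)]
  push_cast
  generalize (((conj z * ζ).re : ℝ) : ℂ) = a at *
  generalize (((conj z * ζ).im : ℝ) : ℂ) = b at *
  field_simp
  linear_combination -h3

theorem tendsto_regDeriv {z : ℂ} (hz : z ≠ 0) (ζ : ℂ) {s : ℕ → ℝ} (hs : Tendsto s atTop (𝓝 0)) :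
    Tendsto (fun n => regDeriv (s n) z ζ) atTop (𝓝 (regDeriv 0 z ζ)) := by
  have hr : 0 < ‖z‖ := norm_pos_iff.2 hz
  have h1 : ContinuousAt (fun s : ℝ => (√(‖z‖ ^ 2 + s))⁻¹) 0 := by
    refine ContinuousAt.inv₀ (by fun_prop) (Real.sqrt_ne_zero'.2 (by positivity))
  have h2 : ContinuousAt (fun s : ℝ => regDeriv s z ζ) 0 := by
    unfold regDeriv
    fun_prop
  exact h2.tendsto.comp hs

/-- The angular gradient of `L (x - p)`. -/
def vortexAngle (L : Space N →L[ℝ] ℂ) (p x : Space N) : EuclideanSpace ℝ (Fin N) :=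
  WithLp.toLp 2 fun k =>
    ‖L (x - p)‖⁻¹ ^ 2 * (conj (L (x - p)) * L (EuclideanSpace.single k 1)).im

/-- Approximate z/|z| by the C¹ maps z/√(|z|² + s), s → 0. Integrability of |z|⁻¹ allows dominated
convergence of the gradients, so the singular set contributes nothing to the weak gradient. -/
theorem isCircleMap_vortex {L : Space N →L[ℝ] ℂ} {p : Space N} (hfin : volume Ω ≠ ⊤)
    (hne : ∀ᵐ x : Space N, L (x - p) ≠ 0) (hi : IntegrableOn (fun x => ‖L (x - p)‖⁻¹) Ω) :
    IsCircleMap Ω (fun x => ((‖L (x - p)‖⁻¹ : ℝ) : ℂ) * L (x - p)) (vortexAngle L p) := by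
  have hfinite : IsFiniteMeasure ((volume : Measure (Space N)).restrict Ω) :=
    ⟨by simpa using hfin.lt_top⟩
  have hLc : Continuous fun x : Space N => L (x - p) := by fun_prop
  have hLm : Measurable fun x : Space N => L (x - p) := hLc.measurable
  have hneΩ : ∀ S : Set (Space N), ∀ᵐ x ∂(volume.restrict S), L (x - p) ≠ 0 :=
    fun S => ae_restrict_of_ae hne
  have hum : Measurable fun x => ((‖L (x - p)‖⁻¹ : ℝ) : ℂ) * L (x - p) := by fun_prop
  have hunit : ∀ x, L (x - p) ≠ 0 → ‖((‖L (x - p)‖⁻¹ : ℝ) : ℂ) * L (x - p)‖ = 1 := fun x hx => by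
    rw [norm_mul, Complex.norm_real, norm_inv, norm_norm, inv_mul_cancel₀ (norm_ne_zero_iff.2 hx)]
  have ham : ∀ k, Measurable fun x => vortexAngle L p x k := fun k => by
    simp only [vortexAngle]
    have : Measurable fun x => conj (L (x - p)) * L (EuclideanSpace.single k 1) :=
      ((Complex.continuous_conj.comp hLc).mul continuous_const).measurable
    exact (hLm.norm.inv.pow_const 2).mul (Complex.measurable_im.comp this)
  have hab : ∀ k x, L (x - p) ≠ 0 → |vortexAngle L p x k|
      ≤ ‖L (EuclideanSpace.single k 1)‖ * ‖L (x - p)‖⁻¹ := fun k x hx => by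
    simp only [vortexAngle]
    have hr : 0 < ‖L (x - p)‖ := norm_pos_iff.2 hx
    rw [abs_mul, abs_of_nonneg (by positivity)]
    have h1 := Complex.abs_im_le_norm (conj (L (x - p)) * L (EuclideanSpace.single k 1))
    rw [norm_mul, RCLike.norm_conj] at h1
    refine (mul_le_mul_of_nonneg_left h1 (by positivity)).trans (le_of_eq ?_)
    field_simp
  have hai : ∀ k, IntegrableOn (fun x => vortexAngle L p x k) Ω := fun k => by
    refine Integrable.mono' (hi.const_mul ‖L (EuclideanSpace.single k 1)‖)
      (ham k).aestronglyMeasurable ?_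
    filter_upwards [hneΩ Ω] with x hx
    exact hab k x hx
  have hui : IntegrableOn (fun x => ((‖L (x - p)‖⁻¹ : ℝ) : ℂ) * L (x - p)) Ω := by
    refine Integrable.of_bound hum.aestronglyMeasurable 1 ?_
    filter_upwards [hneΩ Ω] with x hx
    exact (hunit x hx).le
  have hpi : ∀ k, IntegrableOn (fun x => Complex.I * (((‖L (x - p)‖⁻¹ : ℝ) : ℂ) * L (x - p)) *
      ((vortexAngle L p x k : ℝ) : ℂ)) Ω := fun k => by
    refine Integrable.bdd_mul (c := 1) (hai k).ofReal (hum.const_mul _).aestronglyMeasurable ?_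
    filter_upwards [hneΩ Ω] with x hx
    rw [norm_mul, Complex.norm_I, hunit x hx, one_mul]
  refine ⟨?_, ?_, ?_⟩
  · filter_upwards [hneΩ Ω] with x hx
    exact hunit x hx
  swap
  · exact integrableOn_toLp hai
  set s : ℕ → ℝ := fun n => 1 / ((n : ℝ) + 1) with hs
  have hs0 : ∀ n, 0 < s n := fun n => by positivity
  have hst : Tendsto s atTop (𝓝 0) := tendsto_one_div_add_atTop_nhds_zero_nat
  refine HasWeakPartials.of_tendsto hui.locallyIntegrableOn (fun k => (hpi k).locallyIntegrableOn)
    fun K hKΩ hK => ⟨fun n x => (((√(‖L (x - p)‖ ^ 2 + s n))⁻¹ : ℝ) : ℂ) * L (x - p),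
      fun n k x => regDeriv (s n) (L (x - p)) (L (EuclideanSpace.single k 1)), fun n => ?_, ?_,
      fun k => ?_⟩
  · have := HasWeakPartials.of_contDiff Ω (contDiff_regularized L p (hs0 n))
    simpa only [fderiv_regularized L p (hs0 n)] using this
  · have hKfin : volume K ≠ ⊤ := hK.measure_lt_top.ne
    have h0 : (0 : ℝ≥0∞) = ∫⁻ x in K, 0 := by simp
    rw [h0]
    refine tendsto_lintegral_of_dominated_convergence' (fun _ => 2) (fun n => ?_) (fun n => ?_) ?_
        ?_
    · exact (((contDiff_regularized L p (hs0 n)).continuous.measurable).sub hum).enorm.aemeasurable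
    · filter_upwards [hneΩ K] with x hx
      refine enorm_sub_le.trans ?_
      have h1 : ‖(((√(‖L (x - p)‖ ^ 2 + s n))⁻¹ : ℝ) : ℂ) * L (x - p)‖ ≤ 1 := by
        have h2 : ‖L (x - p)‖ ≤ √(‖L (x - p)‖ ^ 2 + s n) :=
          Real.le_sqrt_of_sq_le (by linarith [hs0 n])
        rw [norm_mul, Complex.norm_real, Real.norm_of_nonneg (by positivity), inv_mul_le_iff₀
          ((norm_pos_iff.2 hx).trans_le h2), mul_one]
        exact h2
      rw [← ofReal_norm, ← ofReal_norm, hunit x hx]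
      refine (add_le_add (ENNReal.ofReal_le_ofReal h1) le_rfl).trans (le_of_eq ?_)
      rw [ENNReal.ofReal_one]; norm_num
    · simpa using ENNReal.mul_ne_top (by simp) hKfin
    · filter_upwards [hneΩ K] with x hx
      have h1 : Tendsto (fun n => (((√(‖L (x - p)‖ ^ 2 + s n))⁻¹ : ℝ) : ℂ) * L (x - p)) atTop
          (𝓝 (((‖L (x - p)‖⁻¹ : ℝ) : ℂ) * L (x - p))) := by
        have h2 : Tendsto (fun n => (√(‖L (x - p)‖ ^ 2 + s n))⁻¹) atTop (𝓝 ‖L (x - p)‖⁻¹) := by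
          have h3 : Tendsto (fun n => √(‖L (x - p)‖ ^ 2 + s n)) atTop (𝓝 ‖L (x - p)‖) := by
            have := (Real.continuous_sqrt.tendsto _).comp (hst.const_add (‖L (x - p)‖ ^ 2))
            rwa [add_zero, Real.sqrt_sq (norm_nonneg _)] at this
          exact h3.inv₀ (norm_ne_zero_iff.2 hx)
        exact ((Complex.continuous_ofReal.tendsto _).comp h2).mul_const _
      simpa using (h1.sub_const (((‖L (x - p)‖⁻¹ : ℝ) : ℂ) * L (x - p))).enorm
  · have h0 : (0 : ℝ≥0∞) = ∫⁻ x in K, 0 := by simp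
    rw [h0]
    have hlim : ∀ x, L (x - p) ≠ 0 → Complex.I * (((‖L (x - p)‖⁻¹ : ℝ) : ℂ) * L (x - p)) *
        ((vortexAngle L p x k : ℝ) : ℂ)
          = regDeriv 0 (L (x - p)) (L (EuclideanSpace.single k 1)) := fun x hx => by
      rw [regDeriv_zero hx]; rfl
    refine tendsto_lintegral_of_dominated_convergence'
      (fun x => 2 * ‖2 * ‖L (EuclideanSpace.single k 1)‖ * ‖L (x - p)‖⁻¹‖ₑ)
      (fun n => ?_) (fun n => ?_) ?_ ?_
    · have h1 : Continuous fun x =>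
          regDeriv (s n) (L (x - p)) (L (EuclideanSpace.single k 1)) := by
        have := ((contDiff_regularized L p (hs0 n)).continuous_fderiv (by simp)).clm_apply
          (continuous_const (y := (EuclideanSpace.single k 1 : Space N)))
        simpa only [fderiv_regularized L p (hs0 n)] using this
      exact (h1.measurable.sub ((hum.const_mul _).mul
        (Complex.measurable_ofReal.comp (ham k)))).enorm.aemeasurable
    · filter_upwards [hneΩ K] with x hx
      rw [hlim x hx]
      refine enorm_sub_le.trans ?_
      rw [two_mul]
      have h1 : ∀ t, 0 ≤ t → ‖regDeriv t (L (x - p)) (L (EuclideanSpace.single k 1))‖ₑ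
          ≤ ‖2 * ‖L (EuclideanSpace.single k 1)‖ * ‖L (x - p)‖⁻¹‖ₑ := fun t ht => by
        rw [← ofReal_norm, ← ofReal_norm]
        exact ENNReal.ofReal_le_ofReal ((norm_regDeriv_le ht hx _).trans (le_abs_self _))
      exact add_le_add (h1 _ (hs0 n).le) (h1 _ le_rfl)
    · rw [lintegral_const_mul' _ _ (by simp)]
      exact ENNReal.mul_ne_top (by simp) ((hi.mono_set hKΩ).const_mul _).2.ne
    · filter_upwards [hneΩ K] with x hx
      rw [hlim x hx]
      simpa using ((tendsto_regDeriv hx (L (EuclideanSpace.single k 1)) hst).sub_const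
        (regDeriv 0 (L (x - p)) (L (EuclideanSpace.single k 1)))).enorm

end VortexMap

/-! ### The vortex is not liftable; values of dist and Dist -/

section NotLiftable

variable {N : ℕ} {Ω : Set (Space N)} {u₀ v₀ : Space N → ℂ}

/-- Weak partial derivatives are curl free. -/
theorem HasWeakPartials.integral_curl_eq_zero {φ : Space N → ℝ} {g : Fin N → Space N → ℝ}
    (h : HasWeakPartials Ω φ g) {η : Space N → ℝ} (hη : ContDiff ℝ ∞ η) (hc : HasCompactSupport η)
    (hs : tsupport η ⊆ Ω) (i j : Fin N) :
    ∫ x in Ω, (fderiv ℝ η x (EuclideanSpace.single j 1) * g i x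
      - fderiv ℝ η x (EuclideanSpace.single i 1) * g j x) = 0 := by
  have hd : ∀ k : Fin N, ContDiff ℝ ∞ fun x => fderiv ℝ η x (EuclideanSpace.single k 1) :=
    fun k => (hη.fderiv_right (m := ∞) (by simp)).clm_apply contDiff_const
  have hsk : ∀ k : Fin N, tsupport (fun x => fderiv ℝ η x (EuclideanSpace.single k 1))
      ⊆ tsupport η := fun k => tsupport_fderiv_apply_subset _
  have hck : ∀ k : Fin N, HasCompactSupport fun x => fderiv ℝ η x (EuclideanSpace.single k 1) :=
    fun k => hc.of_isClosed_subset (isClosed_tsupport _) (hsk k)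
  have hsymm : ∀ x, fderiv ℝ (fun x => fderiv ℝ η x (EuclideanSpace.single j 1)) x
      (EuclideanSpace.single i 1) = fderiv ℝ (fun x => fderiv ℝ η x (EuclideanSpace.single i 1)) x
      (EuclideanSpace.single j 1) := by
    intro x
    have h1 : DifferentiableAt ℝ (fderiv ℝ η) x :=
      (hη.fderiv_right (m := ∞) (by simp)).differentiable (by simp) x
    have h2 : ∀ v w : Space N, fderiv ℝ (fun x => fderiv ℝ η x v) x w
        = fderiv ℝ (fderiv ℝ η) x w v := fun v w => by
      rw [fderiv_clm_apply h1 (differentiableAt_const v)]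
      simp
    rw [h2, h2]
    exact ((contDiff_infty.1 hη 2).contDiffAt.isSymmSndFDerivAt (by simp)).eq _ _
  have e1 := h.integral_eq _ (hd j) (hck j) ((hsk j).trans hs) i
  have e2 := h.integral_eq _ (hd i) (hck i) ((hsk i).trans hs) j
  simp only [hsymm] at e1
  have e3 := neg_injective (e1.symm.trans e2)
  have hi : ∀ k l : Fin N, IntegrableOn
      (fun x => fderiv ℝ η x (EuclideanSpace.single k 1) * g l x) Ω := fun k l =>
    (integrable_smul_of_locallyIntegrableOn (h.loc_partial l) (hd k).continuous (hck k)
      ((hsk k).trans hs)).integrableOn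
  rw [integral_sub (hi j i) (hi i j), sub_eq_zero]
  exact e3

/-- A test function whose gradient is −d(x)(x − p) with d ≥ 0: paired with the angular field it
leaves exactly d. -/
theorem exists_radial_bump {p : Space N} {r : ℝ} (hr : 0 < r) :
    ∃ (η d : Space N → ℝ), ContDiff ℝ ∞ η ∧ tsupport η ⊆ Metric.closedBall p r ∧ η p = 1 ∧
      (∀ x, r ≤ ‖x - p‖ → η x = 0) ∧ Continuous d ∧ (∀ x, 0 ≤ d x) ∧
      ∀ x e, fderiv ℝ η x e = - d x * inner ℝ (x - p) e := by
  set T := Real.smoothTransition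
  have hT : ContDiff ℝ ∞ T := Real.smoothTransition.contDiff
  have hin : ContDiff ℝ ∞ fun x : Space N => 1 - ‖x - p‖ ^ 2 / r ^ 2 :=
    contDiff_const.sub (((contDiff_id.sub contDiff_const).norm_sq ℝ).div_const _)
  have h0 : ∀ x, r ≤ ‖x - p‖ → T (1 - ‖x - p‖ ^ 2 / r ^ 2) = 0 := fun x hx => by
    refine Real.smoothTransition.zero_of_nonpos ?_
    rw [sub_nonpos, le_div_iff₀ (by positivity), one_mul]
    gcongr
  refine ⟨fun x => T (1 - ‖x - p‖ ^ 2 / r ^ 2),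
    fun x => deriv T (1 - ‖x - p‖ ^ 2 / r ^ 2) * (2 / r ^ 2), hT.comp hin, ?_, ?_, h0, ?_, ?_, ?_⟩
  · refine closure_minimal (fun x hx => ?_) Metric.isClosed_closedBall
    rw [Metric.mem_closedBall, dist_eq_norm]
    by_contra! h
    exact hx (h0 x h.le)
  · simp [T]
  · exact ((hT.continuous_deriv (by simp)).comp hin.continuous).mul continuous_const
  · exact fun x => mul_nonneg Real.smoothTransition.monotone.deriv_nonneg (by positivity)
  · intro x e
    have h1 : HasFDerivAt (fun x : Space N => ‖x - p‖ ^ 2) (2 • (innerSL ℝ (x - p))) x := by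
      simpa using ((hasFDerivAt_id x).sub_const p).norm_sq
    have h2 := (((h1.mul_const (r ^ 2)⁻¹).const_sub 1))
    have h3 := (((hT.differentiable (by simp))
        (1 - ‖x - p‖ ^ 2 * (r ^ 2)⁻¹)).hasDerivAt).comp_hasFDerivAt
      x h2
    have h4 : (fun x : Space N => T (1 - ‖x - p‖ ^ 2 / r ^ 2))
        = T ∘ fun x : Space N => 1 - ‖x - p‖ ^ 2 * (r ^ 2)⁻¹ := by
      funext y; simp [div_eq_mul_inv]
    rw [h4, h3.fderiv]
    simp only [smul_neg, neg_apply, smul_apply,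
      innerSL_apply_apply, smul_eq_mul, nsmul_eq_mul, div_eq_mul_inv]
    push_cast
    ring

/-- The gradient of a lifting would be the angular field, and gradients are curl free. Tested with a
radial bump η at p, the curl equals ∫ d; hence d = 0 and η is constant, although η(p) = 1 and η
vanishes at distance r. -/
theorem vortex_notMem_liftable (hΩ : IsOpen Ω) (hfin : volume Ω ≠ ⊤) {p : Space N} (hp : p ∈ Ω)
    {i j : Fin N}
    (hi : IntegrableOn (fun x => ‖planarCLM i j (x - p)‖⁻¹) Ω) (hij : i ≠ j) :
    (fun x => ((‖planarCLM i j (x - p)‖⁻¹ : ℝ) : ℂ) * planarCLM i j (x - p)) ∉ liftable Ω := by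
  rintro ⟨-, φ, hφ, hu⟩
  obtain ⟨-, b, hb, hbi⟩ := memW11_iff.1 hφ
  have hne : ∀ᵐ x : Space N, planarCLM i j (x - p) ≠ 0 := by
    filter_upwards [ae_apply_ne i (p i)] with x hx h
    have := planarCLM_re i j (x - p)
    rw [h] at this
    exact hx (sub_eq_zero.1 this.symm)
  have hv := isCircleMap_vortex (L := planarCLM i j) hfin hne hi
  have hv' := (isCircleMap_exp hΩ hb hbi).congr hΩ hu.symm EventuallyEq.rfl
  have hab : ∀ k, (fun x => b x k) =ᵐ[volume.restrict Ω]
      fun x => vortexAngle (planarCLM i j) p x k := fun k => by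
    filter_upwards [hv'.partials.ae_eq hΩ hv.partials k, hv.norm_eq] with x h1 h2
    have h3 := mul_left_cancel₀ (mul_ne_zero Complex.I_ne_zero
      (norm_ne_zero_iff.1 (by rw [h2]; exact one_ne_zero))) h1
    exact_mod_cast h3
  have hφα := hb.congr hΩ EventuallyEq.rfl hab
  obtain ⟨r, hr, hrΩ⟩ := Metric.nhds_basis_closedBall.mem_iff.1 (hΩ.mem_nhds hp)
  obtain ⟨η, d, hη, hηs, hηp, hη0, hd, hd0, hηd⟩ := exists_radial_bump (p := p) hr
  have hηc : HasCompactSupport η :=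
    (isCompact_closedBall p r).of_isClosed_subset (isClosed_tsupport _) hηs
  have hcurl := hφα.integral_curl_eq_zero hη hηc (hηs.trans hrΩ) i j
  have hdout : ∀ x ∉ Metric.closedBall p r, d x = 0 := fun x hx => by
    have h1 : fderiv ℝ η x = 0 := by
      by_contra h
      exact hx (hηs (support_fderiv_subset ℝ h))
    have h2 := hηd x (x - p)
    rw [h1, real_inner_self_eq_norm_sq] at h2
    have h3 : ‖x - p‖ ≠ 0 := by
      rw [norm_ne_zero_iff, sub_ne_zero]
      rintro rfl
      exact hx (Metric.mem_closedBall_self hr.le)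
    simpa [h3] using h2
  have hd_int : ∫ x, d x = 0 := by
    rw [← setIntegral_eq_integral_of_forall_compl_eq_zero (s := Ω)
      fun x hx => hdout x fun h => hx (hrΩ h), ← hcurl]
    refine integral_congr_ae ?_
    filter_upwards [ae_restrict_of_ae (s := Ω) hne] with x hx
    have hx2 : ‖planarCLM i j (x - p)‖ ^ 2 = (x i - p i) ^ 2 + (x j - p j) ^ 2 := by
      rw [← Complex.normSq_eq_norm_sq, Complex.normSq_apply, planarCLM_re, planarCLM_im]
      simp; ring
    have hx3 : ‖planarCLM i j (x - p)‖ ≠ 0 := norm_ne_zero_iff.2 hx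
    have hk : ∀ k, inner ℝ (x - p) (EuclideanSpace.single k (1 : ℝ)) = x k - p k := fun k => by
      simp [EuclideanSpace.inner_single_right]
    simp only [hηd, hk, vortexAngle, Complex.mul_im, Complex.conj_re, Complex.conj_im,
      planarCLM_re, planarCLM_im]
    generalize ‖planarCLM i j (x - p)‖ = ρ at hx2 hx3
    simp [hij, hij.symm]
    field_simp
    rw [hx2]
    ring
  have hd_zero : ∀ x, d x = 0 := by
    by_contra! h
    obtain ⟨x, hx⟩ := h
    exact (hd.integral_pos_of_hasCompactSupport_nonneg_nonzero
      (HasCompactSupport.intro (isCompact_closedBall p r) hdout) hd0 hx).ne' hd_int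
  have hconst := is_const_of_fderiv_eq_zero (hη.differentiable (by simp))
    (fun x => by ext e; rw [hηd, hd_zero]; simp) p (p + EuclideanSpace.single i r)
  rw [hηp, hη0 _ (by simp [abs_of_pos hr])] at hconst
  exact one_ne_zero hconst

theorem IsSmoothBoundedDomain.exists_notMem_liftable (hΩ : IsSmoothBoundedDomain Ω) (hN : 2 ≤ N) :
    ∃ u ∈ W11Circle Ω, u ∉ liftable Ω := by
  have hfin : volume Ω ≠ ⊤ := hΩ.isBounded.measure_lt_top.ne
  obtain ⟨p, hp⟩ := hΩ.isConnected.nonempty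
  have hij : (⟨0, by omega⟩ : Fin N) ≠ ⟨1, by omega⟩ := by simp
  have hi := integrableOn_inv_norm_planarCLM hΩ.isBounded hij p
  refine ⟨_, (isCircleMap_vortex hfin ?_ hi).mem_W11Circle hfin,
    vortex_notMem_liftable hΩ.isOpen hfin hp hi hij⟩
  filter_upwards [ae_apply_ne ⟨0, by omega⟩ (p ⟨0, by omega⟩)] with x hx h
  have := planarCLM_re ⟨0, by omega⟩ ⟨1, by omega⟩ (x - p)
  rw [h] at this
  exact hx (sub_eq_zero.1 this.symm)

theorem distInf_equivClass (hΩ : IsOpen Ω) (hfin : volume Ω ≠ ⊤) (hu₀ : u₀ ∈ W11Circle Ω)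
    (hv₀ : v₀ ∈ W11Circle Ω) :
    distInf Ω (equivClass Ω u₀) (equivClass Ω v₀)
      = ENNReal.ofReal (2 / Real.pi) * Sig Ω fun x => u₀ x * conj (v₀ x) :=
  le_antisymm (distInf_le_Sig hΩ hfin hu₀ hv₀) (le_distInf hΩ hfin u₀ v₀)

theorem distSup_equivClass (hΩ : IsOpen Ω) (hfin : volume Ω ≠ ⊤) (i : Fin N)
    (hu₀ : u₀ ∈ W11Circle Ω) (hv₀ : v₀ ∈ W11Circle Ω) :
    distSup Ω (equivClass Ω u₀) (equivClass Ω v₀) = Sig Ω fun x => u₀ x * conj (v₀ x) := by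
  refine le_antisymm (iSup₂_le fun u hu => ?_) (Sig_le_distSup hΩ hfin i hu₀ hv₀)
  refine (distTo_le_Sig hΩ hfin hu.1 hv₀).trans
    (Sig_le_of_equivalent_right hΩ (mul_conj_mem hΩ hfin hu₀ hv₀) ?_)
  exact hu.2.symm.mul (Equivalent.refl hfin _)

theorem one_mem_W11Circle (hΩ : IsOpen Ω) (hfin : volume Ω ≠ ⊤) :
    (fun _ => 1 : Space N → ℂ) ∈ W11Circle Ω := by
  obtain ⟨hi, b, hb, hbi⟩ := memW11_iff.1 (memW11_const hfin 0)
  simpa using (isCircleMap_exp hΩ hb hbi).mem_W11Circle hfin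

theorem equivClass_one : equivClass Ω (fun _ => 1) = liftable Ω := by
  simp [equivClass, liftable, Equivalent]

theorem notMem_liftable_of_equivalent {u v : Space N → ℂ} (hu : u ∈ W11Circle Ω)
    (hu' : u ∉ liftable Ω) (h : Equivalent Ω v u) : v ∉ liftable Ω := by
  rw [← equivClass_one] at hu' ⊢
  exact fun hv => hu' ⟨hu, h.symm.trans hv.2⟩

end NotLiftable

end CircleSobolev

end

theorem theorem1p1 (N : ℕ) (hN : 2 ≤ N) (Ω : Set (CircleSobolev.Space N))
    (hΩ : CircleSobolev.IsSmoothBoundedDomain Ω) :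
    (∀ u₀ ∈ CircleSobolev.W11Circle Ω, ∀ v₀ ∈ CircleSobolev.W11Circle Ω,
      CircleSobolev.distInf Ω (CircleSobolev.equivClass Ω u₀) (CircleSobolev.equivClass Ω v₀)
          = ENNReal.ofReal (2 / Real.pi) * CircleSobolev.Sig Ω (fun x => u₀ x * conj (v₀ x)) ∧
      CircleSobolev.distSup Ω (CircleSobolev.equivClass Ω u₀) (CircleSobolev.equivClass Ω v₀)
          = CircleSobolev.Sig Ω (fun x => u₀ x * conj (v₀ x)) ∧
      CircleSobolev.distSup Ω (CircleSobolev.equivClass Ω u₀) (CircleSobolev.equivClass Ω v₀)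
          = CircleSobolev.distSup Ω (CircleSobolev.equivClass Ω v₀)
              (CircleSobolev.equivClass Ω u₀)) ∧
    (∀ u ∈ CircleSobolev.W11Circle Ω,
      ENNReal.ofReal (2 / Real.pi) * CircleSobolev.Sig Ω u
          ≤ CircleSobolev.distTo Ω u (CircleSobolev.liftable Ω) ∧
      CircleSobolev.distTo Ω u (CircleSobolev.liftable Ω) ≤ CircleSobolev.Sig Ω u) ∧
    IsLUB ((fun u => CircleSobolev.distTo Ω u (CircleSobolev.liftable Ω) / CircleSobolev.Sig Ω u) ''
      (CircleSobolev.W11Circle Ω \ CircleSobolev.liftable Ω)) 1 ∧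
    IsGLB ((fun u => CircleSobolev.distTo Ω u (CircleSobolev.liftable Ω) / CircleSobolev.Sig Ω u) ''
      (CircleSobolev.W11Circle Ω \ CircleSobolev.liftable Ω))
      (ENNReal.ofReal (2 / Real.pi)) := by
  have hfin : volume Ω ≠ ⊤ := hΩ.isBounded.measure_lt_top.ne
  have h1 := CircleSobolev.one_mem_W11Circle hΩ.isOpen hfin
  have hupper : ∀ u ∈ CircleSobolev.W11Circle Ω,
      CircleSobolev.distTo Ω u (CircleSobolev.liftable Ω) ≤ CircleSobolev.Sig Ω u := by
    intro u hu
    simpa [CircleSobolev.equivClass_one] using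
      CircleSobolev.distTo_le_Sig hΩ.isOpen hfin hu h1
  have hlower : ∀ u ∈ CircleSobolev.W11Circle Ω,
      ENNReal.ofReal (2 / Real.pi) * CircleSobolev.Sig Ω u
        ≤ CircleSobolev.distTo Ω u (CircleSobolev.liftable Ω) := by
    intro u hu
    have h2 := CircleSobolev.le_distInf hΩ.isOpen hfin u fun _ => 1
    rw [CircleSobolev.equivClass_one] at h2
    simp only [map_one, mul_one] at h2
    exact h2.trans (iInf₂_le u ⟨hu, CircleSobolev.Equivalent.refl hfin u⟩)
  have hpos : ∀ u ∈ CircleSobolev.W11Circle Ω \ CircleSobolev.liftable Ω,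
      CircleSobolev.Sig Ω u ≠ 0 := fun u hu h =>
    hu.2 (CircleSobolev.mem_liftable_of_Sig_eq_zero hΩ hu.1 h)
  have hlt : ∀ u ∈ CircleSobolev.W11Circle Ω, CircleSobolev.Sig Ω u ≠ ⊤ := fun u hu =>
    (CircleSobolev.Sig_lt_top hΩ.isOpen hfin hu).ne
  obtain ⟨u₀, hu₀, hu₀l⟩ := hΩ.exists_notMem_liftable hN
  have hS0 := hpos u₀ ⟨hu₀, hu₀l⟩
  have hSt := hlt u₀ hu₀
  -- On this one non-liftable class the denominator Σ is constant, so the supremum and infimum of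
  -- the ratio over it are Dist/Σ and dist/Σ; both optimal constants are found inside a single
  -- class.
  have hclass : ∀ u ∈ CircleSobolev.equivClass Ω u₀,
      u ∈ CircleSobolev.W11Circle Ω \ CircleSobolev.liftable Ω ∧
        CircleSobolev.Sig Ω u = CircleSobolev.Sig Ω u₀ := fun u hu =>
    ⟨⟨hu.1, CircleSobolev.notMem_liftable_of_equivalent hu₀ hu₀l hu.2⟩,
      le_antisymm (CircleSobolev.Sig_le_of_equivalent_right hΩ.isOpen hu₀ hu.2.symm)
        (CircleSobolev.Sig_le_of_equivalent_right hΩ.isOpen hu.1 hu.2)⟩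
  have hsup := CircleSobolev.distSup_equivClass hΩ.isOpen hfin ⟨0, by omega⟩ hu₀ h1
  have hinf := CircleSobolev.distInf_equivClass hΩ.isOpen hfin hu₀ h1
  simp only [CircleSobolev.equivClass_one, map_one, mul_one] at hsup hinf
  refine ⟨fun u₀ hu₀ v₀ hv₀ =>
    ⟨CircleSobolev.distInf_equivClass hΩ.isOpen hfin hu₀ hv₀,
      CircleSobolev.distSup_equivClass hΩ.isOpen hfin ⟨0, by omega⟩ hu₀ hv₀, ?_⟩,
    fun u hu => ⟨hlower u hu, hupper u hu⟩, ⟨?_, fun c hc => ?_⟩, ?_, fun c hc => ?_⟩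
  · rw [CircleSobolev.distSup_equivClass hΩ.isOpen hfin ⟨0, by omega⟩ hu₀ hv₀,
      CircleSobolev.distSup_equivClass hΩ.isOpen hfin ⟨0, by omega⟩ hv₀ hu₀,
      CircleSobolev.Sig_mul_conj_comm hΩ.isOpen hfin hu₀ hv₀]
  · rintro _ ⟨u, hu, rfl⟩
    exact ENNReal.div_le_of_le_mul (by simpa using hupper u hu.1)
  · have h2 : CircleSobolev.Sig Ω u₀ ≤ c * CircleSobolev.Sig Ω u₀ := by
      conv_lhs => rw [← hsup]
      refine iSup₂_le fun u hu => ?_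
      have h3 := hc ⟨u, (hclass u hu).1, rfl⟩
      simp only [(hclass u hu).2] at h3
      exact (ENNReal.div_le_iff hS0 hSt).1 h3
    rw [← ENNReal.div_le_iff hS0 hSt, ENNReal.div_self hS0 hSt] at h2
    exact h2
  · rintro _ ⟨u, hu, rfl⟩
    exact (ENNReal.le_div_iff_mul_le (Or.inl (hpos u hu)) (Or.inl (hlt u hu.1))).2 (hlower u hu.1)
  · have h2 : c * CircleSobolev.Sig Ω u₀
        ≤ ENNReal.ofReal (2 / Real.pi) * CircleSobolev.Sig Ω u₀ := by
      rw [← hinf]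
      refine le_iInf₂ fun u hu => ?_
      have h3 := hc ⟨u, (hclass u hu).1, rfl⟩
      simp only [(hclass u hu).2] at h3
      exact (ENNReal.le_div_iff_mul_le (Or.inl hS0) (Or.inl hSt)).1 h3
    rw [← ENNReal.le_div_iff_mul_le (Or.inl hS0) (Or.inl hSt), mul_div_assoc,
      ENNReal.div_self hS0 hSt, mul_one] at h2
    exact h2
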